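/- **Setting.** Let $\mathcal A=[0,1)\times[0,1)$ with Lebesgue measure $\lambda$, and let $\bar{\mathcal R}_\alpha(x,y)=(x+\alpha \bmod 1,\,y)$. For $Q,N\ge 1$ let $\mathcal I_Q\otimes\mathcal I_N$ be the partition of $\mathcal A$ into the rectangles $[\frac iQ,\frac{i+1}Q)\times[\frac jN,\frac{j+1}N)$. Given positive integers $k_n,l_n$ put $p_0=0$, $q_0=1$, $p_{n+1}=p_nq_nk_nl_n+1$, $q_{n+1}=k_nl_nq_n^2$, $\alpha_n=p_n/q_n$; let $s_n$ be integers with $s_0\ge2$, $s_n\mid s_{n+1}$, $s_n\mid k_n$; let $\xi_n=\mathcal I_{q_n}\otimes\mathcal I_{s_n}$ with atoms $R^n_{i,j}=[\frac i{q_n},\frac{i+1}{q_n})\times[\frac j{s_n},\frac{j+1}{s_n})$. *The untwisted abstract Anosov–Katok method.* Let $h_{n+1}$ ($n\ge0$) be invertible measure preserving maps of $\mathcal A$ which commute with $\bar{\mathcal R}_{\alpha_n}$, permute the atoms of $\mathcal I_{k_nq_n}\otimes\mathcal I_{s_{n+1}}$ inside $[0,1/q_n)\times[0,1)$, and permute the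 atoms of $\xi_m$ for every $m\ge n+1$. Let $Z:\mathcal A\to X$ be an isomorphism with a probability space $(X,\mathcal B,\mu)$, $Z_n=Z\circ h_1\circ\dots\circ h_n$ and $T_n=Z_n\bar{\mathcal R}_{\alpha_n}Z_n^{-1}$. An invertible measure preserving $T$ of $X$ is *built from these data* if $T_n\to T$ weakly, i.e. $\mu(T_nC\,\triangle\,TC)\to0$ for all measurable $C$. Requirement 1: $s_n\to\infty$. Requirement 2: for all $j<s_n$, $\sigma<s_{n+1}$ exactly $k_n/s_n$ of the $t<k_n$ satisfy $h_{n+1}([\frac t{k_nq_n},\frac{t+1}{k_nq_n})\times[\frac \sigma{s_{n+1}},\frac{\sigma+1}{s_{n+1}}))\subseteq R^n_{0,j}$. Requirement 3: writing $j_t=j_t(\sigma)$ for the index with $h_{n+1}([\frac t{k_nq_n},\frac{t+1}{k_nq_n})\times[\frac \sigma{s_{n+1}},\frac{\sigma+1}{s_{n+1}}))\subseteq R^n_{0,j_t}$, the map $\sigma\mapsto(j_0,\dots,j_{k_n-1})$ is one-to-one. *Words.* Put $\mathcal C_n(w_0,\dots,w_{k_n-1})=\prod_{i<q_n}\prod_{j<k_n}b^{\,q_n-j_i}w_j^{\,l_n-1}e^{\,j_i}$,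 where here $j_i=p_n^{-1}i \bmod q_n$, $0\le j_i<q_n$. Let $u^0_\sigma=a_\sigma$ for $\sigma<s_0$ and $u^{n+1}_\sigma=\mathcal C_n(u^n_{j_0(\sigma)},\dots,u^n_{j_{k_n-1}(\sigma)})$ for $\sigma<s_{n+1}$. Let $\mathcal W_n=\{u^n_\sigma:\sigma<s_n\}$, let $P_{n+1}$ be the set of the tuples ("prewords") $(u^n_{j_0(\sigma)},\dots,u^n_{j_{k_n-1}(\sigma)})$, and let $\mathbb K$ be the set of all $x\in\{a_i,b,e\}^{\mathbb Z}$ every finite subword of which occurs in some word of some $\mathcal W_n$. Let $S\subseteq\mathbb K$ be the set of $x\in\mathbb K$ for which there are $a_m,b_m\to\infty$ with $x\restriction[-a_m,b_m)\in\mathcal W_m$ for all large $m$. *Names.* The rotation by $\alpha_{n+1}$ permutes the intervals $[\frac i{q_{n+1}},\frac{i+1}{q_{n+1}})$ in one cycle; number them $0,\dots,q_{n+1}-1$ along it, starting from $i=0$. Label an interval $b$ or $e$ (at stage $n+1$) if at its number the word $\mathcal C_n(w_0,\dots,w_{k_n-1})$ (with $|w_j|=q_n$) has a letter $b$ or $e$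 outside the $w_j$. A point $x\in X$ is labelled at stage $n+1$ like the interval below $Z_{n+1}^{-1}x$. Let $B$ (resp. $E$) be the set of points that have a last label and whose last label is $b$ (resp. $e$), let $A_i=Z([0,1)\times[\frac i{s_0},\frac{i+1}{s_0}))\setminus(B\cup E)$, and $\mathcal Q=\{A_i:i<s_0\}\cup\{B,E\}$. The $\mathcal Q$-name $\phi(x)\in\{a_i,b,e\}^{\mathbb Z}$ records the atoms that contain the points $T^mx$. A set of words is uniquely readable if $uv=pws$ with $u,v,w$ in it forces $p$ or $s$ to be empty. A *circular construction sequence* with coefficients $k_n\ge2$, $l_n$, $\sum1/l_n<\infty$, is a sequence $\mathcal W_0$ = a set of letters, $\mathcal W_{n+1}=\mathcal C_n[P_{n+1}]$, $P_{n+1}\subseteq\mathcal W_n^{k_n}$, where each $\mathcal W_n$ is uniquely readable with all words of length $q_n$, each $P_{n+1}$ is uniquely readable as a set of words in the letters $\mathcal W_n$ (strong unique readability), every word of $\mathcal W_{n+1}$ contains every word of $\mathcal W_n$, and every word of $\mathcal W_{n+1}$ is uniquely parsed into words of $\mathcal W_n$ (their occurrences do not overlap) and spacers of summably small proportion. It is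 *strongly uniform* if the number of occurrences of $w\in\mathcal W_n$ in $w'\in\mathcal W_{n+1}$ depends only on $n$. **Theorem.** There are functions $l_n^*=l_n^*(k_0,\dots,k_n,l_0,\dots,l_{n-1})$ such that for all data as above with $l_n\ge l_n^*$ for all $n$ and with Requirements 1–3 the following hold. 1. $|\mathcal W_n|=s_n$, $\mathcal W_{n+1}=\mathcal C_n[P_{n+1}]$ with $P_{n+1}\subseteq\mathcal W_n^{k_n}$, and every word of $\mathcal W_n$ occurs exactly $k_n/s_n$ times in every preword of $P_{n+1}$. If each $P_{n+1}$ satisfies strong unique readability, then $\langle\mathcal W_n\rangle$ is a strongly uniform circular construction sequence. 2. There is a unique non-atomic shift-invariant Borel probability measure $\nu$ on $\mathbb K$, and $\nu$ is ergodic. 3. Let $(X,\mathcal B,\mu,T)$ be built from the data. For almost every $x$ and all large $n$: if $x\in Z_nR^n_{i,\sigma}$ and $t=p_n^{-1}i\bmod q_n$, then the $\mathcal Q$-name of $x$ restricted to $[-t,q_n-t)$ is $u^n_\sigma$. The name map $\phi$ is one-to-one on a measurable set of $\mu$-measure one, maps it into $S\subseteq\mathbb K$, and $\nu$ concentrates on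 its image. The map $\phi$ is an isomorphism, modulo null sets, between $(X,\mathcal B,\mu,T)$ and $(\mathbb K,\mathcal B,\nu,\mathrm{sh})$; in particular $T$ is ergodic. 4. (Diffeomorphisms.) Let $F$ be a $C^\infty$ diffeomorphism of the closed unit disk that is built by the smooth method from the data: in the polar coordinates $(x,y)\mapsto\sqrt y\,e^{2\pi ix}$ there are area preserving $C^\infty$ diffeomorphisms $g_{n+1}$ of the disk that are the identity near the centre and near the boundary, commute with the rotation by $\alpha_n$, and move, off a set of measure at most $\varepsilon_n$ with $\sum\varepsilon_n<\infty$, the points of each atom $R$ of each $\xi_m$ ($m\ge n+1$) into $h_{n+1}(R)$; and $H_n\circ(\text{rotation by }\alpha_n)\circ H_n^{-1}\to F$ in $C^\infty$, where $H_n=g_1\circ\dots\circ g_n$. Then $F$ with normalized area is isomorphic to $(\mathbb K,\mathcal B,\nu,\mathrm{sh})$. -/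

import Mathlib

open MeasureTheory Filter Topology
open scoped ENNReal ContDiff symmDiff

universe u

/-! ### Words in the alphabet `Σ ∪ {b, e}` -/

/-- The alphabet `S ∪ {b, e}`, where `b, e` are two new symbols. -/
inductive Symb (S : Type u) : Type u
  | letter (a : S) : Symb S
  | b : Symb S
  | e : Symb S

instance (S : Type u) : MeasurableSpace (Symb S) := ⊤

/-- A collection of words is uniquely readable iff `u v = p w s` with `u, v, w` in the collection
forces `p` or `s` to be empty. -/
def UniquelyReadable {α : Type u} (W : Set (List α)) : Prop :=
  ∀ u ∈ W, ∀ v ∈ W, ∀ w ∈ W, ∀ p s : List α, u ++ v = p ++ w ++ s → p = [] ∨ s = []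

/-- `w` occurs in `u` at position `i`. -/
def OccursAt {α : Type u} (w u : List α) (i : ℕ) : Prop := w <+: u.drop i

/-- The word `x(a) x(a+1) ⋯ x(a+m-1)` of a bi-infinite sequence. -/
def block {α : Type u} (x : ℤ → α) (a : ℤ) (m : ℕ) : List α :=
  List.ofFn fun i : Fin m => x (a + (i : ℕ))

/-- The shift `sh(x)(n) = x(n+1)`. -/
def shift {α : Type u} (x : ℤ → α) : ℤ → α := fun n => x (n + 1)

/-- Construction sequences of words, the words in `W n` having length `q n`.  Every word of
`W (n+1)` is uniquely parsed into words of `W n` and spacers: the occurrences of words of `W n` in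
it do not overlap, and the letters outside them (the spacers) make up a summably small
proportion. -/
structure IsConstructionSequence {α : Type u} (q : ℕ → ℕ) (W : ℕ → Set (List α)) : Prop where
  readable : ∀ n, UniquelyReadable (W n)
  length_eq : ∀ n, ∀ w ∈ W n, w.length = q n
  contains : ∀ n, ∀ w' ∈ W (n + 1), ∀ w ∈ W n, w <:+: w'
  parsing : ∀ n, ∀ w' ∈ W (n + 1), ∀ w₁ ∈ W n, ∀ w₂ ∈ W n, ∀ i₁ i₂ : ℕ,
    OccursAt w₁ w' i₁ → OccursAt w₂ w' i₂ → i₁ < i₂ → i₁ + q n ≤ i₂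
  spacers : ∃ ε : ℕ → ℝ, (∀ n, 0 < ε n) ∧ Summable ε ∧ ∀ n, ∀ w' ∈ W (n + 1),
    (Set.ncard {m : ℕ | m < w'.length ∧ ∀ w ∈ W n, ∀ i : ℕ, OccursAt w w' i →
      ¬ (i ≤ m ∧ m < i + q n)} : ℝ) / (q (n + 1) : ℝ) < ε (n + 1)

/-- Strong uniformity: the number of occurrences of `w ∈ W n` in `w' ∈ W (n+1)` depends only
on `n`. -/
def IsStronglyUniform {α : Type u} (W : ℕ → Set (List α)) : Prop :=
  ∀ n, ∃ f : ℕ, ∀ w ∈ W n, ∀ w' ∈ W (n + 1), Set.ncard {i : ℕ | OccursAt w w' i} = f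

/-- The symbolic shift `𝕂` of a sequence of collections of words: all bi-infinite sequences each of
whose finite subwords occurs in some word of some `W n`. -/
def symbolicShift {α : Type u} (W : ℕ → Set (List α)) : Set (ℤ → α) :=
  {x | ∀ (a : ℤ) (m : ℕ), ∃ n, ∃ w ∈ W n, block x a m <:+: w}

/-- The set `S ⊆ 𝕂` of those `x` for which there are `a_m, b_m → ∞` such that
`x ↾ [-a_m, b_m) ∈ W m` for all large `m`. -/
def coreSet {α : Type u} (W : ℕ → Set (List α)) : Set (ℤ → α) :=
  {x | x ∈ symbolicShift W ∧ ∃ a b : ℕ → ℕ, Tendsto a atTop atTop ∧ Tendsto b atTop atTop ∧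
    ∀ᶠ m in atTop, block x (-(a m : ℤ)) (a m + b m) ∈ W m}

/-! ### Circular systems -/

/-- The pairs `(p_n, q_n)`: `p_0 = 0`, `q_0 = 1`, `p_{n+1} = p_n q_n k_n l_n + 1`,
`q_{n+1} = k_n l_n q_n ^ 2`. -/
def coefPQ (k l : ℕ → ℕ) : ℕ → ℕ × ℕ
  | 0 => (0, 1)
  | n + 1 => ((coefPQ k l n).1 * (coefPQ k l n).2 * k n * l n + 1,
      k n * l n * (coefPQ k l n).2 ^ 2)

def coefP (k l : ℕ → ℕ) (n : ℕ) : ℕ := (coefPQ k l n).1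

def coefQ (k l : ℕ → ℕ) (n : ℕ) : ℕ := (coefPQ k l n).2

/-- `α_n = p_n / q_n`. -/
noncomputable def coefAlpha (k l : ℕ → ℕ) (n : ℕ) : ℝ := (coefP k l n : ℝ) / (coefQ k l n : ℝ)

/-- `j_i = p⁻¹ i mod q`, with `0 ≤ j_i < q` (for `q > 0`). -/
def dynIndex (p q i : ℕ) : ℕ := ((p : ZMod q)⁻¹ * (i : ZMod q)).val

/-- The circular operator
`𝒞(w_0, …, w_{k-1}) = ∏_{i<q} ∏_{j<k} b^{q-j_i} w_j^{l-1} e^{j_i}`; here `v = [w_0, …, w_{k-1}]`. -/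
def circOp {S : Type u} (l p q : ℕ) (v : List (List (Symb S))) : List (Symb S) :=
  (List.range q).flatMap fun i => v.flatMap fun w =>
    List.replicate (q - dynIndex p q i) Symb.b ++ (List.replicate (l - 1) w).flatten ++
      List.replicate (dynIndex p q i) Symb.e

/-- `W` is a circular construction sequence in the alphabet `A ∪ {b, e}` with coefficients
`k, l` and sets of prewords `P n ⊆ (W n)^{k n}` (so `W (n+1)` is obtained from `P n`).  The field
`strong` is strong unique readability: the prewords, as words in the alphabet `W n`, are uniquely
readable. -/
structure IsCircularConstruction {S : Type u} (A : Set S) (k l : ℕ → ℕ)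
    (P : ℕ → Set (List (List (Symb S)))) (W : ℕ → Set (List (Symb S))) : Prop where
  two_le_k : ∀ n, 2 ≤ k n
  l_pos : ∀ n, 0 < l n
  summable_l : Summable fun n => 1 / (l n : ℝ)
  construction : IsConstructionSequence (coefQ k l) W
  alphabet_nonempty : A.Nonempty
  base : W 0 = (fun a => [Symb.letter a]) '' A
  prewords : ∀ n, ∀ v ∈ P n, v.length = k n ∧ ∀ w ∈ v, w ∈ W n
  step : ∀ n, W (n + 1) = circOp (l n) (coefP k l n) (coefQ k l n) '' P n
  strong : ∀ n, UniquelyReadable (P n)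

/-! ### Measure-theoretic notions -/

/-- `ν` is a non-atomic shift-invariant Borel probability measure on `K`. -/
structure IsNonatomicInvariant {α : Type u} [MeasurableSpace α] (K : Set (ℤ → α))
    (ν : Measure (ℤ → α)) : Prop where
  prob : IsProbabilityMeasure ν
  concentrated : ν Kᶜ = 0
  nonatomic : ∀ x, ν {x} = 0
  invariant : MeasurePreserving shift ν ν

/-- `φ` is an isomorphism, modulo null sets, of the systems `(X, μ, T)` and `(Y, ν, R)`. -/
def IsSystemIso {X : Type*} {Y : Type*} [MeasurableSpace X] [MeasurableSpace Y]
    (μ : Measure X) (T : X → X) (ν : Measure Y) (R : Y → Y) (φ : X → Y) : Prop :=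
  MeasurePreserving φ μ ν ∧ (∀ᵐ x ∂μ, φ (T x) = R (φ x)) ∧
    ∃ ψ : Y → X, MeasurePreserving ψ ν μ ∧ (∀ᵐ x ∂μ, ψ (φ x) = x) ∧ (∀ᵐ y ∂ν, φ (ψ y) = y)

/-! ### The untwisted abstract Anosov-Katok method -/

/-- The space `𝒜 = [0,1) × [0,1)`. -/
abbrev UnitSquare : Type := Set.Ico (0 : ℝ) 1 × Set.Ico (0 : ℝ) 1

/-- Lebesgue measure on `𝒜`. -/
noncomputable def lebesgue : Measure UnitSquare :=
  (Measure.comap Subtype.val volume).prod (Measure.comap Subtype.val volume)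

/-- Horizontal rotation of `𝒜` by `α`. -/
noncomputable def rot (α : ℝ) (z : UnitSquare) : UnitSquare :=
  (⟨Int.fract ((z.1 : ℝ) + α), Int.fract_nonneg _, Int.fract_lt_one _⟩, z.2)

/-- `[i/Q, (i+1)/Q) × [j/N, (j+1)/N)`, an atom of the partition `ℐ_Q ⊗ ℐ_N` of `𝒜`
(for `i < Q`, `j < N`). -/
def cell (Q N i j : ℕ) : Set UnitSquare :=
  {z | (i : ℝ) / Q ≤ z.1 ∧ (z.1 : ℝ) < (i + 1) / Q ∧ (j : ℝ) / N ≤ z.2 ∧ (z.2 : ℝ) < (j + 1) / N}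

/-- The data of an untwisted abstract Anosov-Katok construction.  The map `h n` is the one that is
usually written `h_{n+1}`; it leads from stage `n` to stage `n + 1`. -/
structure AKData where
  k : ℕ → ℕ
  l : ℕ → ℕ
  s : ℕ → ℕ
  h : ℕ → (UnitSquare ≃ᵐ UnitSquare)
  k_pos : ∀ n, 0 < k n
  two_le_s : 2 ≤ s 0
  s_dvd_s : ∀ n, s n ∣ s (n + 1)
  s_dvd_k : ∀ n, s n ∣ k n
  measurePreserving : ∀ n, MeasurePreserving (h n) lebesgue lebesgue
  commute : ∀ n z, h n (rot (coefAlpha k l n) z) = rot (coefAlpha k l n) (h n z)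
  /-- `h n` permutes the atoms of `ℐ_{k_n q_n} ⊗ ℐ_{s_{n+1}}` inside `[0, 1/q_n) × [0,1)`. -/
  untwisted : ∀ n, ∀ t < k n, ∀ j < s (n + 1), ∃ t' < k n, ∃ j' < s (n + 1),
    h n '' cell (k n * coefQ k l n) (s (n + 1)) t j
      = cell (k n * coefQ k l n) (s (n + 1)) t' j'
  /-- `h n` permutes the atoms of `ξ_m = ℐ_{q_m} ⊗ ℐ_{s_m}` for all `m ≥ n + 1`. -/
  permutes : ∀ n m, n < m → ∀ i < coefQ k l m, ∀ j < s m, ∃ i' < coefQ k l m, ∃ j' < s m,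
    h n '' cell (coefQ k l m) (s m) i j = cell (coefQ k l m) (s m) i' j'

namespace AKData

variable (D : AKData)

def p (n : ℕ) : ℕ := coefP D.k D.l n

def q (n : ℕ) : ℕ := coefQ D.k D.l n

noncomputable def α (n : ℕ) : ℝ := coefAlpha D.k D.l n

/-- `R^n_{i,j}`, an atom of `ξ_n = ℐ_{q_n} ⊗ ℐ_{s_n}`. -/
def R (n i j : ℕ) : Set UnitSquare := cell (D.q n) (D.s n) i j

/-- The image under `h_{n+1}` of `[t/(k_n q_n), (t+1)/(k_n q_n)) × [σ/s_{n+1}, (σ+1)/s_{n+1})`. -/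
def movedCell (n t σ : ℕ) : Set UnitSquare :=
  D.h n '' cell (D.k n * D.q n) (D.s (n + 1)) t σ

def Requirement1 : Prop := Tendsto D.s atTop atTop

/-- Strong uniformity of the maps `h_{n+1}`. -/
def Requirement2 : Prop :=
  ∀ n, ∀ j < D.s n, ∀ σ < D.s (n + 1),
    Set.ncard {t : ℕ | t < D.k n ∧ D.movedCell n t σ ⊆ D.R n 0 j} = D.k n / D.s n

/-- The index `j_t` with `h_{n+1}([t/(k_n q_n), (t+1)/(k_n q_n)) × [σ/s_{n+1}, (σ+1)/s_{n+1}))`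
contained in `R^n_{0, j_t}`. -/
noncomputable def stripIndex (n σ t : ℕ) : ℕ :=
  sInf {j : ℕ | j < D.s n ∧ D.movedCell n t σ ⊆ D.R n 0 j}

/-- `σ ↦ (j_0, …, j_{k_n - 1})_σ` is one-to-one. -/
def Requirement3 : Prop :=
  ∀ n, ∀ σ < D.s (n + 1), ∀ σ' < D.s (n + 1),
    (∀ t < D.k n, D.stripIndex n σ t = D.stripIndex n σ' t) → σ = σ'

/-- `l_n ≥ l*_n(k_0, …, k_n, l_0, …, l_{n-1})` for all `n`. -/
def GrowsFasterThan (lstar : (n : ℕ) → (Fin (n + 1) → ℕ) → (Fin n → ℕ) → ℕ) : Prop :=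
  ∀ n, lstar n (fun i => D.k i) (fun i => D.l i) ≤ D.l n

/-! #### The words of the towers -/

/-- The word of the `σ`-th tower of the `n`-th periodic approximation: `a_σ` for `n = 0`, and
`𝒞_n(w_0, …, w_{k_n - 1})` at stage `n + 1`, where `w_t` is the word of the `n`-tower with
index `j_t`. -/
noncomputable def towerWord : ℕ → ℕ → List (Symb ℕ)
  | 0, σ => [Symb.letter σ]
  | n + 1, σ => circOp (D.l n) (D.p n) (D.q n)
      ((List.range (D.k n)).map fun t => towerWord n (D.stripIndex n σ t))

/-- The words `𝒲_n`. -/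
def words (n : ℕ) : Set (List (Symb ℕ)) := {w | ∃ σ < D.s n, w = D.towerWord n σ}

/-- The prewords from which `𝒲_{n+1}` is formed. -/
def prewords (n : ℕ) : Set (List (List (Symb ℕ))) :=
  {v | ∃ σ < D.s (n + 1),
    v = (List.range (D.k n)).map fun t => D.towerWord n (D.stripIndex n σ t)}

/-- The shift space `𝕂` of the words `𝒲_n`. -/
def K : Set (ℤ → Symb ℕ) := symbolicShift D.words

/-! #### The partition and the names -/

/-- The word `∏_{i<q} ∏_{j<k} b^{q-j_i} w_j^{l-1} e^{j_i}` of length `q_{n+1}` with the letters of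
the `w_j` replaced by a single symbol. -/
def skeleton (n : ℕ) : List (Symb Unit) :=
  circOp (D.l n) (D.p n) (D.q n)
    (List.replicate (D.k n) (List.replicate (D.q n) (Symb.letter ())))

/-- The points of `𝒜` labelled `c` at stage `n + 1`: those over the intervals
`[i/q_{n+1}, (i+1)/q_{n+1})` whose place `j_i = p_{n+1}⁻¹ i mod q_{n+1}` in the orbit of
`[0, 1/q_{n+1})` under the rotation by `α_{n+1}` carries the symbol `c` in the skeleton. -/
def labelled (n : ℕ) (c : Symb Unit) : Set UnitSquare :=
  {z | ∃ i < D.q (n + 1), (i : ℝ) / D.q (n + 1) ≤ z.1 ∧ (z.1 : ℝ) < (i + 1) / D.q (n + 1) ∧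
    (D.skeleton n)[dynIndex (D.p (n + 1)) (D.q (n + 1)) i]? = some c}

variable {X : Type u} [MeasurableSpace X]

/-- `Z_0 = Z` and `Z_n = Z ∘ h_1 ∘ ⋯ ∘ h_n`. -/
def Zmap (Z : UnitSquare ≃ᵐ X) : ℕ → (UnitSquare ≃ᵐ X)
  | 0 => Z
  | n + 1 => (D.h n).trans (Zmap Z n)

/-- `T_n = Z_n ∘ R_{α_n} ∘ Z_n⁻¹`. -/
noncomputable def approx (Z : UnitSquare ≃ᵐ X) (n : ℕ) (x : X) : X :=
  D.Zmap Z n (rot (D.α n) ((D.Zmap Z n).symm x))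

/-- `T` is built from the data: it is the limit of the `T_n` in the weak topology. -/
def IsLimit (Z : UnitSquare ≃ᵐ X) (μ : Measure X) (T : X ≃ᵐ X) : Prop :=
  ∀ C : Set X, MeasurableSet C →
    Tendsto (fun n => μ ((D.approx Z n '' C) ∆ (T '' C))) atTop (𝓝 0)

/-- The points whose last spacer label is `c` (for `c = b, e`): `x` is labelled `c` at some stage
and gets no label at any later stage. -/
def lastLabelled (Z : UnitSquare ≃ᵐ X) (c : Symb Unit) : Set X :=
  {x | ∃ n, (D.Zmap Z (n + 1)).symm x ∈ D.labelled n c ∧ ∀ m, n < m →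
    (D.Zmap Z (m + 1)).symm x ∉ D.labelled m Symb.b ∧
    (D.Zmap Z (m + 1)).symm x ∉ D.labelled m Symb.e}

open Classical in
/-- The atom of the partition `𝒬` that contains `x`: `B` and `E` are the points whose last spacer
label is `b`, respectively `e`, and `A_i`, for `i < s_0`, is `Z([0,1) × [i/s_0, (i+1)/s_0))`
without `B` and `E`. -/
noncomputable def atomOf (Z : UnitSquare ≃ᵐ X) (x : X) : Symb ℕ :=
  if x ∈ D.lastLabelled Z Symb.b then Symb.b
  else if x ∈ D.lastLabelled Z Symb.e then Symb.e
  else Symb.letter ⌊(D.s 0 : ℝ) * ((Z.symm x).2 : ℝ)⌋₊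

/-- The `𝒬`-name of `x` under `T`. -/
noncomputable def name (Z : UnitSquare ≃ᵐ X) (T : X ≃ᵐ X) (x : X) : ℤ → Symb ℕ :=
  fun i => D.atomOf Z (((T.toEquiv : Equiv.Perm X) ^ i) x)

end AKData

/-! ### Anosov-Katok diffeomorphisms of the disk -/

/-- Area on the closed unit disk, normalized to total mass one. -/
noncomputable def diskMeasure : Measure ℂ :=
  (ENNReal.ofReal Real.pi)⁻¹ • (volume : Measure ℂ).restrict (Metric.closedBall 0 1)

/-- Area-preserving polar coordinates: they turn Lebesgue measure on `𝒜` into normalized area, and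
horizontal rotations of `𝒜` into rotations of the disk. -/
noncomputable def polar (z : UnitSquare) : ℂ :=
  (Real.sqrt (z.2 : ℝ) : ℂ) * Complex.exp (2 * Real.pi * Complex.I * ((z.1 : ℝ) : ℂ))

/-- Rotation of the plane by `α` full turns. -/
noncomputable def rotC (α : ℝ) (z : ℂ) : ℂ :=
  Complex.exp (2 * Real.pi * Complex.I * (α : ℂ)) * z

/-- `H_0 = id` and `H_n = g_1 ∘ ⋯ ∘ g_n` (where `g n` stands for `g_{n+1}`). -/
def composed (g : ℕ → (ℂ ≃ ℂ)) : ℕ → (ℂ ≃ ℂ)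
  | 0 => Equiv.refl ℂ
  | n + 1 => (g n).trans (composed g n)

/-- `S_n = H_n ∘ R_{α_n} ∘ H_n⁻¹`. -/
noncomputable def AKData.smoothApprox (D : AKData) (g : ℕ → (ℂ ≃ ℂ)) (n : ℕ) (z : ℂ) : ℂ :=
  composed g n (rotC (D.α n) ((composed g n).symm z))

/-- `S` is a diffeomorphism of the closed unit disk that is built by the smooth Anosov-Katok method
from the data `D`, with the smooth maps `g_{n+1}` in place of `h_{n+1}`.  A diffeomorphism of the
disk that is the identity near the boundary circle is written as its extension by the identity
to `ℂ`. -/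
structure AKData.IsDiskRealization (D : AKData) (g : ℕ → (ℂ ≃ ℂ)) (S : ℂ → ℂ) : Prop where
  smooth : ∀ n, ContDiff ℝ ∞ (g n) ∧ ContDiff ℝ ∞ (g n).symm
  areaPreserving : ∀ n, MeasurePreserving (g n) volume volume
  /-- `g_{n+1}` is the identity near the centre and near the boundary of the disk. -/
  boundary : ∀ n, ∃ δ > 0, ∀ z : ℂ, ‖z‖ ≤ δ ∨ 1 - δ ≤ ‖z‖ → g n z = z
  commute : ∀ n z, g n (rotC (D.α n) z) = rotC (D.α n) (g n z)
  /-- Off sets of summable measure, `g_{n+1}` moves the atoms of `ξ_m`, `m ≥ n + 1`, as `h_{n+1}`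
  does. -/
  obeys : ∃ ε : ℕ → ℝ≥0∞, ∑' n, ε n ≠ ⊤ ∧ ∀ n, ∃ L : Set UnitSquare, MeasurableSet L ∧
    lebesgue Lᶜ ≤ ε n ∧ ∀ m, n < m → ∀ i < D.q m, ∀ j < D.s m, ∀ x ∈ L ∩ D.R m i j,
      g n (polar x) ∈ polar '' (D.h n '' D.R m i j)
  bijOn : Set.BijOn S (Metric.closedBall 0 1) (Metric.closedBall 0 1)
  contDiffOn : ContDiffOn ℝ ∞ S (Metric.closedBall 0 1)
  /-- `S_n → S` in the `C^∞` topology. -/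
  converges : ∀ r : ℕ, TendstoUniformlyOn
    (fun n => iteratedFDerivWithin ℝ r (D.smoothApprox g n) (Metric.closedBall 0 1))
    (iteratedFDerivWithin ℝ r S (Metric.closedBall 0 1)) atTop (Metric.closedBall 0 1)

/-! ### The letters of circular words -/

/-! Everything rests on one computation. Let `pos n x` be the level of `x` in its `n`-tower, counted
along the orbit of the rotation by `α_n`, and `tow n x` the index of that tower. Because `p_{n+1} =
p_n q_n k_n l_n + 1`, passing from stage `n + 1` to stage `n` sends the level `t` to `t + p_n⁻¹ i
mod q_n`, where `i = t / (k_n l_n q_n)` (`Admissible.pos_succ`). This is the offset `j_i` built into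
`𝒞_n`. Hence climbing the towers and reading circular words are the same thing away from the
spacers.

Recognition: every word of `𝒲_n` starts with the same number of `b` and ends with the same number of
`e`, so consecutive words of `𝒲_n` in a longer word are separated by a long run of `e` followed by a
long run of `b`, a switch. For `n ≥ 2` no word of `𝒲_n` contains such a switch
(`Admissible.not_isSwitch`), so its occurrences in longer words are exactly the ones put there by
the construction (`Admissible.exists_piece`, `Admissible.exists_parent`). Unique readability of
prewords is needed for recognition only at stage 1, where the offsets vanish and there are no `e`.

The measure: with `l_n ≥ 2^(n+2) q_n k_n`, spacers and tower ends have summable measure, so by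
Borel-Cantelli the tower words around almost every point are nested and converge to a sequence
`limName`. Its law `nameLaw` is `ν`. By recognition the sequence determines the level and the tower
of the point at all late stages, hence the point, since the atoms of `ξ_n` shrink; so `ν` has no
atoms. Uniqueness: strong uniformity gives all words of `𝒲_n` the same frequency under any invariant
measure on `𝕂`, and sequences whose position `0` is never covered by words carry no mass, because
sequences made of spacers only are countably many. Conditioning on an invariant set then gives
ergodicity.

The map `T`: the spacers of all stages `m ≥ n` have measure at most `2^(-n) / q_n`, so an orbit
segment of length about `q_n` avoids them; off them the weak limit `T` climbs the `n`-towers as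
`T_n` does. Hence the name of almost every point is `limName`. For the disk, `g_{n+1}` agrees
exactly with `h_{n+1}` in polar coordinates off a small set. Therefore the maps conjugating `T_n` to
the smooth approximations are eventually constant at almost every point, and their limit carries the
abstract result over. -/

theorem List.getElem?_flatMap_of_length {α β : Type*} {c : ℕ} (hc : 0 < c) (f : α → List β) :
    ∀ (L : List α), (∀ a ∈ L, (f a).length = c) → ∀ t : ℕ,
      (L.flatMap f)[t]? = L[t / c]?.bind fun a => (f a)[t % c]?
  | [], _, t => by simp
  | a :: L, h, t => by
    have ha : (f a).length = c := h a (by simp)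
    rw [List.flatMap_cons]
    by_cases ht : t < c
    · rw [List.getElem?_append_left (by omega), Nat.div_eq_of_lt ht, Nat.mod_eq_of_lt ht]
      simp
    · have hct : c ≤ t := not_lt.mp ht
      rw [List.getElem?_append_right (by omega), ha,
        List.getElem?_flatMap_of_length hc f L (fun a h' => h a (by simp [h'])) (t - c)]
      have h1 : t / c = (t - c) / c + 1 := Nat.div_eq_sub_div hc hct
      have h2 : t % c = (t - c) % c := Nat.mod_eq_sub_mod hct
      rw [h1, h2]
      simp

theorem List.length_flatMap_of_length {α β : Type*} {c : ℕ} (f : α → List β) :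
    ∀ (L : List α), (∀ a ∈ L, (f a).length = c) → (L.flatMap f).length = L.length * c
  | [], _ => by simp
  | a :: L, h => by
    rw [List.flatMap_cons, List.length_append, h a (by simp),
      List.length_flatMap_of_length f L (fun a h' => h a (by simp [h'])), List.length_cons]
    ring

theorem List.getElem?_flatten_replicate {β : Type*} {w : List β} {q m t : ℕ} (hw : w.length = q)
    (hq : 0 < q) (ht : t < m * q) : (List.replicate m w).flatten[t]? = w[t % q]? := by
  have := List.getElem?_flatMap_of_length hq (fun x : List β => x) (List.replicate m w)
    (by intro a ha; rw [List.eq_of_mem_replicate ha, hw]) t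
  rw [List.flatMap_id'] at this
  rw [this, List.getElem?_replicate_of_lt (Nat.div_lt_of_lt_mul (by rwa [mul_comm]))]
  rfl

/-! ### Inversion of `p` modulo `q` -/

theorem dynIndex_lt {p q : ℕ} (hq : 0 < q) (i : ℕ) : dynIndex p q i < q := by
  have : NeZero q := ⟨hq.ne'⟩
  exact ZMod.val_lt _

theorem dynIndex_le {p q : ℕ} (hq : 0 < q) (i : ℕ) : dynIndex p q i ≤ q := (dynIndex_lt hq i).le

theorem dynIndex_cast {p q : ℕ} (hq : 0 < q) (i : ℕ) :
    ((dynIndex p q i : ℕ) : ZMod q) = (p : ZMod q)⁻¹ * i := by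
  have : NeZero q := ⟨hq.ne'⟩
  rw [dynIndex, ZMod.natCast_val, ZMod.cast_id]

theorem dynIndex_zero (p q : ℕ) : dynIndex p q 0 = 0 := by
  simp [dynIndex]

theorem mul_dynIndex_cast {p q : ℕ} (hq : 0 < q) (hpq : Nat.Coprime p q) (i : ℕ) :
    (p : ZMod q) * ((dynIndex p q i : ℕ) : ZMod q) = i := by
  rw [dynIndex_cast hq, ← mul_assoc, ZMod.coe_mul_inv_eq_one _ hpq, one_mul]

theorem dynIndex_eq_of_cast {p q : ℕ} (hq : 0 < q) (hpq : Nat.Coprime p q) {i t : ℕ}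
    (h : (p : ZMod q) * t = i) : dynIndex p q i = t % q := by
  have h1 : ((dynIndex p q i : ℕ) : ZMod q) = (t : ℕ) := by
    rw [dynIndex_cast hq, ← h, ← mul_assoc, mul_comm (p : ZMod q)⁻¹,
      ZMod.coe_mul_inv_eq_one _ hpq, one_mul]
  rw [ZMod.natCast_eq_natCast_iff'] at h1
  rw [← h1, Nat.mod_eq_of_lt (dynIndex_lt hq i)]

theorem eq_zero_of_dynIndex_eq_zero {p q : ℕ} (hq : 0 < q) (hpq : Nat.Coprime p q) {i : ℕ}
    (hi : i < q) (h : dynIndex p q i = 0) : i = 0 := by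
  have h1 := mul_dynIndex_cast hq hpq i
  rw [h, Nat.cast_zero, mul_zero] at h1
  have h2 := (ZMod.natCast_eq_zero_iff i q).mp h1.symm
  exact Nat.eq_zero_of_dvd_of_lt h2 hi

theorem length_circOp_piece {S : Type u} {l q j : ℕ} (hj : j ≤ q) (hl : 0 < l)
    {w : List (Symb S)} (hw : w.length = q) :
    (List.replicate (q - j) Symb.b ++ (List.replicate (l - 1) w).flatten ++
      List.replicate j Symb.e).length = l * q := by
  obtain ⟨l, rfl⟩ : ∃ m, l = m + 1 := ⟨l - 1, by omega⟩
  simp [List.length_flatten, hw]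
  rw [add_mul]
  omega

/-- Adding `j` to the position aligns the copies of `w` with the multiples of `q`: the `q - j`
symbols `b` end exactly at shifted position `q`, and the symbols `e` start at `l * q`. -/
theorem getElem?_circOp_piece {S : Type u} {l q j r : ℕ} (hj : j ≤ q) (hl : 0 < l) (hq : 0 < q)
    {w : List (Symb S)} (hw : w.length = q) (hr : r < l * q) :
    (List.replicate (q - j) Symb.b ++ (List.replicate (l - 1) w).flatten ++
      List.replicate j Symb.e)[r]? =
      if r + j < q then some Symb.b else if r + j < l * q then w[(r + j) % q]?
      else some Symb.e := by
  obtain ⟨l, rfl⟩ : ∃ m, l = m + 1 := ⟨l - 1, by omega⟩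
  rw [add_mul, one_mul] at *
  have hlen : ((List.replicate (l + 1 - 1) w).flatten).length = l * q := by
    simp [List.length_flatten, hw]
  split_ifs with h1 h2
  · rw [List.getElem?_append_left (by simp; omega),
      List.getElem?_append_left (by simp; omega),
      List.getElem?_replicate_of_lt (by omega)]
  · rw [List.getElem?_append_left (by simp only [List.length_append, hlen, List.length_replicate]; omega),
      List.getElem?_append_right (by simp; omega), List.length_replicate, add_tsub_cancel_right,
      List.getElem?_flatten_replicate hw hq (by omega)]
    congr 1
    have : r + j = r - (q - j) + q := by omega
    rw [this, Nat.add_mod_right]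
  · rw [List.getElem?_append_right (by simp only [List.length_append, hlen, List.length_replicate]; omega),
      List.getElem?_replicate_of_lt
        (by simp only [List.length_append, hlen, List.length_replicate]; omega)]

section circOp

variable {S : Type u} {k l p q : ℕ} {v : List (List (Symb S))}

theorem length_circOp (hq : 0 < q) (hl : 0 < l) (hk : v.length = k)
    (hv : ∀ w ∈ v, w.length = q) : (circOp l p q v).length = q * (k * (l * q)) := by
  rw [circOp, List.length_flatMap_of_length (c := k * (l * q)), List.length_range]
  intro i _
  rw [List.length_flatMap_of_length (c := l * q), hk]
  intro w hw
  exact length_circOp_piece (dynIndex_le hq i) hl (hv w hw)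

/-- The word consists of blocks of length `l * q`. The block number is `t / (l * q)`; its quotient
by `k` is the index `i` of the outer product and its remainder the index `j` of the inner one. -/
theorem getElem?_circOp (hq : 0 < q) (hl : 0 < l) (hk0 : 0 < k) (hk : v.length = k)
    (hv : ∀ w ∈ v, w.length = q) {t : ℕ} (ht : t < q * (k * (l * q))) :
    (circOp l p q v)[t]? =
      if t % (l * q) + dynIndex p q (t / (l * q) / k) < q then some Symb.b
      else if t % (l * q) + dynIndex p q (t / (l * q) / k) < l * q then
        v[t / (l * q) % k]?.bind fun w => w[(t % (l * q) + dynIndex p q (t / (l * q) / k)) % q]?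
      else some Symb.e := by
  have hlq : 0 < l * q := Nat.mul_pos hl hq
  have hin : ∀ i, ∀ w ∈ v, (List.replicate (q - dynIndex p q i) Symb.b ++
      (List.replicate (l - 1) w).flatten ++ List.replicate (dynIndex p q i) Symb.e).length
        = l * q :=
    fun i w hw => length_circOp_piece (dynIndex_le hq i) hl (hv w hw)
  rw [circOp, List.getElem?_flatMap_of_length (c := k * (l * q)) (Nat.mul_pos hk0 hlq) _ _
    (fun i _ => by rw [List.length_flatMap_of_length (c := l * q) _ _ (hin i), hk])]
  have hi : t / (k * (l * q)) < q := Nat.div_lt_of_lt_mul (by rwa [mul_comm])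
  rw [List.getElem?_range hi]
  simp only [Option.bind_some]
  rw [List.getElem?_flatMap_of_length hlq _ _ (hin _)]
  have e1 : t / (k * (l * q)) = t / (l * q) / k := by rw [Nat.div_div_eq_div_mul, mul_comm k]
  have e2 : t % (k * (l * q)) / (l * q) = t / (l * q) % k := by
    rw [mul_comm k, Nat.mod_mul_right_div_self]
  have e3 : t % (k * (l * q)) % (l * q) = t % (l * q) := Nat.mod_mul_left_mod _ _ _
  rw [e1, e2, e3]
  have hj : t / (l * q) % k < v.length := by rw [hk]; exact Nat.mod_lt _ hk0
  rw [List.getElem?_eq_getElem hj]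
  simp only [Option.bind_some]
  rw [getElem?_circOp_piece (dynIndex_le hq _) hl hq (hv _ (List.getElem_mem hj))
    (Nat.mod_lt _ hlq)]

end circOp

/-! ### Coefficients -/

theorem coefQ_zero (k l : ℕ → ℕ) : coefQ k l 0 = 1 := rfl

theorem coefQ_succ (k l : ℕ → ℕ) (n : ℕ) : coefQ k l (n + 1) = k n * l n * coefQ k l n ^ 2 := rfl

theorem coefP_succ (k l : ℕ → ℕ) (n : ℕ) :
    coefP k l (n + 1) = coefP k l n * coefQ k l n * k n * l n + 1 := rfl

/-- The next `p` is `1` modulo `q_n k_n l_n`, and the next `q` is this number times its own divisor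
`q_n`. -/
theorem coprime_coefP_coefQ (k l : ℕ → ℕ) : ∀ n, Nat.Coprime (coefP k l n) (coefQ k l n)
  | 0 => by rw [coefQ_zero]; exact Nat.coprime_one_right _
  | n + 1 => by
    have h : Nat.Coprime (coefP k l (n + 1)) (coefQ k l n * k n * l n) := by
      rw [coefP_succ, show coefP k l n * coefQ k l n * k n * l n + 1
        = 1 + (coefQ k l n * k n * l n) * coefP k l n by ring]
      exact (Nat.coprime_add_mul_left_left _ _ _).mpr (Nat.coprime_one_left _)
    have h1 := h.coprime_dvd_right (Dvd.intro _ (mul_assoc (coefQ k l n) (k n) (l n)).symm)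
    have h2 := h.mul_right h1
    rwa [show coefQ k l n * k n * l n * coefQ k l n = coefQ k l (n + 1) by
      rw [coefQ_succ]; ring] at h2

namespace AKData

/-- The standing assumptions on the data. -/
structure Admissible (D : AKData) : Prop where
  req1 : D.Requirement1
  req2 : D.Requirement2
  req3 : D.Requirement3
  -- The power of two makes the proportions of spacers summable; the factor `q n` keeps orbit
  -- segments of length about `q n` away from the spacers of later stages.
  growth : ∀ n, 2 ^ (n + 2) * D.q n * D.k n ≤ D.l n

variable {D : AKData}

theorem q_succ (n : ℕ) : D.q (n + 1) = D.q n * (D.k n * (D.l n * D.q n)) := by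
  rw [q, coefQ_succ]; rw [q]; ring

theorem p_succ (n : ℕ) : D.p (n + 1) = D.p n * D.q n * D.k n * D.l n + 1 := coefP_succ _ _ n

theorem q_zero : D.q 0 = 1 := rfl

theorem coprime_p_q (n : ℕ) : Nat.Coprime (D.p n) (D.q n) := coprime_coefP_coefQ _ _ n

/-- If `s (n + 1)` vanished, it would force its multiple `k (n + 1)` to vanish. -/
theorem s_pos (n : ℕ) : 0 < D.s n := by
  induction n with
  | zero => have := D.two_le_s; omega
  | succ n _ =>
    rcases Nat.eq_zero_or_pos (D.s (n + 1)) with h | h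
    · have h1 := D.s_dvd_k (n + 1)
      rw [h] at h1
      have := D.k_pos (n + 1)
      rw [Nat.eq_zero_of_zero_dvd h1] at this
      exact absurd this (lt_irrefl _)
    · exact h

theorem two_le_s' (n : ℕ) : 2 ≤ D.s n := by
  induction n with
  | zero => exact D.two_le_s
  | succ n ih => exact ih.trans (Nat.le_of_dvd (s_pos _) (D.s_dvd_s n))

theorem s_le_k (n : ℕ) : D.s n ≤ D.k n := Nat.le_of_dvd (D.k_pos n) (D.s_dvd_k n)

theorem two_le_k (n : ℕ) : 2 ≤ D.k n := (two_le_s' n).trans (s_le_k n)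

theorem Admissible.q_pos (hD : D.Admissible) (n : ℕ) : 0 < D.q n := by
  induction n with
  | zero => exact Nat.one_pos
  | succ n ih =>
    have h1 : 0 < D.l n :=
      lt_of_lt_of_le (Nat.mul_pos (Nat.mul_pos (by positivity) ih) (D.k_pos n)) (hD.growth n)
    rw [q_succ]
    exact Nat.mul_pos ih (Nat.mul_pos (D.k_pos n) (Nat.mul_pos h1 ih))

theorem Admissible.eight_le_l (hD : D.Admissible) (n : ℕ) : 8 ≤ D.l n := by
  refine le_trans ?_ (hD.growth n)
  have h1 : 4 ≤ 2 ^ (n + 2) := by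
    rw [pow_add]; have := Nat.one_le_two_pow (n := n); omega
  calc 8 = 4 * 1 * 2 := rfl
    _ ≤ _ := Nat.mul_le_mul (Nat.mul_le_mul h1 (hD.q_pos n)) (two_le_k n)

theorem Admissible.l_pos (hD : D.Admissible) (n : ℕ) : 0 < D.l n := by
  have := hD.eight_le_l n; omega

theorem Admissible.lq_pos (hD : D.Admissible) (n : ℕ) : 0 < D.l n * D.q n :=
  Nat.mul_pos (hD.l_pos n) (hD.q_pos n)

theorem Admissible.q_lt_q_succ (hD : D.Admissible) (n : ℕ) : 16 * D.q n ≤ D.q (n + 1) := by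
  rw [q_succ]
  have h1 := hD.q_pos n
  have h2 := two_le_k (D := D) n
  have h3 := hD.eight_le_l n
  calc 16 * D.q n = D.q n * (2 * (8 * 1)) := by ring
    _ ≤ _ := Nat.mul_le_mul_left _ (Nat.mul_le_mul h2 (Nat.mul_le_mul h3 h1))

theorem Admissible.q_mono (hD : D.Admissible) : Monotone D.q :=
  monotone_nat_of_le_succ fun n => by have := hD.q_lt_q_succ n; omega

theorem Admissible.lt_q (hD : D.Admissible) (n : ℕ) : n < D.q n := by
  induction n with
  | zero => exact Nat.one_pos
  | succ n ih => have := hD.q_lt_q_succ n; omega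

/-! ### The letters of the tower words -/

/-- The phase of the position `t` of a word of `𝒲_{n+1}` relative to the words of `𝒲_n` inside
it. -/
def phase (D : AKData) (n t : ℕ) : ℕ :=
  t % (D.l n * D.q n) + dynIndex (D.p n) (D.q n) (t / (D.l n * D.q n) / D.k n)

/-- The index of the `n`-tower whose word is used around the position `t` of the word of the
`(n+1)`-tower with index `σ`. -/
noncomputable def strip (D : AKData) (n σ t : ℕ) : ℕ :=
  D.stripIndex n σ (t / (D.l n * D.q n) % D.k n)

/-- The letter at the position `t` of the word of the `σ`-th `n`-tower. -/
noncomputable def lett (D : AKData) : ℕ → ℕ → ℕ → Symb ℕ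
  | 0, σ, _ => Symb.letter σ
  | n + 1, σ, t =>
    if D.phase n t < D.q n then Symb.b
    else if D.phase n t < D.l n * D.q n then
      lett D n (D.strip n σ t) (D.phase n t % D.q n)
    else Symb.e

theorem Admissible.length_towerWord (hD : D.Admissible) (n σ : ℕ) :
    (D.towerWord n σ).length = D.q n := by
  induction n generalizing σ with
  | zero => rfl
  | succ n ih =>
    rw [towerWord, length_circOp (k := D.k n) (hD.q_pos n) (hD.l_pos n), q_succ]
    · simp
    · intro w hw
      simp only [List.mem_map] at hw
      obtain ⟨t, -, rfl⟩ := hw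
      exact ih _

theorem Admissible.getElem?_towerWord (hD : D.Admissible) (n σ : ℕ) {t : ℕ} (ht : t < D.q n) :
    (D.towerWord n σ)[t]? = some (D.lett n σ t) := by
  induction n generalizing σ t with
  | zero =>
    rw [q_zero] at ht
    obtain rfl : t = 0 := by omega
    rfl
  | succ n ih =>
    rw [q_succ] at ht
    rw [towerWord, getElem?_circOp (k := D.k n) (hD.q_pos n) (hD.l_pos n) (D.k_pos n) (by simp)
      _ ht]
    · rw [lett, ← phase]
      split_ifs
      · rfl
      · rw [List.getElem?_map, List.getElem?_range (Nat.mod_lt _ (D.k_pos n))]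
        exact ih _ (Nat.mod_lt _ (hD.q_pos n))
      · rfl
    · intro w hw
      simp only [List.mem_map] at hw
      obtain ⟨t, -, rfl⟩ := hw
      exact hD.length_towerWord _ _

theorem Admissible.getElem?_skeleton (hD : D.Admissible) (n : ℕ) {t : ℕ} (ht : t < D.q (n + 1)) :
    (D.skeleton n)[t]? = some (if D.phase n t < D.q n then Symb.b
      else if D.phase n t < D.l n * D.q n then Symb.letter () else Symb.e) := by
  rw [q_succ] at ht
  rw [skeleton, getElem?_circOp (k := D.k n) (hD.q_pos n) (hD.l_pos n) (D.k_pos n) (by simp)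
      _ ht]
  · rw [← phase]
    split_ifs
    · rfl
    · rw [List.getElem?_replicate_of_lt (Nat.mod_lt _ (D.k_pos n)), Option.bind_some,
        List.getElem?_replicate_of_lt (Nat.mod_lt _ (hD.q_pos n))]
    · rfl
  · intro w hw
    rw [List.eq_of_mem_replicate hw, List.length_replicate]

end AKData

/-! ### Recognition of the words of `𝒲_n` in longer words -/

namespace AKData

variable {D : AKData}

theorem mod_eq_sub_of_le {l q y : ℕ} (h1 : (l - 1) * q ≤ y) (h2 : y < l * q) :
    y % q = y - (l - 1) * q := by
  obtain ⟨z, rfl⟩ := Nat.exists_eq_add_of_le h1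
  have hl : 0 < l := by
    rcases Nat.eq_zero_or_pos l with rfl | h
    · simp at h2
    · exact h
  obtain ⟨l, rfl⟩ : ∃ m, l = m + 1 := ⟨l - 1, by omega⟩
  rw [add_tsub_cancel_right] at *
  rw [add_mul, one_mul] at h2
  rw [add_tsub_cancel_left, add_comm, mul_comm, Nat.add_mul_mod_self_left, Nat.mod_eq_of_lt]
  omega

theorem Admissible.phase_add (hD : D.Admissible) (n blk : ℕ) {r : ℕ} (hr : r < D.l n * D.q n) :
    D.phase n (blk * (D.l n * D.q n) + r) = r + dynIndex (D.p n) (D.q n) (blk / D.k n) := by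
  rw [phase, mul_comm blk, Nat.mul_add_mod, Nat.mod_eq_of_lt hr, Nat.mul_add_div (hD.lq_pos n),
    Nat.div_eq_of_lt hr, add_zero]

theorem Admissible.strip_add (hD : D.Admissible) (n σ blk : ℕ) {r : ℕ} (hr : r < D.l n * D.q n) :
    D.strip n σ (blk * (D.l n * D.q n) + r) = D.stripIndex n σ (blk % D.k n) := by
  rw [strip, mul_comm blk, Nat.mul_add_div (hD.lq_pos n), Nat.div_eq_of_lt hr, add_zero]

theorem Admissible.exists_block (hD : D.Admissible) (n t : ℕ) :
    ∃ blk r, r < D.l n * D.q n ∧ t = blk * (D.l n * D.q n) + r :=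
  ⟨t / (D.l n * D.q n), t % (D.l n * D.q n), Nat.mod_lt _ (hD.lq_pos n),
    (Nat.div_add_mod' _ _).symm⟩

/-- Positions that differ little enough lie in the same block. -/
theorem Admissible.phase_add_right (hD : D.Admissible) (n : ℕ) {t d : ℕ}
    (h : D.phase n t + d < D.l n * D.q n) :
    D.phase n (t + d) = D.phase n t + d ∧ ∀ σ, D.strip n σ (t + d) = D.strip n σ t := by
  obtain ⟨blk, r, hr, rfl⟩ := hD.exists_block n t
  rw [hD.phase_add n blk hr] at h
  have hr' : r + d < D.l n * D.q n := by omega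
  constructor
  · rw [add_assoc, hD.phase_add n blk hr', hD.phase_add n blk hr]; omega
  · intro σ
    rw [add_assoc, hD.strip_add n σ blk hr', hD.strip_add n σ blk hr]

theorem lett_of_phase_lt {n t : ℕ} (h : D.phase n t < D.q n) (σ : ℕ) :
    D.lett (n + 1) σ t = Symb.b := by
  rw [lett, if_pos h]

theorem Admissible.lett_of_le_phase (hD : D.Admissible) {n t : ℕ}
    (h : D.l n * D.q n ≤ D.phase n t) (σ : ℕ) : D.lett (n + 1) σ t = Symb.e := by
  have : D.q n ≤ D.l n * D.q n := Nat.le_mul_of_pos_left _ (hD.l_pos n)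
  rw [lett, if_neg (by omega), if_neg (by omega)]

theorem lett_of_phase_mem {n t : ℕ} (h1 : D.q n ≤ D.phase n t)
    (h2 : D.phase n t < D.l n * D.q n) (σ : ℕ) :
    D.lett (n + 1) σ t = D.lett n (D.strip n σ t) (D.phase n t % D.q n) := by
  rw [lett, if_neg (by omega), if_pos h2]

/-- The number of symbols `b` at the beginning of the words of `𝒲_n`. -/
def headLen (D : AKData) : ℕ → ℕ
  | 0 => 0
  | n + 1 => D.q n + headLen D n

/-- The number of symbols `e` at the end of the words of `𝒲_n`. -/
def tailLen (D : AKData) : ℕ → ℕ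
  | 0 => 0
  | n + 1 => dynIndex (D.p n) (D.q n) (D.q n - 1) + tailLen D n

theorem headLen_mono : Monotone D.headLen :=
  monotone_nat_of_le_succ fun n => by rw [headLen]; omega

theorem tailLen_mono : Monotone D.tailLen :=
  monotone_nat_of_le_succ fun n => by rw [tailLen]; omega

theorem Admissible.headLen_add_tailLen (hD : D.Admissible) (n : ℕ) :
    D.headLen n + D.tailLen n < D.q n := by
  induction n with
  | zero => simp [headLen, tailLen, q_zero]
  | succ n ih =>
    have := hD.q_lt_q_succ n
    have := dynIndex_lt (p := D.p n) (hD.q_pos n) (D.q n - 1)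
    rw [headLen, tailLen]
    omega

theorem Admissible.lq_ge (hD : D.Admissible) (n : ℕ) : 8 * D.q n ≤ D.l n * D.q n :=
  Nat.mul_le_mul_right _ (hD.eight_le_l n)

theorem Admissible.l_sub_one_mul (hD : D.Admissible) (n : ℕ) :
    (D.l n - 1) * D.q n + D.q n = D.l n * D.q n := by
  have := hD.l_pos n
  obtain ⟨m, hm⟩ : ∃ m, D.l n = m + 1 := ⟨D.l n - 1, by omega⟩
  rw [hm, add_tsub_cancel_right]; ring

theorem Admissible.phase_head (hD : D.Admissible) (n : ℕ) {t : ℕ} (ht : t < D.l n * D.q n) :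
    D.phase n t = t := by
  have := hD.phase_add n 0 ht
  rwa [zero_mul, zero_add, Nat.zero_div, dynIndex_zero, add_zero] at this

/-- The first block has offset `0`, so `q n` symbols `b` are followed at once by a full word of the
preceding stage with its own initial run. -/
theorem Admissible.lett_head (hD : D.Admissible) (n σ : ℕ) {t : ℕ} (ht : t < D.headLen n) :
    D.lett n σ t = Symb.b := by
  induction n generalizing σ t with
  | zero => simp [headLen] at ht
  | succ n ih =>
    rw [headLen] at ht
    have h1 := hD.headLen_add_tailLen n
    have h2 := hD.lq_ge n
    have h3 := hD.phase_head n (t := t) (by omega)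
    by_cases h : t < D.q n
    · exact lett_of_phase_lt (by omega) σ
    · rw [lett_of_phase_mem (by omega) (by omega), h3]
      have : t % D.q n = t - D.q n := by
        rw [Nat.mod_eq_sub_mod (by omega), Nat.mod_eq_of_lt (by omega)]
      exact ih _ (by omega)

/-- With `lett_head`, the initial run of `b` has exactly this length; this is what bounds a run of
`b` in `not_isSwitch`. -/
theorem Admissible.lett_headLen (hD : D.Admissible) (n σ : ℕ) :
    ∃ a, D.lett n σ (D.headLen n) = Symb.letter a := by
  induction n generalizing σ with
  | zero => exact ⟨σ, rfl⟩
  | succ n ih =>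
    have h1 := hD.headLen_add_tailLen n
    have h2 := hD.lq_ge n
    have h3 := hD.phase_head n (t := D.headLen (n + 1)) (by rw [headLen]; omega)
    rw [headLen] at h3 ⊢
    rw [lett_of_phase_mem (by omega) (by omega), h3, Nat.add_mod_left,
      Nat.mod_eq_of_lt (by omega)]
    exact ih _

/-- The last block belongs to the last outer index `q n - 1`, so its offset is the one that enters
`tailLen`. -/
theorem Admissible.phase_tail (hD : D.Admissible) (n : ℕ) {t : ℕ} (ht : t < D.q (n + 1))
    (h : D.q (n + 1) ≤ t + D.l n * D.q n) :
    D.phase n t + D.q (n + 1)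
      = t + D.l n * D.q n + dynIndex (D.p n) (D.q n) (D.q n - 1) := by
  have hk := D.k_pos n
  have hq := hD.q_pos n
  have hqk : 0 < D.q n * D.k n := Nat.mul_pos hq hk
  have e : D.q (n + 1) = (D.q n * D.k n - 1) * (D.l n * D.q n) + D.l n * D.q n := by
    rw [q_succ, ← mul_assoc]
    obtain ⟨m, hm⟩ : ∃ m, D.q n * D.k n = m + 1 := ⟨D.q n * D.k n - 1, by omega⟩
    rw [hm, add_tsub_cancel_right]; ring
  obtain ⟨r, hr⟩ : ∃ r, t = (D.q n * D.k n - 1) * (D.l n * D.q n) + r :=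
    Nat.exists_eq_add_of_le (by omega)
  have h4 : (D.q n * D.k n - 1) / D.k n = D.q n - 1 := by
    rw [Nat.div_eq_iff hk]
    obtain ⟨m, hm⟩ : ∃ m, D.q n = m + 1 := ⟨D.q n - 1, by omega⟩
    rw [hm, add_tsub_cancel_right, add_mul]
    omega
  have h5 := hD.phase_add n (D.q n * D.k n - 1) (r := r) (by omega)
  rw [h4, ← hr] at h5
  omega

theorem Admissible.lett_tail (hD : D.Admissible) (n σ : ℕ) {t : ℕ} (ht : t < D.q n)
    (h : D.q n ≤ t + D.tailLen n) : D.lett n σ t = Symb.e := by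
  induction n generalizing σ t with
  | zero => simp [tailLen] at h; omega
  | succ n ih =>
    rw [tailLen] at h
    have h1 := hD.headLen_add_tailLen n
    have h2 := hD.lq_ge n
    have h0 := dynIndex_lt (p := D.p n) (hD.q_pos n) (D.q n - 1)
    have h3 := hD.phase_tail n ht (by omega)
    have h4 := hD.l_sub_one_mul n
    by_cases h' : D.l n * D.q n ≤ D.phase n t
    · exact hD.lett_of_le_phase h' σ
    · have h5 := mod_eq_sub_of_le (l := D.l n) (q := D.q n) (y := D.phase n t) (by omega)
        (by omega)
      rw [lett_of_phase_mem (by omega) (by omega)]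
      exact ih _ (Nat.mod_lt _ (hD.q_pos n)) (by omega)

theorem Admissible.lett_tailLen (hD : D.Admissible) (n σ : ℕ) :
    ∃ a, D.lett n σ (D.q n - D.tailLen n - 1) = Symb.letter a := by
  induction n generalizing σ with
  | zero => exact ⟨σ, rfl⟩
  | succ n ih =>
    have h1 := hD.headLen_add_tailLen n
    have h1' := hD.headLen_add_tailLen (n + 1)
    have h2 := hD.lq_ge n
    have h0 := dynIndex_lt (p := D.p n) (hD.q_pos n) (D.q n - 1)
    rw [tailLen] at h1' ⊢
    have h3 := hD.phase_tail n (t := D.q (n + 1)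
      - (dynIndex (D.p n) (D.q n) (D.q n - 1) + D.tailLen n) - 1) (by omega) (by omega)
    have h4 := hD.l_sub_one_mul n
    have h5 := mod_eq_sub_of_le (l := D.l n) (q := D.q n) (y := D.phase n (D.q (n + 1)
      - (dynIndex (D.p n) (D.q n) (D.q n - 1) + D.tailLen n) - 1)) (by omega)
        (by omega)
    rw [lett_of_phase_mem (by omega) (by omega), h5]
    have e : D.phase n (D.q (n + 1) - (dynIndex (D.p n) (D.q n) (D.q n - 1) + D.tailLen n) - 1)
      - (D.l n - 1) * D.q n = D.q n - D.tailLen n - 1 := by omega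
    rw [e]
    exact ih _

theorem Admissible.lett_zero_ne_e (hD : D.Admissible) (n σ : ℕ) : D.lett n σ 0 ≠ Symb.e := by
  rcases Nat.eq_zero_or_pos (D.headLen n) with h | h
  · obtain ⟨a, ha⟩ := hD.lett_headLen n σ
    rw [h] at ha
    rw [ha]; exact nofun
  · rw [hD.lett_head n σ h]; exact nofun

theorem Admissible.lett_last_ne_b (hD : D.Admissible) (n σ : ℕ) :
    D.lett n σ (D.q n - 1) ≠ Symb.b := by
  have hq := hD.q_pos n
  rcases Nat.eq_zero_or_pos (D.tailLen n) with h | h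
  · obtain ⟨a, ha⟩ := hD.lett_tailLen n σ
    rw [h] at ha
    rw [Nat.sub_zero] at ha
    rw [ha]; exact nofun
  · rw [hD.lett_tail n σ (by omega) (by omega)]; exact nofun

/-- A symbol `b` is never followed by a symbol `e`. -/
theorem Admissible.lett_b_e (hD : D.Admissible) (n σ : ℕ) {t : ℕ} (ht : t + 1 < D.q n)
    (hb : D.lett n σ t = Symb.b) : D.lett n σ (t + 1) ≠ Symb.e := by
  induction n generalizing σ t with
  | zero => rw [q_zero] at ht; omega
  | succ n ih =>
    have h2 := hD.lq_ge n
    have hq := hD.q_pos n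
    rcases lt_or_ge (D.phase n t) (D.q n) with h | h
    · have h3 := (hD.phase_add_right n (t := t) (d := 1) (by omega)).1
      by_cases h4 : D.phase n t + 1 < D.q n
      · rw [lett_of_phase_lt (by omega)]; exact nofun
      · rw [lett_of_phase_mem (by omega) (by omega), h3,
          show D.phase n t + 1 = D.q n by omega, Nat.mod_self]
        exact hD.lett_zero_ne_e _ _
    · rcases lt_or_ge (D.phase n t) (D.l n * D.q n) with h' | h'
      · rw [lett_of_phase_mem h h'] at hb
        have h5 : D.phase n t % D.q n ≠ D.q n - 1 := fun h6 =>
          hD.lett_last_ne_b _ _ (h6 ▸ hb)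
        have h7 := Nat.mod_lt (D.phase n t) hq
        have h8 : (D.phase n t + 1) % D.q n = D.phase n t % D.q n + 1 := by
          rw [Nat.add_mod, Nat.mod_eq_of_lt (a := 1) (by omega), Nat.mod_eq_of_lt]
          omega
        have h9 : D.phase n t + 1 < D.l n * D.q n := by
          by_contra h10
          have h11 : D.phase n t + 1 = D.l n * D.q n := by omega
          rw [h11, Nat.mul_mod_left] at h8
          omega
        obtain ⟨h10, h11⟩ := hD.phase_add_right n (t := t) (d := 1) h9
        rw [lett_of_phase_mem (by omega) (by omega), h10, h11, h8]
        exact ih _ (by omega) hb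
      · rw [hD.lett_of_le_phase h'] at hb
        cases hb

/-- A run of `tailLen n` symbols `e` followed by `headLen n` symbols `b`, inside a window. -/
def IsSwitch (D : AKData) (n : ℕ) (f : ℕ → Symb ℕ) (s : ℕ) : Prop :=
  D.tailLen n ≤ s ∧ (∀ t, s ≤ t + D.tailLen n → t < s → f t = Symb.e) ∧
    ∀ t, s ≤ t → t < s + D.headLen n → f t = Symb.b

/-- Put `n = m + 1`. The `b`-run of a switch has length `q m + headLen m`, which inside the word
forces it to start a block with offset `0`. That happens only for the outer index `0`; then the
preceding block also has offset `0` and its final `e`-run is only `tailLen m` long, whereas a switch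
asks for more. -/
theorem Admissible.not_isSwitch (hD : D.Admissible) {n : ℕ} (hn : 2 ≤ n) (σ : ℕ) {s : ℕ}
    (hs : s + D.headLen n ≤ D.q n) : ¬ D.IsSwitch n (D.lett n σ) s := by
  rintro ⟨h0, he, hb⟩
  obtain ⟨m, rfl⟩ : ∃ m, n = m + 1 := ⟨n - 1, by omega⟩
  have hq := hD.q_pos m
  -- Here `n ≥ 2` is used. For `n = 1` there are no final `e`, and a switch would be a single `b`.
  have hq2 : 2 ≤ D.q m := by have := hD.lt_q m; omega
  have hlq := hD.lq_ge m
  have hBE := hD.headLen_add_tailLen m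
  have hJ : 0 < dynIndex (D.p m) (D.q m) (D.q m - 1) := by
    rcases Nat.eq_zero_or_pos (dynIndex (D.p m) (D.q m) (D.q m - 1)) with h | h
    · have := eq_zero_of_dynIndex_eq_zero hq (coprime_p_q m) (by omega) h
      omega
    · exact h
  rw [headLen] at hb hs
  rw [tailLen] at he h0
  obtain ⟨blk, r, hr, hsr⟩ := hD.exists_block m s
  have hph := hD.phase_add m blk hr
  rw [← hsr] at hph
  have hjlt := dynIndex_lt (p := D.p m) hq (blk / D.k m)
  have hsb := hb s le_rfl (by omega)
  have hse := he (s - 1) (by omega) (by omega)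
  rcases lt_or_ge (D.phase m s) (D.q m) with h | h
  -- Beyond the first place of a block's `b`-run, the preceding symbol would be `b` and not `e`.
  · have hr0 : r = 0 := by
      by_contra hr0
      have h1 := hD.phase_add m blk (r := r - 1) (by omega)
      have h2 : blk * (D.l m * D.q m) + (r - 1) = s - 1 := by omega
      rw [h2] at h1
      rw [lett_of_phase_lt (by omega)] at hse
      cases hse
    subst hr0
    -- An offset `j > 0` leaves only `q - j` spacers `b`; after them and the head of the next copy a
    -- letter interrupts the run too early.
    have hj0 : dynIndex (D.p m) (D.q m) (blk / D.k m) = 0 := by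
      by_contra hj
      obtain ⟨h1, -⟩ := hD.phase_add_right m (t := s)
        (d := D.q m - dynIndex (D.p m) (D.q m) (blk / D.k m) + D.headLen m) (by omega)
      have h2 := hb (s + (D.q m - dynIndex (D.p m) (D.q m) (blk / D.k m) + D.headLen m))
        (by omega) (by omega)
      rw [lett_of_phase_mem (by omega) (by omega), h1, hph] at h2
      rw [show 0 + dynIndex (D.p m) (D.q m) (blk / D.k m) +
        (D.q m - dynIndex (D.p m) (D.q m) (blk / D.k m) + D.headLen m)
          = D.q m + D.headLen m by omega, Nat.add_mod_left, Nat.mod_eq_of_lt (by omega)] at h2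
      obtain ⟨a, ha⟩ := hD.lett_headLen m (D.strip m σ (s +
        (D.q m - dynIndex (D.p m) (D.q m) (blk / D.k m) + D.headLen m)))
      rw [ha] at h2
      cases h2
    have hblkq : blk < D.q m * D.k m := by
      by_contra h1
      have h2 : D.q m * D.k m * (D.l m * D.q m) ≤ blk * (D.l m * D.q m) :=
        Nat.mul_le_mul_right _ (not_lt.mp h1)
      have h3 := q_succ (D := D) m
      rw [← mul_assoc] at h3
      omega
    have hb0 : blk / D.k m = 0 := eq_zero_of_dynIndex_eq_zero hq (coprime_p_q m)
      (Nat.div_lt_of_lt_mul (by rwa [mul_comm])) hj0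
    obtain ⟨c, rfl⟩ : ∃ c, blk = c + 1 := by
      refine ⟨blk - 1, ?_⟩
      rcases Nat.eq_zero_or_pos blk with h1 | h1
      · rw [h1] at hsr; omega
      · omega
    -- The block before still has outer index `0`, hence no spacers `e`: the symbol just before its
    -- last `tailLen m` ones is a letter.
    have hc0 : c / D.k m = 0 := by
      rw [Nat.div_eq_zero_iff] at hb0 ⊢
      omega
    have h1 := hD.phase_add m c (r := D.l m * D.q m - D.tailLen m - 1) (by omega)
    rw [hc0, dynIndex_zero, add_zero] at h1
    have h2 : c * (D.l m * D.q m) + (D.l m * D.q m - D.tailLen m - 1) = s - D.tailLen m - 1 := by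
      rw [hsr, add_mul]; omega
    rw [h2] at h1
    have h3 := he (s - D.tailLen m - 1) (by omega) (by omega)
    have h4 := hD.l_sub_one_mul m
    rw [lett_of_phase_mem (by omega) (by omega), mod_eq_sub_of_le (l := D.l m) (by omega) (by omega), h1,
      show D.l m * D.q m - D.tailLen m - 1 - (D.l m - 1) * D.q m = D.q m - D.tailLen m - 1 by
        omega] at h3
    obtain ⟨a, ha⟩ := hD.lett_tailLen m (D.strip m σ (s - D.tailLen m - 1))
    rw [ha] at h3
    cases h3
  · rcases lt_or_ge (D.phase m s) (D.l m * D.q m) with h' | h'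
    -- Inside a copy of a word of `𝒲_m`, fewer than `q m` steps lead to its last symbol, which is
    -- not `b`.
    · have h1 := Nat.mod_lt (D.phase m s) hq
      have h2 := Nat.div_add_mod (D.phase m s) (D.q m)
      have h3 : D.phase m s / D.q m < D.l m := Nat.div_lt_of_lt_mul (by rwa [mul_comm])
      have h4 : D.q m * (D.phase m s / D.q m) + D.q m ≤ D.l m * D.q m := by
        calc _ = (D.phase m s / D.q m + 1) * D.q m := by ring
          _ ≤ _ := Nat.mul_le_mul_right _ h3
      obtain ⟨h5, -⟩ := hD.phase_add_right m (t := s)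
        (d := D.q m - 1 - D.phase m s % D.q m) (by omega)
      have h6 := hb (s + (D.q m - 1 - D.phase m s % D.q m)) (by omega) (by omega)
      rw [lett_of_phase_mem (by omega) (by omega), h5,
        show D.phase m s + (D.q m - 1 - D.phase m s % D.q m)
          = D.q m * (D.phase m s / D.q m) + (D.q m - 1) by omega, Nat.mul_add_mod,
        Nat.mod_eq_of_lt (a := D.q m - 1) (by omega)] at h6
      exact hD.lett_last_ne_b _ _ h6
    · rw [hD.lett_of_le_phase h'] at hsb
      cases hsb

/-- The word of the `σ`-th `n`-tower is read in `f` at the position `c`. -/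
def ReadsAt (D : AKData) (n σ : ℕ) (f : ℕ → Symb ℕ) (c : ℕ) : Prop :=
  ∀ r < D.q n, f (c + r) = D.lett n σ r

/-- In a sequence that is parsed into words of `𝒲_M`, which are separated by switches, every
occurrence of a word of `𝒲_n`, where `2 ≤ n ≤ M`, lies inside one of these words. -/
theorem Admissible.exists_piece (hD : D.Admissible) {n M : ℕ} (hn : 2 ≤ n) (hnM : n ≤ M)
    {f : ℕ → Symb ℕ} {len : ℕ} {C : Set ℕ}
    (hC1 : ∀ c ∈ C, ∃ τ, D.ReadsAt M τ f c)
    (hC2 : ∀ t < len, (∃ a, f t = Symb.letter a) → ∃ c ∈ C, c ≤ t ∧ t < c + D.q M)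
    (hC3 : ∀ c ∈ C, ∀ c' ∈ C, c < c' → ∃ s, c + D.q M ≤ s ∧ s ≤ c' ∧ D.IsSwitch M f s)
    {σ p : ℕ} (hp : D.ReadsAt n σ f p) (hpl : p + D.q n ≤ len) :
    ∃ c ∈ C, c ≤ p ∧ p + D.q n ≤ c + D.q M := by
  have hBE := hD.headLen_add_tailLen n
  have hBM := headLen_mono (D := D) hnM
  have hEM := tailLen_mono (D := D) hnM
  obtain ⟨a, ha⟩ := hD.lett_headLen n σ
  obtain ⟨a', ha'⟩ := hD.lett_tailLen n σ
  rw [← hp _ (by omega)] at ha ha'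
  obtain ⟨c, hc, hc1, hc2⟩ := hC2 _ (by omega) ⟨a, ha⟩
  obtain ⟨c', hc', hc1', hc2'⟩ := hC2 _ (by omega) ⟨a', ha'⟩
  rcases lt_trichotomy c c' with h | h | h
  · exfalso
    -- The switch of order `M` contains one of order `n`. The first and the last letter of the
    -- occurrence lie on either side of its runs, so the smaller switch would lie inside a word of
    -- `𝒲_n`.
    obtain ⟨s, hs1, hs2, h0, he, hb⟩ := hC3 c hc c' hc' h
    have h1 : p + D.headLen n + D.tailLen n < s := by
      by_contra h1
      rw [he (p + D.headLen n) (by omega) (by omega)] at ha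
      cases ha
    have h2 : s + D.headLen n ≤ p + (D.q n - D.tailLen n - 1) := by
      by_contra h2
      rw [hb (p + (D.q n - D.tailLen n - 1)) (by omega) (by omega)] at ha'
      cases ha'
    refine hD.not_isSwitch hn σ (s := s - p) (by omega) ⟨by omega, ?_, ?_⟩
    · intro t ht1 ht2
      rw [← hp t (by omega)]
      exact he _ (by omega) (by omega)
    · intro t ht1 ht2
      rw [← hp t (by omega)]
      exact hb _ (by omega) (by omega)
  · subst h
    obtain ⟨τ, hτ⟩ := hC1 c hc
    refine ⟨c, hc, ?_, ?_⟩
    -- If the occurrence started before the piece, its first letter would fall into the initial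
    -- `b`-run of the piece, which is at least `headLen n` long. The other end is symmetric.
    · by_contra h1
      have h2 := hτ (p + D.headLen n - c) (by omega)
      rw [show c + (p + D.headLen n - c) = p + D.headLen n by omega, ha,
        hD.lett_head M τ (by omega)] at h2
      cases h2
    · by_contra h1
      have h2 := hτ (p + (D.q n - D.tailLen n - 1) - c) (by omega)
      rw [show c + (p + (D.q n - D.tailLen n - 1) - c) = p + (D.q n - D.tailLen n - 1) by omega,
        ha', hD.lett_tail M τ (by omega) (by omega)] at h2
      cases h2
  · exfalso
    obtain ⟨s, hs1, hs2, -⟩ := hC3 c' hc' c hc h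
    omega

/-- The starting points of the words of `𝒲_n` from which a word of `𝒲_{n+1}` is built. -/
def pieceStarts (D : AKData) (n : ℕ) : Set ℕ :=
  {c | c < D.q (n + 1) ∧ D.q n ≤ D.phase n c ∧ D.phase n c < D.l n * D.q n ∧ D.q n ∣ D.phase n c}

theorem phase_add_lt {n c d : ℕ} (hc : c ∈ D.pieceStarts n)
    (hd : d < D.q n) : D.phase n c + d < D.l n * D.q n := by
  obtain ⟨-, h1, h2, a, ha⟩ := hc
  rw [ha, mul_comm] at h2 ⊢
  have h3 : a < D.l n := lt_of_mul_lt_mul_right h2 (Nat.zero_le _)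
  calc a * D.q n + d < a * D.q n + D.q n := by omega
    _ = (a + 1) * D.q n := by ring
    _ ≤ _ := Nat.mul_le_mul_right _ h3

theorem Admissible.readsAt_pieceStarts (hD : D.Admissible) {n c : ℕ} (hc : c ∈ D.pieceStarts n)
    (σ : ℕ) : D.ReadsAt n (D.strip n σ c) (D.lett (n + 1) σ) c := by
  intro r hr
  obtain ⟨h1, h2⟩ := hD.phase_add_right n (phase_add_lt hc hr)
  have h3 := phase_add_lt hc hr
  obtain ⟨-, h4, h5, a, ha⟩ := hc
  rw [lett_of_phase_mem (by omega) (by omega), h1, h2, ha, Nat.mul_add_mod, Nat.mod_eq_of_lt hr]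

theorem Admissible.phase_lt (hD : D.Admissible) (n t : ℕ) :
    D.phase n t < t % (D.l n * D.q n) + D.q n :=
  Nat.add_lt_add_left (dynIndex_lt (hD.q_pos n) _) _

/-- Step back by the residue of the phase modulo `q n`. As the phase is at least `q n` and the
offset is smaller than `q n`, this stays in the same block. -/
theorem Admissible.exists_pieceStart (hD : D.Admissible) {n t : ℕ} (ht : t < D.q (n + 1))
    (h1 : D.q n ≤ D.phase n t) (h2 : D.phase n t < D.l n * D.q n) :
    ∃ c ∈ D.pieceStarts n, t = c + D.phase n t % D.q n ∧
      ∀ σ, D.strip n σ c = D.strip n σ t := by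
  have hq := hD.q_pos n
  have h3 := Nat.mod_lt (D.phase n t) hq
  have h4 := Nat.div_add_mod (D.phase n t) (D.q n)
  have h6 : 1 ≤ D.phase n t / D.q n := (Nat.one_le_div_iff hq).mpr h1
  have h7 : D.q n ≤ D.q n * (D.phase n t / D.q n) := Nat.le_mul_of_pos_right _ h6
  obtain ⟨blk, r, hr, rfl⟩ := hD.exists_block n t
  have h5 := hD.phase_add n blk hr
  set ρ := D.phase n (blk * (D.l n * D.q n) + r) % D.q n
  have h8 := dynIndex_lt (p := D.p n) hq (blk / D.k n)
  have h9 : D.phase n (blk * (D.l n * D.q n) + (r - ρ))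
      = D.q n * (D.phase n (blk * (D.l n * D.q n) + r) / D.q n) := by
    rw [hD.phase_add n blk (r := r - ρ) (by omega)]
    omega
  refine ⟨blk * (D.l n * D.q n) + (r - ρ), ⟨by omega, by omega, by omega, ⟨_, h9⟩⟩, by omega, ?_⟩
  intro σ
  rw [hD.strip_add n σ blk hr, hD.strip_add n σ blk (r := r - ρ) (by omega)]

theorem Admissible.exists_pieceStart_of_letter (hD : D.Admissible) {n σ t : ℕ}
    (ht : t < D.q (n + 1)) (h : ∃ a, D.lett (n + 1) σ t = Symb.letter a) :
    ∃ c ∈ D.pieceStarts n, c ≤ t ∧ t < c + D.q n := by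
  obtain ⟨a, ha⟩ := h
  have h1 : D.q n ≤ D.phase n t := by
    by_contra h1
    rw [lett_of_phase_lt (by omega)] at ha
    cases ha
  have h2 : D.phase n t < D.l n * D.q n := by
    by_contra h2
    rw [hD.lett_of_le_phase (by omega)] at ha
    cases ha
  obtain ⟨c, hc, h3, -⟩ := hD.exists_pieceStart ht h1 h2
  have := Nat.mod_lt (D.phase n t) (hD.q_pos n)
  exact ⟨c, hc, by omega, by omega⟩

/-- Either another copy follows directly and the switch is at the seam, or `c` starts the last copy
of its block and the switch is at the end of the block. In the second case the spacers `e` before it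
and `b` after it only lengthen the tail and the head of the neighbouring words. -/
theorem Admissible.isSwitch_between (hD : D.Admissible) {n c c' : ℕ} (hc : c ∈ D.pieceStarts n)
    (hc' : c' ∈ D.pieceStarts n) (h : c < c') (σ : ℕ) :
    ∃ s, c + D.q n ≤ s ∧ s ≤ c' ∧ D.IsSwitch n (D.lett (n + 1) σ) s := by
  have hq := hD.q_pos n
  have hlq := hD.lq_ge n
  have hBE := hD.headLen_add_tailLen n
  have hl1 := hD.l_sub_one_mul n
  have hge : c + D.q n ≤ c' := by
    by_contra hlt
    obtain ⟨h1, -⟩ := hD.phase_add_right n (phase_add_lt hc (d := c' - c) (by omega))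
    rw [show c + (c' - c) = c' by omega] at h1
    obtain ⟨-, -, -, a, ha⟩ := hc
    obtain ⟨-, -, -, a', ha'⟩ := hc'
    rw [ha, ha'] at h1
    have h2 := congrArg (· % D.q n) h1
    simp only [Nat.mul_mod_right, Nat.mul_add_mod] at h2
    rw [Nat.mod_eq_of_lt (by omega)] at h2
    omega
  by_cases hlast : D.phase n c + D.q n < D.l n * D.q n
  · obtain ⟨h1, -⟩ := hD.phase_add_right n hlast
    have hs : c + D.q n ∈ D.pieceStarts n := by
      obtain ⟨h2, h3, h4, h5⟩ := hc
      refine ⟨lt_of_le_of_lt hge hc'.1, by omega, by omega, ?_⟩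
      rw [h1]
      exact (Nat.dvd_add_iff_left (dvd_refl _)).mp h5
    refine ⟨c + D.q n, le_rfl, hge, by omega, ?_, ?_⟩
    · intro t ht1 ht2
      have h2 := hD.readsAt_pieceStarts hc σ (t - c) (by omega)
      rwa [show c + (t - c) = t by omega, hD.lett_tail n (D.strip n σ c) (t := t - c) (by omega)
        (by omega)] at h2
    · intro t ht1 ht2
      have h2 := hD.readsAt_pieceStarts hs σ (t - (c + D.q n)) (by omega)
      rwa [show c + D.q n + (t - (c + D.q n)) = t by omega,
        hD.lett_head n _ (t := t - (c + D.q n)) (by omega)] at h2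
  · obtain ⟨blk, r, hr, hcr⟩ := hD.exists_block n c
    have h1 := hD.phase_add n blk hr
    rw [← hcr] at h1
    have hj := dynIndex_lt (p := D.p n) hq (blk / D.k n)
    have h2 := hc.2.2.1
    have hphc : D.phase n c = (D.l n - 1) * D.q n := by
      obtain ⟨a, ha⟩ := hc.2.2.2
      have h3 := mod_eq_sub_of_le (l := D.l n) (q := D.q n) (y := D.phase n c) (by omega) h2
      rw [ha, Nat.mul_mod_right, ← ha] at h3
      omega
    -- No copy starts in the same block after the last one: the phase there would reach `l n * q n`.
    have hle : (blk + 1) * (D.l n * D.q n) ≤ c' := by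
      by_contra hlt
      rw [add_mul, one_mul, not_le] at hlt
      have h3 := hD.phase_add n blk (r := c' - blk * (D.l n * D.q n)) (by omega)
      rw [show blk * (D.l n * D.q n) + (c' - blk * (D.l n * D.q n)) = c' by omega] at h3
      have := hc'.2.2.1
      omega
    rw [add_mul, one_mul] at hle
    refine ⟨blk * (D.l n * D.q n) + D.l n * D.q n, by omega, hle, by omega, ?_, ?_⟩
    · intro t ht1 ht2
      have h3 := hD.phase_add n blk (r := t - blk * (D.l n * D.q n)) (by omega)
      rw [show blk * (D.l n * D.q n) + (t - blk * (D.l n * D.q n)) = t by omega] at h3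
      by_cases h4 : D.l n * D.q n ≤ D.phase n t
      · exact hD.lett_of_le_phase h4 σ
      · rw [lett_of_phase_mem (by omega) (by omega), mod_eq_sub_of_le (l := D.l n) (by omega) (by omega)]
        exact hD.lett_tail _ _ (by omega) (by omega)
    · intro t ht1 ht2
      have h3 := hD.phase_add n (blk + 1) (r := t - (blk + 1) * (D.l n * D.q n))
        (by rw [add_mul]; omega)
      have hj' := dynIndex_lt (p := D.p n) hq ((blk + 1) / D.k n)
      rw [add_mul, one_mul, show blk * (D.l n * D.q n) + D.l n * D.q n +
        (t - (blk * (D.l n * D.q n) + D.l n * D.q n)) = t by omega] at h3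
      by_cases h4 : D.phase n t < D.q n
      · exact lett_of_phase_lt h4 σ
      · rw [lett_of_phase_mem (by omega) (by omega), Nat.mod_eq_sub_mod (by omega),
          Nat.mod_eq_of_lt (by omega)]
        exact hD.lett_head _ _ (by omega)

theorem Admissible.pieceStarts_disjoint (hD : D.Admissible) {n c c' : ℕ}
    (hc : c ∈ D.pieceStarts n) (hc' : c' ∈ D.pieceStarts n) (h : c < c') : c + D.q n ≤ c' := by
  obtain ⟨s, h1, h2, -⟩ := hD.isSwitch_between hc hc' h 0
  omega

theorem Admissible.exists_piece_of_readsAt (hD : D.Admissible) {n M : ℕ} (hn : 2 ≤ n)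
    (hnM : n ≤ M) {σ τ p : ℕ} (hp : D.ReadsAt n σ (D.lett (M + 1) τ) p)
    (hpl : p + D.q n ≤ D.q (M + 1)) :
    ∃ c ∈ D.pieceStarts M, c ≤ p ∧ p + D.q n ≤ c + D.q M :=
  hD.exists_piece hn hnM (fun _ hc => ⟨_, hD.readsAt_pieceStarts hc τ⟩)
    (fun _ ht h => hD.exists_pieceStart_of_letter ht h)
    (fun _ hc _ hc' h => hD.isSwitch_between hc hc' h τ) hp hpl

/-- The infimum of the empty set is `0`, which is below `s n` too, so no condition on `σ` and `t` is
needed. -/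
theorem stripIndex_lt (n σ t : ℕ) : D.stripIndex n σ t < D.s n := by
  rw [stripIndex]
  rcases Set.eq_empty_or_nonempty {j : ℕ | j < D.s n ∧ D.movedCell n t σ ⊆ D.R n 0 j} with h | h
  · rw [h, Nat.sInf_empty]; exact s_pos n
  · exact (Nat.sInf_mem h).1

theorem strip_lt (n σ t : ℕ) : D.strip n σ t < D.s n := stripIndex_lt _ _ _

/-- A copy running over the end would give the position `q (n + 1)` a phase of at least `q n`, but a
new block starts there, with outer index `q n ≡ 0` and phase `0`. -/
theorem Admissible.pieceStart_add_le (hD : D.Admissible) {n c : ℕ} (hc : c ∈ D.pieceStarts n) :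
    c + D.q n ≤ D.q (n + 1) := by
  have hq := hD.q_pos n
  by_contra h
  have h1 := hD.phase_add_right n (phase_add_lt hc (d := D.q (n + 1) - c)
    (by have := hc.1; omega))
  have h2 := hc.1
  rw [show c + (D.q (n + 1) - c) = D.q (n + 1) by omega] at h1
  have h3 : D.phase n (D.q (n + 1)) = 0 := by
    have h4 := hD.phase_add n (D.q n * D.k n) (r := 0) (hD.lq_pos n)
    rw [Nat.mul_div_cancel _ (D.k_pos n)] at h4
    rw [q_succ, ← mul_assoc, ← add_zero (D.q n * D.k n * (D.l n * D.q n)), h4]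
    simp [dynIndex]
  have := hc.2.1
  omega

/-- An occurrence of a word of `𝒲_n` in a word of `𝒲_N`, `2 ≤ n < N`, is one of those from which
a word of `𝒲_{n+1}` inside it is built. -/
theorem Admissible.exists_parent (hD : D.Admissible) {n N : ℕ} (hn : 2 ≤ n) (hnN : n < N)
    {σ τ p : ℕ} (hτ : τ < D.s N) (hp : D.ReadsAt n σ (D.lett N τ) p) (hpl : p + D.q n ≤ D.q N) :
    ∃ σ' c, σ' < D.s (n + 1) ∧ c + D.q (n + 1) ≤ D.q N ∧
      D.ReadsAt (n + 1) σ' (D.lett N τ) c ∧ c ≤ p ∧ p - c ∈ D.pieceStarts n := by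
  induction N generalizing τ p with
  | zero => omega
  | succ N ih =>
    obtain ⟨c, hc, h1, h2⟩ := hD.exists_piece_of_readsAt hn (by omega) hp hpl
    have hc' := hD.pieceStart_add_le hc
    rcases Nat.lt_or_ge n N with h | h
    · have hr := hD.readsAt_pieceStarts hc τ
      -- The enclosing piece is itself a word of `𝒲_N`, so the search continues inside it until it
      -- has order `n + 1`.
      obtain ⟨σ', c', h3, h4, h5, h6, h7⟩ := ih (τ := D.strip N τ c) (p := p - c) h
        (strip_lt _ _ _)
        (fun r hr' => by
          rw [← hr _ (by omega), ← hp r hr']; congr 1; omega) (by omega)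
      refine ⟨σ', c + c', h3, by omega, ?_, by omega, ?_⟩
      · intro r hr'
        rw [add_assoc, hr _ (by omega), h5 r hr']
      · rwa [← Nat.sub_sub]
    · obtain rfl : n = N := by omega
      refine ⟨τ, 0, hτ, by omega, ?_, Nat.zero_le _, ?_⟩
      · intro r _; rw [zero_add]
      · rw [show p - 0 = c by omega]; exact hc

/-- Both occurrences lie in pieces of the stage below. Distinct pieces are disjoint, a common piece
allows induction, and for `N = n` only the position `0` is possible. -/
theorem Admissible.readsAt_disjoint (hD : D.Admissible) {n N : ℕ} (hn : 2 ≤ n) (hnN : n ≤ N)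
    {σ σ' τ p p' : ℕ} (hp : D.ReadsAt n σ (D.lett N τ) p) (hpl : p + D.q n ≤ D.q N)
    (hp' : D.ReadsAt n σ' (D.lett N τ) p') (hpl' : p' + D.q n ≤ D.q N) (h : p < p') :
    p + D.q n ≤ p' := by
  induction N generalizing τ p p' with
  | zero => omega
  | succ N ih =>
    rcases Nat.lt_or_ge N n with h0 | h0
    · obtain rfl : n = N + 1 := by omega
      omega
    obtain ⟨c, hc, h1, h2⟩ := hD.exists_piece_of_readsAt hn h0 hp hpl
    obtain ⟨c', hc', h1', h2'⟩ := hD.exists_piece_of_readsAt hn h0 hp' hpl'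
    rcases lt_trichotomy c c' with hcc | rfl | hcc
    · have := hD.pieceStarts_disjoint hc hc' hcc
      omega
    · have hr := hD.readsAt_pieceStarts hc τ
      have := ih (τ := D.strip N τ c) (p := p - c) (p' := p' - c) h0
        (fun r hr' => by rw [← hr _ (by omega), ← hp r hr']; congr 1; omega) (by omega)
        (fun r hr' => by rw [← hr _ (by omega), ← hp' r hr']; congr 1; omega) (by omega)
        (by omega)
      omega
    · have := hD.pieceStarts_disjoint hc' hc hcc
      omega

theorem Admissible.exists_readsAt_of_letter (hD : D.Admissible) {n N : ℕ} (hnN : n ≤ N)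
    {τ t : ℕ} (hτ : τ < D.s N) (ht : t < D.q N) (h : ∃ a, D.lett N τ t = Symb.letter a) :
    ∃ σ c, σ < D.s n ∧ c + D.q n ≤ D.q N ∧ D.ReadsAt n σ (D.lett N τ) c ∧ c ≤ t ∧
      t < c + D.q n := by
  induction N generalizing τ t with
  | zero =>
    obtain rfl : n = 0 := by omega
    exact ⟨τ, 0, hτ, by omega, fun r _ => by rw [zero_add], by omega, by omega⟩
  | succ N ih =>
    rcases Nat.lt_or_ge N n with h0 | h0
    · obtain rfl : n = N + 1 := by omega
      exact ⟨τ, 0, hτ, by omega, fun r _ => by rw [zero_add], by omega, by omega⟩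
    obtain ⟨c, hc, h1, h2⟩ := hD.exists_pieceStart_of_letter ht h
    have hr := hD.readsAt_pieceStarts hc τ
    have hc' := hD.pieceStart_add_le hc
    obtain ⟨σ, d, h3, h4, h5, h6, h7⟩ := ih (τ := D.strip N τ c) (t := t - c) h0 (strip_lt _ _ _)
      (by omega) (by
        obtain ⟨a, ha⟩ := h
        refine ⟨a, ?_⟩
        rw [← ha, ← hr _ (by omega)]; congr 1; omega)
    refine ⟨σ, c + d, h3, by omega, ?_, by omega, by omega⟩
    intro r hr'
    rw [add_assoc, hr _ (by omega), h5 r hr']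

end AKData

/-! ### Cells and rotations of the square -/

theorem floor_eq_iff_div {N j : ℕ} (hN : 0 < N) {x : ℝ} (hx : 0 ≤ x) :
    ⌊(N : ℝ) * x⌋₊ = j ↔ (j : ℝ) / N ≤ x ∧ x < (j + 1) / N := by
  have hN' : (0 : ℝ) < N := Nat.cast_pos.mpr hN
  rw [Nat.floor_eq_iff (by positivity), div_le_iff₀ hN', lt_div_iff₀ hN', mul_comm x]

theorem mem_cell {Q N i j : ℕ} (hQ : 0 < Q) (hN : 0 < N) {z : UnitSquare} :
    z ∈ cell Q N i j ↔ ⌊(Q : ℝ) * (z.1 : ℝ)⌋₊ = i ∧ ⌊(N : ℝ) * (z.2 : ℝ)⌋₊ = j := by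
  rw [floor_eq_iff_div hQ z.1.2.1, floor_eq_iff_div hN z.2.2.1, and_assoc]
  rfl

theorem floor_mul_lt {N : ℕ} (hN : 0 < N) (x : Set.Ico (0 : ℝ) 1) :
    ⌊(N : ℝ) * (x : ℝ)⌋₊ < N := by
  have hN' : (0 : ℝ) < N := Nat.cast_pos.mpr hN
  rw [Nat.floor_lt (mul_nonneg hN'.le x.2.1)]
  nlinarith [x.2.2]

theorem floor_mul_div (N c : ℕ) {x : ℝ} : c ≠ 0 →
    ⌊((c * N : ℕ) : ℝ) * x⌋₊ / c = ⌊(N : ℝ) * x⌋₊ := by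
  intro hc
  rw [← Nat.floor_div_natCast, Nat.cast_mul, mul_assoc, mul_div_cancel_left₀]
  exact Nat.cast_ne_zero.mpr hc

theorem div_mem_Ico {j N : ℕ} (h : j < N) : (j : ℝ) / N ∈ Set.Ico (0 : ℝ) 1 := by
  have hN : (0 : ℝ) < N := by exact_mod_cast (Nat.zero_le j).trans_lt h
  refine ⟨by positivity, ?_⟩
  rw [div_lt_one hN]
  exact_mod_cast h

theorem cell_nonempty {Q N i j : ℕ} (hi : i < Q) (hj : j < N) : (cell Q N i j).Nonempty := by
  have hQ : (0 : ℝ) < Q := by exact_mod_cast (Nat.zero_le i).trans_lt hi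
  have hN : (0 : ℝ) < N := by exact_mod_cast (Nat.zero_le j).trans_lt hj
  refine ⟨(⟨(i : ℝ) / Q, div_mem_Ico hi⟩, ⟨(j : ℝ) / N, div_mem_Ico hj⟩), le_rfl, ?_, le_rfl, ?_⟩
  · exact div_lt_div_of_pos_right (by linarith) hQ
  · exact div_lt_div_of_pos_right (by linarith) hN

theorem measurable_floor_mul (N : ℕ) :
    Measurable fun x : Set.Ico (0 : ℝ) 1 => ⌊(N : ℝ) * (x : ℝ)⌋₊ :=
  Nat.measurable_floor.comp (measurable_subtype_coe.const_mul _)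

theorem comap_volume_Ico {N j : ℕ} (h : j < N) :
    (Measure.comap Subtype.val volume : Measure (Set.Ico (0 : ℝ) 1))
      {x | ⌊(N : ℝ) * (x : ℝ)⌋₊ = j} = (N : ℝ≥0∞)⁻¹ := by
  have hN : 0 < N := (Nat.zero_le j).trans_lt h
  have hN' : (0 : ℝ) < N := Nat.cast_pos.mpr hN
  rw [comap_subtype_coe_apply measurableSet_Ico]
  have : Subtype.val '' {x : Set.Ico (0 : ℝ) 1 | ⌊(N : ℝ) * (x : ℝ)⌋₊ = j}
      = Set.Ico ((j : ℝ) / N) ((j + 1) / N) := by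
    ext y
    constructor
    · rintro ⟨x, hx, rfl⟩
      exact (floor_eq_iff_div hN x.2.1).mp hx
    · intro hy
      have h0 : (0 : ℝ) ≤ (j : ℝ) / N := by positivity
      have h1 : ((j : ℝ) + 1) / N ≤ 1 := by
        rw [div_le_one hN']; exact_mod_cast h
      exact ⟨⟨y, h0.trans hy.1, hy.2.trans_le h1⟩,
        (floor_eq_iff_div hN (h0.trans hy.1)).mpr hy, rfl⟩
  rw [this, Real.volume_Ico, ← sub_div, add_sub_cancel_left, one_div,
    ENNReal.ofReal_inv_of_pos hN', ENNReal.ofReal_natCast]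

instance : IsProbabilityMeasure
    (Measure.comap Subtype.val volume : Measure (Set.Ico (0 : ℝ) 1)) := by
  constructor
  rw [comap_subtype_coe_apply measurableSet_Ico, Set.image_univ, Subtype.range_coe,
    Real.volume_Ico, sub_zero, ENNReal.ofReal_one]

instance : IsProbabilityMeasure lebesgue := by
  rw [lebesgue]; infer_instance

theorem lebesgue_cell {Q N i j : ℕ} (hi : i < Q) (hj : j < N) :
    lebesgue (cell Q N i j) = ((Q : ℝ≥0∞) * N)⁻¹ := by
  have h : cell Q N i j = {x : Set.Ico (0 : ℝ) 1 | ⌊(Q : ℝ) * (x : ℝ)⌋₊ = i} ×ˢ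
      {x : Set.Ico (0 : ℝ) 1 | ⌊(N : ℝ) * (x : ℝ)⌋₊ = j} := by
    ext z
    rw [mem_cell ((Nat.zero_le i).trans_lt hi) ((Nat.zero_le j).trans_lt hj)]
    rfl
  rw [h, lebesgue, Measure.prod_prod, comap_volume_Ico hi, comap_volume_Ico hj,
    ENNReal.mul_inv (Or.inr (ENNReal.natCast_ne_top _)) (Or.inl (ENNReal.natCast_ne_top _))]

theorem rot_rot (α β : ℝ) (z : UnitSquare) : rot α (rot β z) = rot (α + β) z := by
  refine Prod.ext (Subtype.ext ?_) rfl
  change Int.fract (Int.fract ((z.1 : ℝ) + β) + α) = Int.fract ((z.1 : ℝ) + (α + β))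
  rw [Int.fract_eq_fract]
  refine ⟨-⌊(z.1 : ℝ) + β⌋, ?_⟩
  rw [Int.fract]; push_cast; ring

theorem rot_add_intCast (α : ℝ) (m : ℤ) (z : UnitSquare) : rot (α + m) z = rot α z := by
  refine Prod.ext (Subtype.ext ?_) rfl
  change Int.fract ((z.1 : ℝ) + (α + m)) = Int.fract ((z.1 : ℝ) + α)
  rw [← add_assoc, Int.fract_add_intCast]

theorem rot_zero (z : UnitSquare) : rot 0 z = z := by
  refine Prod.ext (Subtype.ext ?_) rfl
  change Int.fract ((z.1 : ℝ) + 0) = _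
  rw [add_zero, Int.fract_eq_self.mpr z.1.2]

theorem rot_iterate (α : ℝ) (m : ℕ) (z : UnitSquare) : (rot α)^[m] z = rot (m * α) z := by
  induction m with
  | zero => simp [rot_zero]
  | succ m ih =>
    rw [Function.iterate_succ_apply', ih, rot_rot]
    congr 1
    push_cast; ring

theorem floor_rot {Q : ℕ} (hQ : 0 < Q) (a : ℕ) (z : UnitSquare) :
    ⌊(Q : ℝ) * ((rot ((a : ℝ) / Q) z).1 : ℝ)⌋₊ = (⌊(Q : ℝ) * (z.1 : ℝ)⌋₊ + a) % Q := by
  have hQ' : (0 : ℝ) < Q := Nat.cast_pos.mpr hQ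
  set i := ⌊(Q : ℝ) * (z.1 : ℝ)⌋₊ with hi
  obtain ⟨h1, h2⟩ := (Nat.floor_eq_iff (mul_nonneg hQ'.le z.1.2.1)).mp hi.symm
  have h3 := Nat.div_add_mod (i + a) Q
  have h3' : (Q : ℝ) * ((i + a) / Q : ℕ) + ((i + a) % Q : ℕ) = i + a := by exact_mod_cast h3
  have h4 : (((i + a) % Q : ℕ) : ℝ) + 1 ≤ Q := by exact_mod_cast Nat.mod_lt (i + a) hQ
  have h5 : (0 : ℝ) ≤ ((i + a) % Q : ℕ) := Nat.cast_nonneg _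
  have hfr : Int.fract ((z.1 : ℝ) + (a : ℝ) / Q) = (z.1 : ℝ) + (a : ℝ) / Q - ((i + a) / Q : ℕ) := by
    rw [Int.fract_eq_iff]
    have e : (Q : ℝ) * ((z.1 : ℝ) + (a : ℝ) / Q - ((i + a) / Q : ℕ))
      = Q * z.1 + a - Q * ((i + a) / Q : ℕ) := by field_simp
    refine ⟨?_, ?_, ⟨(((i + a) / Q : ℕ) : ℤ), by rw [Int.cast_natCast]; ring⟩⟩
    · by_contra h
      have := mul_neg_of_pos_of_neg hQ' (not_le.mp h)
      linarith
    · by_contra h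
      have := mul_le_mul_of_nonneg_left (not_lt.mp h) hQ'.le
      linarith
  change ⌊(Q : ℝ) * Int.fract ((z.1 : ℝ) + (a : ℝ) / Q)⌋₊ = _
  have e : (Q : ℝ) * ((z.1 : ℝ) + (a : ℝ) / Q - ((i + a) / Q : ℕ))
      = Q * z.1 + a - Q * ((i + a) / Q : ℕ) := by field_simp
  rw [hfr, e, Nat.floor_eq_iff (by linarith)]
  constructor <;> linarith

namespace AKData

variable {D : AKData}

/-- As `p n` is invertible modulo `q n`, every multiple of `1 / q n` is a multiple of `α n` modulo
`1`. -/
theorem Admissible.h_rot (hD : D.Admissible) (n a : ℕ) (z : UnitSquare) :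
    D.h n (rot ((a : ℝ) / D.q n) z) = rot ((a : ℝ) / D.q n) (D.h n z) := by
  have hq := hD.q_pos n
  have hq' : (0 : ℝ) < D.q n := Nat.cast_pos.mpr hq
  have hit : ∀ m : ℕ, D.h n (rot (m * coefAlpha D.k D.l n) z)
      = rot (m * coefAlpha D.k D.l n) (D.h n z) := by
    intro m
    rw [← rot_iterate, ← rot_iterate]
    exact (Function.Semiconj.iterate_right (D.commute n) m).eq z
  set m := dynIndex (D.p n) (D.q n) a
  have hm := mul_dynIndex_cast hq (coprime_p_q n) a
  have hm' : (((D.p n * m : ℕ) : ℤ) : ZMod (D.q n)) = ((a : ℤ) : ZMod (D.q n)) := by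
    push_cast; exact hm
  rw [ZMod.intCast_eq_intCast_iff_dvd_sub] at hm'
  obtain ⟨c, hc⟩ := hm'
  have hc' : (a : ℝ) - D.p n * m = D.q n * c := by exact_mod_cast hc
  have e : (m : ℝ) * coefAlpha D.k D.l n = (a : ℝ) / D.q n + ((-c : ℤ) : ℝ) := by
    change (m : ℝ) * ((D.p n : ℝ) / D.q n) = _
    field_simp
    push_cast
    linarith
  have := hit m
  rwa [e, rot_add_intCast, rot_add_intCast] at this

theorem Admissible.kq_pos (hD : D.Admissible) (n : ℕ) : 0 < D.k n * D.q n :=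
  Nat.mul_pos (D.k_pos n) (hD.q_pos n)

theorem Admissible.k_le_kq (hD : D.Admissible) (n : ℕ) : D.k n ≤ D.k n * D.q n :=
  Nat.le_mul_of_pos_right _ (hD.q_pos n)

/-- The image is again a small cell over `[0, 1 / q n)`, and `s n ∣ s (n + 1)` puts its strip into a
single strip of `ξ_n`. -/
theorem Admissible.exists_movedCell_subset (hD : D.Admissible) {n t σ : ℕ} (ht : t < D.k n)
    (hσ : σ < D.s (n + 1)) : ∃ j < D.s n, D.movedCell n t σ ⊆ D.R n 0 j := by
  obtain ⟨t', ht', j', hj', h⟩ := D.untwisted n t ht σ hσ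
  obtain ⟨c, hc⟩ := D.s_dvd_s n
  have hc0 : c ≠ 0 := by
    rintro rfl
    have := s_pos (D := D) (n + 1)
    omega
  refine ⟨j' / c, ?_, ?_⟩
  · rw [hc, mul_comm] at hj'
    exact Nat.div_lt_of_lt_mul hj'
  · intro z hz
    replace hz : z ∈ cell (D.k n * D.q n) (D.s (n + 1)) t' j' := h.le hz
    rw [mem_cell (hD.kq_pos n) (s_pos _)] at hz
    rw [R, mem_cell (hD.q_pos n) (s_pos _)]
    constructor
    · rw [← floor_mul_div (D.q n) (D.k n) (D.k_pos n).ne', hz.1]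
      exact Nat.div_eq_of_lt ht'
    · rw [← floor_mul_div (D.s n) c hc0, mul_comm c, ← hc, hz.2]

theorem Admissible.movedCell_subset_iff (hD : D.Admissible) {n t σ j : ℕ} (ht : t < D.k n)
    (hσ : σ < D.s (n + 1)) : D.movedCell n t σ ⊆ D.R n 0 j ↔ D.stripIndex n σ t = j := by
  have huniq : ∀ i i', D.movedCell n t σ ⊆ D.R n 0 i → D.movedCell n t σ ⊆ D.R n 0 i' →
      i = i' := by
    intro i i' h h'
    obtain ⟨z, hz⟩ := cell_nonempty (ht.trans_le (hD.k_le_kq n)) hσ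
    have h1 := h (Set.mem_image_of_mem _ hz)
    have h2 := h' (Set.mem_image_of_mem _ hz)
    rw [R, mem_cell (hD.q_pos n) (s_pos n)] at h1 h2
    exact h1.2.symm.trans h2.2
  have hmem : D.movedCell n t σ ⊆ D.R n 0 (D.stripIndex n σ t) := by
    obtain ⟨j, hj⟩ := hD.exists_movedCell_subset ht hσ
    exact (Nat.sInf_mem (s := {j : ℕ | j < D.s n ∧ D.movedCell n t σ ⊆ D.R n 0 j}) ⟨j, hj⟩).2
  exact ⟨fun h => huniq _ _ hmem h, fun h => h ▸ hmem⟩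

theorem Admissible.ncard_stripIndex (hD : D.Admissible) {n σ j : ℕ} (hσ : σ < D.s (n + 1))
    (hj : j < D.s n) : Set.ncard {t | t < D.k n ∧ D.stripIndex n σ t = j} = D.k n / D.s n := by
  rw [← hD.req2 n j hj σ hσ]
  congr 1
  ext t
  exact and_congr_right fun ht => (hD.movedCell_subset_iff ht hσ).symm

/-- The first copy in block `t < k n` shows the word of the tower `j_t`. By induction equal words
have equal sequences `(j_t)`, and Requirement 3 applies. -/
theorem Admissible.lett_injective (hD : D.Admissible) (n : ℕ) {σ σ' : ℕ} (hσ : σ < D.s n)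
    (hσ' : σ' < D.s n) (h : ∀ t < D.q n, D.lett n σ t = D.lett n σ' t) : σ = σ' := by
  induction n generalizing σ σ' with
  | zero =>
    have h1 := h 0 Nat.one_pos
    simpa [lett] using h1
  | succ n ih =>
    have hq := hD.q_pos n
    refine hD.req3 n σ hσ σ' hσ' fun t ht => ih (stripIndex_lt _ _ _) (stripIndex_lt _ _ _) ?_
    intro r hr
    have hlq := hD.lq_ge n
    have hlt : D.q n + r < D.l n * D.q n := by omega
    have hp := hD.phase_add n t hlt
    rw [Nat.div_eq_of_lt ht, dynIndex_zero, add_zero] at hp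
    have hm : (D.q n + r) % D.q n = r := by rw [Nat.add_mod_left, Nat.mod_eq_of_lt hr]
    have key : ∀ τ, D.lett (n + 1) τ (t * (D.l n * D.q n) + (D.q n + r))
        = D.lett n (D.stripIndex n τ t) r := by
      intro τ
      rw [lett_of_phase_mem (by omega) (by omega), hp, hm, hD.strip_add n τ t hlt,
        Nat.mod_eq_of_lt ht]
    rw [← key, ← key]
    refine h _ ?_
    have e := q_succ (D := D) n
    rw [← mul_assoc] at e
    rw [e]
    calc t * (D.l n * D.q n) + (D.q n + r) < (t + 1) * (D.l n * D.q n) := by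
          rw [add_mul, one_mul]; omega
      _ ≤ _ := Nat.mul_le_mul_right _ (by
          calc t + 1 ≤ D.k n := ht
            _ ≤ D.q n * D.k n := Nat.le_mul_of_pos_left _ hq)

/-! ### The position of a point in the towers -/

section coordinates

variable {X : Type u} [MeasurableSpace X]

/-- The column of the partition `ξ_n` that contains `Z_n⁻¹ x`. -/
noncomputable def col (D : AKData) (Z : UnitSquare ≃ᵐ X) (n : ℕ) (x : X) : ℕ :=
  ⌊(D.q n : ℝ) * (((D.Zmap Z n).symm x).1 : ℝ)⌋₊

/-- The index of the `n`-tower that contains `x`. -/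
noncomputable def tow (D : AKData) (Z : UnitSquare ≃ᵐ X) (n : ℕ) (x : X) : ℕ :=
  ⌊(D.s n : ℝ) * (((D.Zmap Z n).symm x).2 : ℝ)⌋₊

/-- The level of the point `x` in its `n`-tower. -/
noncomputable def pos (D : AKData) (Z : UnitSquare ≃ᵐ X) (n : ℕ) (x : X) : ℕ :=
  dynIndex (D.p n) (D.q n) (D.col Z n x)

variable (Z : UnitSquare ≃ᵐ X)

theorem Admissible.col_lt (hD : D.Admissible) (n : ℕ) (x : X) : D.col Z n x < D.q n :=
  floor_mul_lt (hD.q_pos n) _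

theorem tow_lt (n : ℕ) (x : X) : D.tow Z n x < D.s n := floor_mul_lt (s_pos n) _

theorem Admissible.pos_lt (hD : D.Admissible) (n : ℕ) (x : X) : D.pos Z n x < D.q n :=
  dynIndex_lt (hD.q_pos n) _

theorem measurable_tow (n : ℕ) : Measurable (D.tow Z n) :=
  (measurable_floor_mul _).comp (measurable_snd.comp (D.Zmap Z n).symm.measurable)

theorem measurable_col (n : ℕ) : Measurable (D.col Z n) :=
  (measurable_floor_mul _).comp (measurable_fst.comp (D.Zmap Z n).symm.measurable)

theorem measurable_pos (n : ℕ) : Measurable (D.pos Z n) :=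
  (measurable_of_countable _).comp (measurable_col Z n)

theorem Admissible.col_eq (hD : D.Admissible) (n : ℕ) (x : X) :
    D.col Z n x = D.p n * D.pos Z n x % D.q n := by
  have h := mul_dynIndex_cast (hD.q_pos n) (coprime_p_q n) (D.col Z n x)
  rw [← Nat.cast_mul, ZMod.natCast_eq_natCast_iff', Nat.mod_eq_of_lt (hD.col_lt Z n x)] at h
  exact h.symm

theorem Admissible.col_eq_iff (hD : D.Admissible) (n : ℕ) (x : X) {i : ℕ} (hi : i < D.q n) :
    D.col Z n x = i ↔ D.pos Z n x = dynIndex (D.p n) (D.q n) i := by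
  constructor
  · rintro rfl; rfl
  · intro h
    have h1 := mul_dynIndex_cast (hD.q_pos n) (coprime_p_q n) i
    rw [← h, ← Nat.cast_mul, ZMod.natCast_eq_natCast_iff', Nat.mod_eq_of_lt hi] at h1
    rw [hD.col_eq, h1]

theorem Admissible.mem_image_R (hD : D.Admissible) (n : ℕ) (x : X) {i σ : ℕ} (hi : i < D.q n) :
    x ∈ D.Zmap Z n '' D.R n i σ ↔
      D.pos Z n x = dynIndex (D.p n) (D.q n) i ∧ D.tow Z n x = σ := by
  rw [← hD.col_eq_iff Z n x hi]
  constructor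
  · rintro ⟨z, hz, rfl⟩
    rw [col, tow, MeasurableEquiv.symm_apply_apply]
    exact (mem_cell (hD.q_pos n) (s_pos n)).mp hz
  · intro h
    exact ⟨(D.Zmap Z n).symm x, (mem_cell (hD.q_pos n) (s_pos n)).mpr h,
      MeasurableEquiv.apply_symm_apply _ _⟩

theorem h_Zmap_symm (n : ℕ) (x : X) :
    D.h n ((D.Zmap Z (n + 1)).symm x) = (D.Zmap Z n).symm x := by
  change D.h n ((D.h n).symm ((D.Zmap Z n).symm x)) = _
  rw [MeasurableEquiv.apply_symm_apply]

/-- Turn the point back into `[0, 1 / q n)`, where `stripIndex` describes `h n`, and use that `h n`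
commutes with turning by whole columns. -/
theorem Admissible.floor_h (hD : D.Admissible) (n : ℕ) (z : UnitSquare) :
    ⌊(D.q n : ℝ) * ((D.h n z).1 : ℝ)⌋₊
      = ⌊(D.q (n + 1) : ℝ) * (z.1 : ℝ)⌋₊ / (D.l n * D.q n) / D.k n ∧
    ⌊(D.s n : ℝ) * ((D.h n z).2 : ℝ)⌋₊
      = D.stripIndex n ⌊(D.s (n + 1) : ℝ) * (z.2 : ℝ)⌋₊
        (⌊(D.q (n + 1) : ℝ) * (z.1 : ℝ)⌋₊ / (D.l n * D.q n) % D.k n) := by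
  have hq := hD.q_pos n
  have hk := D.k_pos n
  have hkq := hD.kq_pos n
  have e1 : ⌊(D.q (n + 1) : ℝ) * (z.1 : ℝ)⌋₊ / (D.l n * D.q n)
      = ⌊((D.k n * D.q n : ℕ) : ℝ) * (z.1 : ℝ)⌋₊ := by
    rw [← floor_mul_div (D.k n * D.q n) (D.l n * D.q n) (hD.lq_pos n).ne', q_succ]
    congr 4
    ring
  rw [e1]
  set c := ⌊((D.k n * D.q n : ℕ) : ℝ) * (z.1 : ℝ)⌋₊ with hc
  have hclt : c < D.k n * D.q n := floor_mul_lt hkq _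
  set a := c / D.k n
  have ha : a < D.q n := Nat.div_lt_of_lt_mul hclt
  have hca : D.k n * a + c % D.k n = c := Nat.div_add_mod c (D.k n)
  -- Turning forward by `q n - a` columns is turning back by `a`.
  set z₀ := rot (((D.q n - a : ℕ) : ℝ) / D.q n) z with hz₀
  have hz : rot ((a : ℝ) / D.q n) z₀ = z := by
    rw [hz₀, rot_rot, ← add_div, ← Nat.cast_add, Nat.add_sub_cancel' ha.le,
      div_self (Nat.cast_ne_zero.mpr hq.ne')]
    have := rot_add_intCast 0 1 z
    rwa [zero_add, Int.cast_one, rot_zero] at this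
  have hcell : z₀ ∈ cell (D.k n * D.q n) (D.s (n + 1)) (c % D.k n)
      ⌊(D.s (n + 1) : ℝ) * (z.2 : ℝ)⌋₊ := by
    rw [mem_cell hkq (s_pos _)]
    refine ⟨?_, rfl⟩
    have e : ((D.q n - a : ℕ) : ℝ) / D.q n
        = ((D.k n * (D.q n - a) : ℕ) : ℝ) / (D.k n * D.q n : ℕ) := by
      rw [Nat.cast_mul, Nat.cast_mul, mul_div_mul_left _ _ (Nat.cast_ne_zero.mpr hk.ne')]
    rw [hz₀, e, floor_rot hkq, ← hc]
    have : c + D.k n * (D.q n - a) = D.k n * D.q n + c % D.k n := by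
      rw [Nat.mul_sub]
      have : D.k n * a ≤ D.k n * D.q n := Nat.mul_le_mul_left _ ha.le
      omega
    rw [this, Nat.add_mod_left, Nat.mod_eq_of_lt ((Nat.mod_lt _ hk).trans_le (hD.k_le_kq n))]
  have hR := ((hD.movedCell_subset_iff (Nat.mod_lt c hk) (floor_mul_lt (s_pos _) z.2)).mpr rfl)
    (Set.mem_image_of_mem _ hcell)
  rw [R, mem_cell hq (s_pos n)] at hR
  have hh : D.h n z = rot ((a : ℝ) / D.q n) (D.h n z₀) := by rw [← hD.h_rot, hz]
  rw [hh]
  refine ⟨?_, hR.2⟩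
  rw [floor_rot hq, hR.1, zero_add, Nat.mod_eq_of_lt ha]

theorem Admissible.col_succ (hD : D.Admissible) (n : ℕ) (x : X) :
    D.col Z n x = D.col Z (n + 1) x / (D.l n * D.q n) / D.k n ∧
    D.tow Z n x = D.stripIndex n (D.tow Z (n + 1) x)
      (D.col Z (n + 1) x / (D.l n * D.q n) % D.k n) := by
  have := hD.floor_h n ((D.Zmap Z (n + 1)).symm x)
  rw [h_Zmap_symm] at this
  exact this

/-- This is where the geometry produces the operator `𝒞_n`. The column at stage `n` is the column at
stage `n + 1` divided by `l n * q n * k n`; multiplying by `p_n⁻¹` turns columns into levels, and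
the carry becomes the offset in `phase`. -/
theorem Admissible.pos_succ (hD : D.Admissible) (n : ℕ) (x : X) :
    D.pos Z n x = D.phase n (D.pos Z (n + 1) x) % D.q n ∧
    D.tow Z n x = D.strip n (D.tow Z (n + 1) x) (D.pos Z (n + 1) x) := by
  have hq := hD.q_pos n
  obtain ⟨h1, h2⟩ := hD.col_succ Z n x
  set t := D.pos Z (n + 1) x with ht
  -- From `p_{n+1} = l_n q_n k_n p_n + 1` up to the factor `q_n`: moving `t` levels up shifts the
  -- column by `t` plus a multiple of `l_n q_n k_n`.
  have h3 : D.col Z (n + 1) x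
      = (t + D.l n * D.q n * D.k n * (D.p n * t)) % (D.l n * D.q n * D.k n * D.q n) := by
    rw [hD.col_eq, p_succ, q_succ, ← ht]
    congr 1 <;> ring
  have h4 : D.col Z n x = (t / (D.l n * D.q n) / D.k n + D.p n * t) % D.q n := by
    rw [h1, Nat.div_div_eq_div_mul, h3, Nat.mod_mul_right_div_self, Nat.add_mul_div_left _ _
      (Nat.mul_pos (hD.lq_pos n) (D.k_pos n)), Nat.div_div_eq_div_mul]
  constructor
  · rw [pos]
    apply dynIndex_eq_of_cast hq (coprime_p_q n)
    rw [h4, ZMod.natCast_mod, phase, Nat.cast_add, mul_add, mul_dynIndex_cast hq (coprime_p_q n)]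
    -- The block length is a multiple of `q n`, so the place in the block and the level agree modulo
    -- `q n`.
    have h5 : ((t % (D.l n * D.q n) : ℕ) : ZMod (D.q n)) = (t : ℕ) := by
      rw [ZMod.natCast_eq_natCast_iff', Nat.mod_mod_of_dvd _ (Dvd.intro_left _ rfl)]
    rw [h5]
    push_cast
    ring
  · rw [h2, strip]
    congr 1
    rw [h3, ← Nat.mod_mul_right_div_self, Nat.mod_mul_right_mod, Nat.add_mul_mod_self_left,
      Nat.mod_mul_right_div_self]

theorem Admissible.col_approx (hD : D.Admissible) (n : ℕ) (x : X) :
    D.pos Z n (D.approx Z n x) = (D.pos Z n x + 1) % D.q n ∧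
    D.tow Z n (D.approx Z n x) = D.tow Z n x := by
  have hq := hD.q_pos n
  constructor
  · have h1 : D.col Z n (D.approx Z n x) = (D.col Z n x + D.p n) % D.q n := by
      rw [col, approx, MeasurableEquiv.symm_apply_apply]
      exact floor_rot hq (D.p n) _
    rw [pos, h1]
    apply dynIndex_eq_of_cast hq (coprime_p_q n)
    rw [ZMod.natCast_mod, Nat.cast_add, Nat.cast_one, mul_add, mul_one, pos,
      mul_dynIndex_cast hq (coprime_p_q n), Nat.cast_add]
  · rw [tow, approx, MeasurableEquiv.symm_apply_apply]
    rfl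

theorem measurePreserving_Zmap {μ : Measure X} (hZ : MeasurePreserving Z lebesgue μ) :
    ∀ n, MeasurePreserving (D.Zmap Z n) lebesgue μ
  | 0 => hZ
  | n + 1 => (measurePreserving_Zmap hZ n).comp (D.measurePreserving n)

/-- The points of a given level of a given `n`-tower. -/
def level (D : AKData) (Z : UnitSquare ≃ᵐ X) (n t σ : ℕ) : Set X :=
  {x | D.pos Z n x = t ∧ D.tow Z n x = σ}

theorem measurableSet_level (n t σ : ℕ) : MeasurableSet (D.level Z n t σ) :=
  (measurable_pos Z n (MeasurableSet.singleton t)).inter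
    (measurable_tow Z n (MeasurableSet.singleton σ))

theorem Admissible.measure_level (hD : D.Admissible) {μ : Measure X}
    (hZ : MeasurePreserving Z lebesgue μ) {n t σ : ℕ} (ht : t < D.q n) (hσ : σ < D.s n) :
    μ (D.level Z n t σ) = ((D.q n : ℝ≥0∞) * D.s n)⁻¹ := by
  have hq := hD.q_pos n
  have hi : D.p n * t % D.q n < D.q n := Nat.mod_lt _ hq
  rw [← lebesgue_cell hi hσ, ← (measurePreserving_Zmap Z hZ n).measure_preimage
    (measurableSet_level Z n t σ).nullMeasurableSet]
  congr 1
  ext z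
  have h := hD.mem_image_R Z n (D.Zmap Z n z) (σ := σ) hi
  rw [(D.Zmap Z n).injective.mem_set_image, dynIndex_eq_of_cast hq (coprime_p_q n) (t := t)
    (by rw [ZMod.natCast_mod, Nat.cast_mul]), Nat.mod_eq_of_lt ht] at h
  exact h.symm

theorem Admissible.floor_h_congr (hD : D.Admissible) {n m : ℕ} (hnm : n < m) {w w' : UnitSquare}
    (h1 : ⌊(D.q m : ℝ) * (w.1 : ℝ)⌋₊ = ⌊(D.q m : ℝ) * (w'.1 : ℝ)⌋₊)
    (h2 : ⌊(D.s m : ℝ) * (w.2 : ℝ)⌋₊ = ⌊(D.s m : ℝ) * (w'.2 : ℝ)⌋₊) :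
    ⌊(D.q m : ℝ) * ((D.h n w).1 : ℝ)⌋₊ = ⌊(D.q m : ℝ) * ((D.h n w').1 : ℝ)⌋₊ ∧
    ⌊(D.s m : ℝ) * ((D.h n w).2 : ℝ)⌋₊ = ⌊(D.s m : ℝ) * ((D.h n w').2 : ℝ)⌋₊ := by
  obtain ⟨i', -, j', -, h⟩ := D.permutes n m hnm _ (floor_mul_lt (hD.q_pos m) w.1) _
    (floor_mul_lt (s_pos m) w.2)
  have hw : w ∈ cell (D.q m) (D.s m) ⌊(D.q m : ℝ) * (w.1 : ℝ)⌋₊ ⌊(D.s m : ℝ) * (w.2 : ℝ)⌋₊ :=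
    (mem_cell (hD.q_pos m) (s_pos m)).mpr ⟨rfl, rfl⟩
  have hw' : w' ∈ cell (D.q m) (D.s m) ⌊(D.q m : ℝ) * (w.1 : ℝ)⌋₊ ⌊(D.s m : ℝ) * (w.2 : ℝ)⌋₊ :=
    (mem_cell (hD.q_pos m) (s_pos m)).mpr ⟨h1.symm, h2.symm⟩
  change D.h n '' cell (D.q m) (D.s m) _ _ = cell (D.q m) (D.s m) i' j' at h
  have h3 : D.h n w ∈ cell (D.q m) (D.s m) i' j' := h ▸ Set.mem_image_of_mem _ hw
  have h4 : D.h n w' ∈ cell (D.q m) (D.s m) i' j' := h ▸ Set.mem_image_of_mem _ hw'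
  rw [mem_cell (hD.q_pos m) (s_pos m)] at h3 h4
  exact ⟨h3.1.trans h4.1.symm, h3.2.trans h4.2.symm⟩

/-- Levels of stage `m` are defined through `Z_m⁻¹`. Since each of `h_1, …, h_m` permutes the atoms
of `ξ_m`, two points on the same level also share an atom of `ξ_m` in the fixed coordinates `Z⁻¹`.
-/
theorem Admissible.floor_Zmap_congr (hD : D.Admissible) {n m : ℕ} (hnm : n ≤ m)
    {w w' : UnitSquare}
    (h1 : ⌊(D.q m : ℝ) * (w.1 : ℝ)⌋₊ = ⌊(D.q m : ℝ) * (w'.1 : ℝ)⌋₊)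
    (h2 : ⌊(D.s m : ℝ) * (w.2 : ℝ)⌋₊ = ⌊(D.s m : ℝ) * (w'.2 : ℝ)⌋₊) :
    ⌊(D.q m : ℝ) * ((Z.symm (D.Zmap Z n w)).1 : ℝ)⌋₊
      = ⌊(D.q m : ℝ) * ((Z.symm (D.Zmap Z n w')).1 : ℝ)⌋₊ ∧
    ⌊(D.s m : ℝ) * ((Z.symm (D.Zmap Z n w)).2 : ℝ)⌋₊
      = ⌊(D.s m : ℝ) * ((Z.symm (D.Zmap Z n w')).2 : ℝ)⌋₊ := by
  induction n generalizing w w' with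
  | zero =>
    change ⌊(D.q m : ℝ) * ((Z.symm (Z w)).1 : ℝ)⌋₊ = ⌊(D.q m : ℝ) * ((Z.symm (Z w')).1 : ℝ)⌋₊ ∧
      ⌊(D.s m : ℝ) * ((Z.symm (Z w)).2 : ℝ)⌋₊ = ⌊(D.s m : ℝ) * ((Z.symm (Z w')).2 : ℝ)⌋₊
    rw [MeasurableEquiv.symm_apply_apply, MeasurableEquiv.symm_apply_apply]
    exact ⟨h1, h2⟩
  | succ n ih =>
    obtain ⟨h3, h4⟩ := hD.floor_h_congr (n := n) (by omega) h1 h2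
    exact ih (by omega) h3 h4

theorem eq_of_frequently_floor_eq {N : ℕ → ℕ} (hN : Tendsto N atTop atTop) {P : ℕ → Prop}
    (hP : ∃ᶠ n in atTop, P n) {x y : Set.Ico (0 : ℝ) 1}
    (h : ∀ n, P n → ⌊(N n : ℝ) * (x : ℝ)⌋₊ = ⌊(N n : ℝ) * (y : ℝ)⌋₊) : x = y := by
  refine Subtype.ext (sub_eq_zero.mp (abs_eq_zero.mp (le_antisymm (le_of_forall_pos_le_add
    fun ε hε => ?_) (abs_nonneg _))))
  obtain ⟨M, hM⟩ := exists_nat_gt ε⁻¹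
  obtain ⟨n, hn, hn'⟩ := (hP.and_eventually (hN.eventually_ge_atTop (M + 1))).exists
  have hpos : (0 : ℝ) < N n := by exact_mod_cast (Nat.succ_pos M).trans_le hn'
  obtain ⟨h1, h2⟩ := (Nat.floor_eq_iff (mul_nonneg hpos.le x.2.1)).mp (h n hn)
  obtain ⟨h3, h4⟩ := (Nat.floor_eq_iff (mul_nonneg hpos.le y.2.1)).mp rfl
  have h5 : (N n : ℝ) * |(x : ℝ) - y| < 1 := by
    rw [← abs_of_pos hpos, ← abs_mul, abs_lt, mul_sub]
    constructor <;> linarith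
  have h6 : ε⁻¹ < N n := hM.trans (by exact_mod_cast (Nat.lt_succ_self M).trans_le hn')
  rw [zero_add]
  by_contra h7
  have h8 := mul_lt_mul'' h6 (not_le.mp h7) (by positivity) hε.le
  rw [inv_mul_cancel₀ hε.ne'] at h8
  linarith

theorem Admissible.tendsto_q (hD : D.Admissible) : Tendsto D.q atTop atTop :=
  tendsto_atTop_mono (fun n => (hD.lt_q n).le) tendsto_id

/-- Infinitely often the two points share, in the coordinates `Z⁻¹`, a rectangle with sides `1 / q
n` and `1 / s n`, and both sides tend to `0` by Requirement 1. -/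
theorem Admissible.eq_of_frequently (hD : D.Admissible) {x x' : X}
    (h : ∃ᶠ n in atTop, D.pos Z n x = D.pos Z n x' ∧ D.tow Z n x = D.tow Z n x') : x = x' := by
  have key : ∀ n, D.pos Z n x = D.pos Z n x' ∧ D.tow Z n x = D.tow Z n x' →
      ⌊(D.q n : ℝ) * ((Z.symm x).1 : ℝ)⌋₊ = ⌊(D.q n : ℝ) * ((Z.symm x').1 : ℝ)⌋₊ ∧
      ⌊(D.s n : ℝ) * ((Z.symm x).2 : ℝ)⌋₊ = ⌊(D.s n : ℝ) * ((Z.symm x').2 : ℝ)⌋₊ := by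
    rintro n ⟨h1, h2⟩
    have h3 : D.col Z n x = D.col Z n x' := by rw [hD.col_eq, hD.col_eq, h1]
    have := hD.floor_Zmap_congr Z le_rfl h3 h2
    rwa [MeasurableEquiv.apply_symm_apply, MeasurableEquiv.apply_symm_apply] at this
  apply Z.symm.injective
  exact Prod.ext (eq_of_frequently_floor_eq hD.tendsto_q h fun n hn => (key n hn).1)
    (eq_of_frequently_floor_eq hD.req1 h fun n hn => (key n hn).2)

theorem Admissible.mem_labelled (hD : D.Admissible) (n : ℕ) (c : Symb Unit) (x : X) :
    (D.Zmap Z (n + 1)).symm x ∈ D.labelled n c ↔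
      (D.skeleton n)[D.pos Z (n + 1) x]? = some c := by
  have hq := hD.q_pos (n + 1)
  constructor
  · rintro ⟨i, hi, h1, h2, h3⟩
    have h4 : D.col Z (n + 1) x = i := (floor_eq_iff_div hq
      ((D.Zmap Z (n + 1)).symm x).1.2.1).mpr ⟨h1, h2⟩
    rw [pos, h4, h3]
  · intro h
    obtain ⟨h1, h2⟩ := (floor_eq_iff_div (j := D.col Z (n + 1) x) hq
      (((D.Zmap Z (n + 1)).symm x).1.2).1).mp rfl
    exact ⟨D.col Z (n + 1) x, hD.col_lt Z _ x, h1, h2, h⟩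

end coordinates

end AKData

/-! ### The words of the towers form a circular construction sequence -/

theorem occursAt_iff {α : Type u} {w u : List α} {i : ℕ} :
    OccursAt w u i ↔ ∀ r < w.length, u[i + r]? = w[r]? := by
  rw [OccursAt, List.prefix_iff_getElem?]
  constructor
  · intro h r hr
    rw [← List.getElem?_drop, h r hr, List.getElem?_eq_getElem hr]
  · intro h r hr
    rw [List.getElem?_drop, h r hr, List.getElem?_eq_getElem hr]

theorem OccursAt.isInfix {α : Type u} {w u : List α} {i : ℕ} (h : OccursAt w u i) : w <:+: u :=
  List.IsInfix.trans (List.IsPrefix.isInfix h) (List.drop_suffix i u).isInfix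

namespace AKData

variable {D : AKData}

theorem Admissible.towerWord_injective (hD : D.Admissible) (n : ℕ) {σ σ' : ℕ} (hσ : σ < D.s n)
    (hσ' : σ' < D.s n) (h : D.towerWord n σ = D.towerWord n σ') : σ = σ' := by
  refine hD.lett_injective n hσ hσ' fun t ht => ?_
  have h1 := hD.getElem?_towerWord n σ ht
  rw [h, hD.getElem?_towerWord n σ' ht] at h1
  exact (Option.some.inj h1).symm

theorem Admissible.ncard_words (hD : D.Admissible) (n : ℕ) : (D.words n).ncard = D.s n := by
  have h : D.words n = D.towerWord n '' Set.Iio (D.s n) := by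
    ext w
    constructor
    · rintro ⟨σ, hσ, rfl⟩; exact ⟨σ, hσ, rfl⟩
    · rintro ⟨σ, hσ, rfl⟩; exact ⟨σ, hσ, rfl⟩
  rw [h, Set.InjOn.ncard_image (s := Set.Iio (D.s n))
      fun σ hσ σ' hσ' he => hD.towerWord_injective n hσ hσ' he,
    ← Finset.coe_Iio, Set.ncard_coe_finset, Nat.card_Iio]

theorem words_succ (n : ℕ) :
    D.words (n + 1) = circOp (D.l n) (D.p n) (D.q n) '' D.prewords n := by
  ext w
  constructor
  · rintro ⟨σ, hσ, rfl⟩; exact ⟨_, ⟨σ, hσ, rfl⟩, rfl⟩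
  · rintro ⟨_, ⟨σ, hσ, rfl⟩, rfl⟩; exact ⟨σ, hσ, rfl⟩

theorem towerWord_mem_words {n σ : ℕ} (hσ : σ < D.s n) : D.towerWord n σ ∈ D.words n :=
  ⟨σ, hσ, rfl⟩

theorem prewords_spec {n : ℕ} {v : List (List (Symb ℕ))} (hv : v ∈ D.prewords n) :
    v.length = D.k n ∧ ∀ w ∈ v, w ∈ D.words n := by
  obtain ⟨σ, -, rfl⟩ := hv
  refine ⟨by simp, fun w hw => ?_⟩
  simp only [List.mem_map] at hw
  obtain ⟨t, -, rfl⟩ := hw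
  exact towerWord_mem_words (stripIndex_lt _ _ _)

theorem Admissible.ncard_preword (hD : D.Admissible) {n : ℕ} {v : List (List (Symb ℕ))}
    (hv : v ∈ D.prewords n) {w : List (Symb ℕ)} (hw : w ∈ D.words n) :
    Set.ncard {t : ℕ | v[t]? = some w} = D.k n / D.s n := by
  obtain ⟨σ, hσ, rfl⟩ := hv
  obtain ⟨j, hj, rfl⟩ := hw
  rw [← hD.ncard_stripIndex hσ hj]
  congr 1
  ext t
  simp only [Set.mem_ofPred_eq, List.getElem?_map]
  by_cases ht : t < D.k n
  · rw [List.getElem?_range ht, Option.map_some]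
    constructor
    · intro h
      exact ⟨ht, hD.towerWord_injective n (stripIndex_lt _ _ _) hj (Option.some.inj h)⟩
    · rintro ⟨-, h⟩; rw [h]
  · rw [List.getElem?_eq_none (by simpa using ht)]
    simp [ht]

theorem Admissible.occursAt_towerWord (hD : D.Admissible) {n N σ τ p : ℕ} :
    OccursAt (D.towerWord n σ) (D.towerWord N τ) p ↔
      p + D.q n ≤ D.q N ∧ D.ReadsAt n σ (D.lett N τ) p := by
  have hq := hD.q_pos n
  rw [occursAt_iff, hD.length_towerWord]
  constructor
  · intro h
    have hle : p + D.q n ≤ D.q N := by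
      by_contra hlt
      have h1 := h (D.q n - 1) (by omega)
      rw [hD.getElem?_towerWord n σ (by omega),
        List.getElem?_eq_none (by rw [hD.length_towerWord]; omega)] at h1
      cases h1
    refine ⟨hle, fun r hr => ?_⟩
    have h1 := h r hr
    rw [hD.getElem?_towerWord n σ hr, hD.getElem?_towerWord N τ (by omega)] at h1
    exact Option.some.inj h1
  · rintro ⟨hle, h⟩ r hr
    rw [hD.getElem?_towerWord n σ hr, hD.getElem?_towerWord N τ (by omega), h r hr]

/-- The letters of the concatenation of two words of `𝒲_n`. -/
noncomputable def pairLett (D : AKData) (n σ τ t : ℕ) : Symb ℕ :=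
  if t < D.q n then D.lett n σ t else D.lett n τ (t - D.q n)

theorem Admissible.getElem?_append_towerWord (hD : D.Admissible) {n σ τ t : ℕ}
    (ht : t < 2 * D.q n) :
    (D.towerWord n σ ++ D.towerWord n τ)[t]? = some (D.pairLett n σ τ t) := by
  rw [pairLett]
  split_ifs with h
  · rw [List.getElem?_append_left (by rwa [hD.length_towerWord]), hD.getElem?_towerWord n σ h]
  · rw [List.getElem?_append_right (by rw [hD.length_towerWord]; omega), hD.length_towerWord,
      hD.getElem?_towerWord n τ (by omega)]

theorem Admissible.uniquelyReadable_words (hD : D.Admissible) {n : ℕ}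
    (h : ∀ σ < D.s n, ∀ τ < D.s n, ∀ ρ < D.s n, ∀ d, 0 < d → d < D.q n →
      ¬ D.ReadsAt n ρ (D.pairLett n σ τ) d) : UniquelyReadable (D.words n) := by
  rintro _ ⟨σ, hσ, rfl⟩ _ ⟨τ, hτ, rfl⟩ _ ⟨ρ, hρ, rfl⟩ p s heq
  by_contra hps
  rw [not_or] at hps
  have hp := List.length_pos_iff.mpr hps.1
  have hs := List.length_pos_iff.mpr hps.2
  have hlen := congrArg List.length heq
  simp only [List.length_append, hD.length_towerWord] at hlen
  refine h σ hσ τ hτ ρ hρ p.length hp (by omega) fun r hr => ?_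
  have h1 := congrArg (fun L : List (Symb ℕ) => L[p.length + r]?) heq
  rw [hD.getElem?_append_towerWord (by omega), List.append_assoc,
    List.getElem?_append_right (by omega), add_tsub_cancel_left,
    List.getElem?_append_left (by rwa [hD.length_towerWord]), hD.getElem?_towerWord n ρ hr] at h1
  exact Option.some.inj h1

/-- The seam of two words of `𝒲_n` is a switch, so `exists_piece` applies with pieces at `0` and `q
n`, and an occurrence must coincide with one of them. -/
theorem Admissible.not_readsAt_pair (hD : D.Admissible) {n : ℕ} (hn : 2 ≤ n) (σ τ ρ : ℕ) {d : ℕ}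
    (h0 : 0 < d) (hd : d < D.q n) : ¬ D.ReadsAt n ρ (D.pairLett n σ τ) d := by
  intro h
  have hq := hD.q_pos n
  have hBE := hD.headLen_add_tailLen n
  have hσ : D.ReadsAt n σ (D.pairLett n σ τ) 0 := fun r hr => by
    rw [zero_add, pairLett, if_pos hr]
  have hτ : D.ReadsAt n τ (D.pairLett n σ τ) (D.q n) := fun r hr => by
    rw [pairLett, if_neg (by omega), add_tsub_cancel_left]
  obtain ⟨c, hc, h1, h2⟩ := hD.exists_piece (C := {0, D.q n}) (len := 2 * D.q n) hn le_rfl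
    (by
      rintro c (rfl | rfl)
      · exact ⟨σ, hσ⟩
      · exact ⟨τ, hτ⟩)
    (by
      intro t ht _
      by_cases h1 : t < D.q n
      · exact ⟨0, Or.inl rfl, by omega, by omega⟩
      · exact ⟨D.q n, Or.inr rfl, by omega, by omega⟩)
    (by
      rintro c (rfl | rfl) c' (rfl | rfl) hcc
      · omega
      · refine ⟨D.q n, by omega, le_rfl, by omega, ?_, ?_⟩
        · intro t h1 h2
          have := hσ t h2
          rw [zero_add] at this
          rw [this]
          exact hD.lett_tail _ _ (by omega) (by omega)
        · intro t h1 h2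
          have := hτ (t - D.q n) (by omega)
          rw [Nat.add_sub_cancel' h1] at this
          rw [this]
          exact hD.lett_head _ _ (by omega)
      · omega
      · omega)
    h (by omega)
  rcases hc with rfl | rfl <;> omega

/-! #### The words of `𝒲_1` -/

theorem dynIndex_one (p i : ℕ) : dynIndex p 1 i = 0 := by
  have := dynIndex_lt (p := p) Nat.one_pos i
  omega

theorem phase_zero (t : ℕ) : D.phase 0 t = t % D.l 0 := by
  rw [phase, q_zero, dynIndex_one, mul_one, add_zero]

theorem Admissible.lett_one (hD : D.Admissible) (σ t : ℕ) :
    D.lett 1 σ t = if t % D.l 0 = 0 then Symb.b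
      else Symb.letter (D.stripIndex 0 σ (t / D.l 0 % D.k 0)) := by
  have h := Nat.mod_lt t (hD.l_pos 0)
  split_ifs with h1
  · exact lett_of_phase_lt (by rw [phase_zero, h1, q_zero]; omega) σ
  · rw [lett_of_phase_mem (by rw [phase_zero, q_zero]; omega)
      (by rw [phase_zero, q_zero]; omega), lett, strip, q_zero, mul_one]

theorem q_one : D.q 1 = D.k 0 * D.l 0 := by
  rw [q_succ, q_zero]; ring

/-- Words of `𝒲_1` are products of blocks `b a^(l_0 - 1)`, with `b` at the multiples of `l 0` only.
A shifted occurrence is therefore shifted by whole blocks, and keeping one letter per block yields a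
shifted occurrence of prewords. -/
theorem Admissible.not_readsAt_pair_one (hD : D.Admissible)
    (hP : UniquelyReadable (D.prewords 0)) {σ τ ρ : ℕ} (hσ : σ < D.s 1) (hτ : τ < D.s 1)
    (hρ : ρ < D.s 1) {d : ℕ} (h0 : 0 < d) (hd : d < D.q 1) :
    ¬ D.ReadsAt 1 ρ (D.pairLett 1 σ τ) d := by
  intro h
  have hl := hD.eight_le_l 0
  have hk := D.k_pos 0
  have hq1 := q_one (D := D)
  have hb : ∀ t, (D.pairLett 1 σ τ t = Symb.b → D.l 0 ∣ t) := by
    intro t ht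
    rw [pairLett] at ht
    split_ifs at ht with h1
    · rw [hD.lett_one] at ht
      split_ifs at ht with h2
      exact Nat.dvd_of_mod_eq_zero h2
    · rw [hD.lett_one] at ht
      split_ifs at ht with h2
      have h3 := Nat.dvd_of_mod_eq_zero h2
      have h4 : D.l 0 ∣ D.q 1 := Dvd.intro_left _ hq1.symm
      have := (Nat.dvd_add_right h4).mpr h3
      rwa [Nat.add_sub_cancel' (not_lt.mp h1)] at this
  obtain ⟨d', rfl⟩ : D.l 0 ∣ d := by
    apply hb
    have := h 0 (hD.q_pos 1)
    rw [add_zero, hD.lett_one, Nat.zero_mod, if_pos rfl] at this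
    exact this
  have hd'k : d' < D.k 0 := by
    rw [hq1, mul_comm] at hd
    exact lt_of_mul_lt_mul_right hd (Nat.zero_le _)
  have hd'0 : 0 < d' := Nat.pos_of_mul_pos_left h0
  set pre : ℕ → List (List (Symb ℕ)) := fun σ =>
    (List.range (D.k 0)).map fun t => D.towerWord 0 (D.stripIndex 0 σ t) with hpre
  have hpl : ∀ σ, (pre σ).length = D.k 0 := fun σ => by simp [hpre]
  have hpg : ∀ σ t, t < D.k 0 → (pre σ)[t]? = some [Symb.letter (D.stripIndex 0 σ t)] := by
    intro σ t ht
    rw [hpre]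
    simp only [List.getElem?_map, List.getElem?_range ht]
    rfl
  have hlett : ∀ σ t, t < D.k 0 → D.lett 1 σ (t * D.l 0 + 1)
      = Symb.letter (D.stripIndex 0 σ t) := by
    intro σ t ht
    have e1 : (t * D.l 0 + 1) % D.l 0 = 1 := by
      rw [mul_comm, Nat.mul_add_mod, Nat.mod_eq_of_lt (by omega)]
    have e2 : (t * D.l 0 + 1) / D.l 0 = t := by
      rw [mul_comm, Nat.mul_add_div (by omega), Nat.div_eq_of_lt (by omega), add_zero]
    rw [hD.lett_one, e1, e2, if_neg one_ne_zero, Nat.mod_eq_of_lt ht]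
  have hocc : ∀ j < D.k 0, (pre σ ++ pre τ)[d' + j]? = (pre ρ)[j]? := by
    intro j hj
    have hj1 : j * D.l 0 + 1 < D.q 1 := by
      rw [hq1]
      calc j * D.l 0 + 1 < (j + 1) * D.l 0 := by rw [add_mul]; omega
        _ ≤ _ := Nat.mul_le_mul_right _ hj
    have h1 := h (j * D.l 0 + 1) hj1
    rw [hlett ρ j hj, show D.l 0 * d' + (j * D.l 0 + 1) = (d' + j) * D.l 0 + 1 by ring,
      pairLett] at h1
    rw [hpg ρ j hj]
    by_cases h2 : d' + j < D.k 0
    · rw [if_pos (by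
        rw [hq1]
        calc (d' + j) * D.l 0 + 1 < (d' + j + 1) * D.l 0 := by rw [add_mul _ 1]; omega
          _ ≤ _ := Nat.mul_le_mul_right _ h2), hlett σ _ h2] at h1
      rw [List.getElem?_append_left (by rwa [hpl]), hpg σ _ h2, Symb.letter.inj h1]
    · have h3 : D.q 1 ≤ (d' + j) * D.l 0 := by
        rw [hq1]; exact Nat.mul_le_mul_right _ (not_lt.mp h2)
      rw [if_neg (by omega), show (d' + j) * D.l 0 + 1 - D.q 1 = (d' + j - D.k 0) * D.l 0 + 1 by
        rw [Nat.sub_mul, ← hq1]; omega, hlett τ _ (by omega)] at h1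
      rw [List.getElem?_append_right (by rw [hpl]; omega), hpl, hpg τ _ (by omega),
        Symb.letter.inj h1]
  -- Letterwise agreement at the shift `d'` is turned into a factorization whose outer parts have
  -- lengths `d'` and `k 0 - d'`, both positive.
  have hkey : pre σ ++ pre τ = (pre σ ++ pre τ).take d' ++ pre ρ
      ++ (pre σ ++ pre τ).drop (d' + D.k 0) := by
    have h1 : pre ρ = ((pre σ ++ pre τ).drop d').take (D.k 0) := by
      apply List.ext_getElem?
      intro j
      rw [List.getElem?_take]
      split_ifs with hj
      · rw [List.getElem?_drop, hocc j hj]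
      · rw [List.getElem?_eq_none (by rw [hpl]; omega)]
    conv_rhs => rw [h1, List.append_assoc, ← List.drop_drop, List.take_append_drop,
      List.take_append_drop]
  rcases hP _ ⟨σ, hσ, rfl⟩ _ ⟨τ, hτ, rfl⟩ _ ⟨ρ, hρ, rfl⟩ _ _ hkey with h1 | h1
  · have := congrArg List.length h1
    rw [List.length_take, List.length_append, List.length_nil] at this
    rw [hpl, hpl] at this
    omega
  · have := congrArg List.length h1
    rw [List.length_drop, List.length_append, List.length_nil] at this
    rw [hpl, hpl] at this
    omega

theorem Admissible.lett_one_ne_e (hD : D.Admissible) (σ t : ℕ) : D.lett 1 σ t ≠ Symb.e := by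
  rw [hD.lett_one]
  split_ifs <;> exact nofun

theorem Admissible.lett_one_b_b (hD : D.Admissible) (σ t : ℕ) (h : D.lett 1 σ t = Symb.b) :
    D.lett 1 σ (t + 1) ≠ Symb.b := by
  have hl := hD.eight_le_l 0
  rw [hD.lett_one] at h ⊢
  split_ifs at h with h1
  rw [if_neg]
  · exact nofun
  · rw [Nat.add_mod, h1, zero_add, Nat.mod_mod, Nat.mod_eq_of_lt (by omega)]
    exact one_ne_zero

/-- An occurrence meeting two pieces is excluded in three ways: across two adjacent copies it
contradicts readability of `𝒲_1`; across spacers it would contain either an `e` or two consecutive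
`b`, and a word of `𝒲_1` contains neither. -/
theorem Admissible.mem_pieceStarts_one (hD : D.Admissible) (hP : UniquelyReadable (D.prewords 0))
    {σ τ p : ℕ} (hσ : σ < D.s 1) (hp : D.ReadsAt 1 σ (D.lett 2 τ) p)
    (hpl : p + D.q 1 ≤ D.q 2) : p ∈ D.pieceStarts 1 := by
  have hl := hD.eight_le_l 0
  have hq16 := hD.q_lt_q_succ 0
  rw [q_zero] at hq16
  norm_num at hq16
  have hlq := hD.lq_ge 1
  have hl1 := hD.l_sub_one_mul 1
  have hq2 : D.q (1 + 1) = D.q 2 := rfl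
  have h1 : D.lett 2 τ (p + 1) = D.lett 1 σ 1 := hp 1 (by omega)
  have h2 : ∃ a, D.lett 1 σ 1 = Symb.letter a := by
    rw [hD.lett_one, if_neg (by rw [Nat.mod_eq_of_lt (by omega)]; exact one_ne_zero)]
    exact ⟨_, rfl⟩
  have h3 : ∃ a, D.lett 1 σ (D.q 1 - 1) = Symb.letter a := hD.lett_tailLen 1 σ |> fun h => by
    have : D.tailLen 1 = 0 := by rw [tailLen, tailLen, q_zero, dynIndex_one]
    rwa [this, Nat.sub_zero] at h
  -- The symbol at `0` is `b` and could be a spacer; those at `1` and at the end are letters, so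
  -- they lie in pieces.
  obtain ⟨c, hc, hc1, hc2⟩ := hD.exists_pieceStart_of_letter (σ := τ) (n := 1) (t := p + 1)
    (by omega) (by rw [h1]; exact h2)
  obtain ⟨c', hc', hc1', hc2'⟩ := hD.exists_pieceStart_of_letter (σ := τ) (n := 1)
    (t := p + (D.q 1 - 1)) (by omega) (by rw [hp _ (by omega)]; exact h3)
  rcases lt_trichotomy c c' with h | h | h
  · exfalso
    have h4 := hD.pieceStarts_disjoint hc hc' h
    by_cases hlast : D.phase 1 c + D.q 1 < D.l 1 * D.q 1
    · obtain ⟨h5, h6⟩ := hD.phase_add_right 1 hlast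
      have hs : c + D.q 1 ∈ D.pieceStarts 1 := by
        obtain ⟨g1, g2, g3, g4⟩ := hc
        refine ⟨lt_of_le_of_lt h4 hc'.1, by omega, by omega, ?_⟩
        rw [h5]
        exact (Nat.dvd_add_iff_left (dvd_refl _)).mp g4
      refine hD.not_readsAt_pair_one hP (σ := D.strip 1 τ c) (τ := D.strip 1 τ c)
        (strip_lt _ _ _) (strip_lt _ _ _) hσ (d := p - c) (by omega) (by omega) ?_
      intro r hr
      rw [← hp r hr, pairLett]
      split_ifs with h7
      · rw [← hD.readsAt_pieceStarts hc τ _ h7]; congr 1; omega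
      · rw [← h6 τ, ← hD.readsAt_pieceStarts hs τ _ (by omega)]; congr 1; omega
    · obtain ⟨blk, r, hr, hcr⟩ := hD.exists_block 1 c
      have g1 := hD.phase_add 1 blk hr
      rw [← hcr] at g1
      have hj := dynIndex_lt (p := D.p 1) (hD.q_pos 1) (blk / D.k 1)
      have g2 := hc.2.2.1
      have hphc : D.phase 1 c = (D.l 1 - 1) * D.q 1 := by
        obtain ⟨a, ha⟩ := hc.2.2.2
        have h3 := mod_eq_sub_of_le (l := D.l 1) (q := D.q 1) (y := D.phase 1 c) (by omega) g2
        rw [ha, Nat.mul_mod_right, ← ha] at h3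
        omega
      have g3 := hp (c + D.q 1 - p) (by omega)
      rw [show p + (c + D.q 1 - p) = c + D.q 1 by omega] at g3
      rcases Nat.eq_zero_or_pos (dynIndex (D.p 1) (D.q 1) (blk / D.k 1)) with hj0 | hj0
      · have e1 : c + D.q 1 = (blk + 1) * (D.l 1 * D.q 1) := by
          rw [add_mul]; omega
        have hj' := dynIndex_lt (p := D.p 1) (hD.q_pos 1) ((blk + 1) / D.k 1)
        have g4 := hD.phase_add 1 (blk + 1) (r := 0) (by omega)
        have g5 := hD.phase_add 1 (blk + 1) (r := 1) (by omega)
        rw [← e1] at g4 g5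
        rw [add_zero] at g4
        have hne : c' ≠ c + D.q 1 := by
          rintro rfl
          have := hc'.2.1
          omega
        have g6 : D.lett 2 τ (c + D.q 1) = Symb.b := lett_of_phase_lt (n := 1) (by omega) τ
        -- If the next block has only one spacer `b`, the second `b` is the first symbol of the word
        -- of `𝒲_1` that follows it.
        have g7 : D.lett 2 τ (c + D.q 1 + 1) = Symb.b := by
          by_cases g8 : D.phase 1 (c + D.q 1 + 1) < D.q 1
          · exact lett_of_phase_lt (n := 1) g8 τ
          · rw [lett_of_phase_mem (n := 1) (by omega) (by omega),
              show D.phase 1 (c + D.q 1 + 1) = D.q 1 by omega, Nat.mod_self, hD.lett_one,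
              Nat.zero_mod, if_pos rfl]
        have g9 := hp (c + D.q 1 - p + 1) (by omega)
        rw [show p + (c + D.q 1 - p + 1) = c + D.q 1 + 1 by omega, g7] at g9
        rw [g6] at g3
        exact hD.lett_one_b_b σ _ g3.symm g9.symm
      · have g4 := hD.phase_add 1 blk (r := c + D.q 1 - blk * (D.l 1 * D.q 1)) (by omega)
        rw [show blk * (D.l 1 * D.q 1) + (c + D.q 1 - blk * (D.l 1 * D.q 1)) = c + D.q 1 by
          omega] at g4
        rw [hD.lett_of_le_phase (n := 1) (by omega)] at g3
        exact hD.lett_one_ne_e _ _ g3.symm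
  · subst h
    rcases lt_or_eq_of_le hc1 with h4 | h4
    · rwa [show p = c by omega]
    · exfalso
      have h5 := hD.readsAt_pieceStarts hc τ 0 (by omega)
      rw [add_zero, h4, h1, hD.lett_one _ 0, Nat.zero_mod, if_pos rfl] at h5
      obtain ⟨a, ha⟩ := h2
      rw [ha] at h5
      cases h5
  · exfalso
    have := hD.pieceStarts_disjoint hc' hc h
    omega

/-! #### Occurrences of the words of `𝒲_n` in the words of `𝒲_{n+1}` -/

/-- For `n = 0` any letter is a word, for `n = 1` unique readability of the first prewords is
needed, and from `n = 2` on the spacers alone make the words recognizable. -/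
theorem Admissible.readsAt_succ_iff (hD : D.Admissible) {n : ℕ}
    (hP : n = 1 → UniquelyReadable (D.prewords 0)) {σ τ p : ℕ} (hσ : σ < D.s n) :
    (p + D.q n ≤ D.q (n + 1) ∧ D.ReadsAt n σ (D.lett (n + 1) τ) p) ↔
      p ∈ D.pieceStarts n ∧ D.strip n τ p = σ := by
  constructor
  · rintro ⟨hpl, hp⟩
    have hmem : p ∈ D.pieceStarts n := by
      rcases Nat.lt_or_ge n 2 with h | h
      · interval_cases n
        · have hq := hD.q_pos 0
          obtain ⟨c, hc, h1, h2⟩ := hD.exists_pieceStart_of_letter (n := 0) (σ := τ) (t := p)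
            (by omega) ⟨σ, hp 0 hq⟩
          rw [q_zero] at h2
          rwa [show p = c by omega]
        · exact hD.mem_pieceStarts_one (hP rfl) hσ hp hpl
      · obtain ⟨c, hc, h1, h2⟩ := hD.exists_piece_of_readsAt h le_rfl hp hpl
        rwa [show p = c by omega]
    refine ⟨hmem, hD.lett_injective n (strip_lt _ _ _) hσ fun t ht => ?_⟩
    rw [← hD.readsAt_pieceStarts hmem τ t ht, hp t ht]
  · rintro ⟨hp, rfl⟩
    exact ⟨hD.pieceStart_add_le hp, hD.readsAt_pieceStarts hp τ⟩

theorem Admissible.pieceStart_of_index (hD : D.Admissible) {n i j κ : ℕ} (hi : i < D.q n)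
    (hj : j < D.k n) (hκ : κ + 1 < D.l n) :
    ∃ r, r + dynIndex (D.p n) (D.q n) i = (κ + 1) * D.q n ∧
      (i * D.k n + j) * (D.l n * D.q n) + r ∈ D.pieceStarts n ∧
      r < D.l n * D.q n ∧ (i * D.k n + j) / D.k n = i ∧ (i * D.k n + j) % D.k n = j := by
  have hk := D.k_pos n
  have h1 : (i * D.k n + j) / D.k n = i := by
    rw [mul_comm, Nat.mul_add_div hk, Nat.div_eq_of_lt hj, add_zero]
  have h2 : (i * D.k n + j) % D.k n = j := by
    rw [mul_comm, Nat.mul_add_mod, Nat.mod_eq_of_lt hj]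
  have hJ := dynIndex_lt (p := D.p n) (hD.q_pos n) i
  have h3 : D.q n ≤ (κ + 1) * D.q n := Nat.le_mul_of_pos_left _ (Nat.succ_pos κ)
  have h4 : (κ + 1) * D.q n < D.l n * D.q n := Nat.mul_lt_mul_of_pos_right hκ (hD.q_pos n)
  refine ⟨(κ + 1) * D.q n - dynIndex (D.p n) (D.q n) i, by omega, ?_, by omega, h1, h2⟩
  have h5 := hD.phase_add n (i * D.k n + j)
    (r := (κ + 1) * D.q n - dynIndex (D.p n) (D.q n) i) (by omega)
  rw [h1, Nat.sub_add_cancel (by omega)] at h5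
  refine ⟨?_, by omega, by omega, by rw [h5]; exact Dvd.intro_left _ rfl⟩
  have h6 : i * D.k n + j + 1 ≤ D.q n * D.k n := by
    calc i * D.k n + j + 1 ≤ (i + 1) * D.k n := by rw [add_mul]; omega
      _ ≤ _ := Nat.mul_le_mul_right _ hi
  have h7 := Nat.mul_le_mul_right (D.l n * D.q n) h6
  rw [add_mul _ 1, one_mul] at h7
  rw [q_succ, ← mul_assoc (D.q n) (D.k n)]
  omega

/-- A copy is given by the outer index `i`, a place `j` with `j_t = σ` and its number `κ` among the
`l n - 1` copies of the block. The count does not depend on `σ` or `τ`, which is strong uniformity.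
-/
theorem Admissible.ncard_pieceStarts (hD : D.Admissible) {n σ τ : ℕ} (hσ : σ < D.s n)
    (hτ : τ < D.s (n + 1)) :
    Set.ncard {p | p ∈ D.pieceStarts n ∧ D.strip n τ p = σ}
      = D.q n * (D.k n / D.s n) * (D.l n - 1) := by
  have hq := hD.q_pos n
  have hk := D.k_pos n
  have hlq := hD.lq_pos n
  rw [← hD.ncard_stripIndex hτ hσ]
  set A : Set ℕ := {j | j < D.k n ∧ D.stripIndex n τ j = σ} with hA
  have hprod : D.q n * A.ncard * (D.l n - 1)
      = ((Set.Iio (D.q n) ×ˢ A) ×ˢ Set.Iio (D.l n - 1)).ncard := by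
    rw [Set.ncard_prod, Set.ncard_prod, ← Finset.coe_Iio, ← Finset.coe_Iio,
      Set.ncard_coe_finset, Set.ncard_coe_finset, Nat.card_Iio, Nat.card_Iio]
  rw [hprod]
  symm
  refine Set.ncard_congr (fun x _ => (x.1.1 * D.k n + x.1.2) * (D.l n * D.q n) +
    ((x.2 + 1) * D.q n - dynIndex (D.p n) (D.q n) x.1.1)) ?_ ?_ ?_
  · rintro ⟨⟨i, j⟩, κ⟩ ⟨⟨hi, hj, hjσ⟩, hκ⟩
    simp only [Set.mem_Iio] at hi hκ hj hjσ ⊢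
    obtain ⟨r, h1, h2, h3, h4, h5⟩ := hD.pieceStart_of_index hi hj (κ := κ) (by omega)
    rw [show (κ + 1) * D.q n - dynIndex (D.p n) (D.q n) i = r by omega]
    refine ⟨h2, ?_⟩
    rw [hD.strip_add n τ _ h3, h5, hjσ]
  · rintro ⟨⟨i, j⟩, κ⟩ ⟨⟨i', j'⟩, κ'⟩ ⟨⟨hi, hj, -⟩, hκ⟩ ⟨⟨hi', hj', -⟩, hκ'⟩ heq
    simp only [Set.mem_Iio] at hi hκ hj hi' hκ' hj'
    obtain ⟨r, h1, -, h3, h4, h5⟩ := hD.pieceStart_of_index hi hj (κ := κ) (by omega)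
    obtain ⟨r', h1', -, h3', h4', h5'⟩ := hD.pieceStart_of_index hi' hj' (κ := κ') (by omega)
    simp only at heq
    rw [show (κ + 1) * D.q n - dynIndex (D.p n) (D.q n) i = r by omega,
      show (κ' + 1) * D.q n - dynIndex (D.p n) (D.q n) i' = r' by omega] at heq
    have e1 := congrArg (· / (D.l n * D.q n)) heq
    have e2 := congrArg (· % (D.l n * D.q n)) heq
    simp only [mul_comm _ (D.l n * D.q n), Nat.mul_add_div hlq, Nat.mul_add_mod,
      Nat.div_eq_of_lt h3, Nat.div_eq_of_lt h3', Nat.mod_eq_of_lt h3, Nat.mod_eq_of_lt h3',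
      add_zero] at e1 e2
    have e3 := congrArg (· / D.k n) e1
    have e4 := congrArg (· % D.k n) e1
    simp only [h4, h5, h4', h5'] at e3 e4
    subst e3 e4
    have e5 : (κ + 1) * D.q n = (κ' + 1) * D.q n := by omega
    have e6 := Nat.eq_of_mul_eq_mul_right hq e5
    rw [show κ = κ' by omega]
  · rintro p ⟨hp, hpσ⟩
    obtain ⟨blk, r, hr, rfl⟩ := hD.exists_block n p
    obtain ⟨h1, h2, h3, a, ha⟩ := hp
    rw [hD.phase_add n blk hr] at h2 h3 ha
    rw [hD.strip_add n τ blk hr] at hpσ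
    have hblk : blk < D.q n * D.k n := by
      by_contra h
      have := Nat.mul_le_mul_right (D.l n * D.q n) (not_lt.mp h)
      rw [q_succ, ← mul_assoc (D.q n) (D.k n)] at h1
      omega
    have ha1 : 1 ≤ a := by
      rcases Nat.eq_zero_or_pos a with rfl | h
      · omega
      · exact h
    have hal : a < D.l n := by
      rw [ha, mul_comm] at h3
      exact lt_of_mul_lt_mul_right h3 (Nat.zero_le _)
    refine ⟨((blk / D.k n, blk % D.k n), a - 1), ⟨⟨?_, Nat.mod_lt _ hk, hpσ⟩, ?_⟩, ?_⟩
    · exact Nat.div_lt_of_lt_mul (by rwa [mul_comm])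
    · simp only [Set.mem_Iio]; omega
    · simp only
      rw [Nat.div_add_mod', Nat.sub_add_cancel ha1, mul_comm a, ← ha, Nat.add_sub_cancel]

theorem Admissible.readable_words (hD : D.Admissible)
    (hP : ∀ n, UniquelyReadable (D.prewords n)) (n : ℕ) : UniquelyReadable (D.words n) := by
  apply hD.uniquelyReadable_words
  intro σ hσ τ hτ ρ hρ d h0 hd
  rcases Nat.lt_or_ge n 2 with h | h
  · interval_cases n
    · rw [q_zero] at hd; omega
    · exact hD.not_readsAt_pair_one (hP 0) hσ hτ hρ h0 hd
  · exact hD.not_readsAt_pair h _ _ _ h0 hd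

/-- Each of the `q n * k n` blocks has `(q - j) + j` spacers. Reducing the phase modulo the block
length folds the final `e` onto the residues below `j`, left free by the `b`. -/
theorem Admissible.spacer_count (hD : D.Admissible) (n : ℕ) :
    ((Finset.range (D.q (n + 1))).filter fun t =>
      D.phase n t < D.q n ∨ D.l n * D.q n ≤ D.phase n t).card ≤ D.q n * D.k n * D.q n := by
  have hlq := hD.lq_pos n
  have hle := hD.lq_ge n
  have hcard : ((Finset.range (D.q n * D.k n)) ×ˢ (Finset.range (D.q n))).card
      = D.q n * D.k n * D.q n := by
    rw [Finset.card_product, Finset.card_range, Finset.card_range]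
  rw [← hcard]
  refine Finset.card_le_card_of_injOn
    (fun t => (t / (D.l n * D.q n), D.phase n t % (D.l n * D.q n))) ?_ ?_
  · intro t ht
    rw [Finset.coe_filter, Set.mem_ofPred_eq, Finset.mem_range] at ht
    rw [Finset.coe_product, Set.mem_prod, Finset.mem_coe, Finset.mem_coe, Finset.mem_range,
      Finset.mem_range]
    refine ⟨?_, ?_⟩
    · apply Nat.div_lt_of_lt_mul
      have := ht.1
      rw [q_succ] at this
      calc t < _ := this
        _ = _ := by ring
    · have h1 := hD.phase_lt n t
      have h2 := Nat.mod_lt t hlq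
      rcases ht.2 with h | h
      · exact (Nat.mod_le _ _).trans_lt h
      · change D.phase n t % (D.l n * D.q n) < D.q n
        rw [Nat.mod_eq_sub_mod h, Nat.mod_eq_of_lt (by omega)]
        omega
  · intro t _ t' _ heq
    simp only [Prod.mk.injEq] at heq
    obtain ⟨h1, h2⟩ := heq
    have h3 := Nat.mod_lt t hlq
    have h4 := Nat.mod_lt t' hlq
    have h5 := Nat.div_add_mod t (D.l n * D.q n)
    have h6 := Nat.div_add_mod t' (D.l n * D.q n)
    rw [phase, phase, h1] at h2
    have h7 : t % (D.l n * D.q n) = t' % (D.l n * D.q n) := by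
      have := Nat.ModEq.add_right_cancel' _ h2
      rwa [Nat.ModEq, Nat.mod_mod, Nat.mod_mod] at this
    rw [← h5, ← h6, h1, h7]

theorem Admissible.summable_l (hD : D.Admissible) : Summable fun n => 1 / (D.l n : ℝ) := by
  refine Summable.of_nonneg_of_le (fun n => by positivity) (fun n => ?_)
    (summable_geometric_of_lt_one (r := (1 / 2 : ℝ)) (by norm_num) (by norm_num))
  rw [one_div_pow]
  refine one_div_le_one_div_of_le (by positivity) ?_
  have h : 2 ^ n ≤ D.l n := by
    refine le_trans ?_ (hD.growth n)
    rw [mul_assoc]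
    calc 2 ^ n ≤ 2 ^ (n + 2) := Nat.pow_le_pow_right (by norm_num) (by omega)
      _ ≤ _ := Nat.le_mul_of_pos_right _ (Nat.mul_pos (hD.q_pos n) (D.k_pos n))
  exact_mod_cast h

theorem Admissible.exists_strip (hD : D.Admissible) {n σ τ : ℕ} (hσ : σ < D.s n)
    (hτ : τ < D.s (n + 1)) : ∃ j < D.k n, D.stripIndex n τ j = σ := by
  have h1 := hD.ncard_stripIndex hτ hσ
  have h2 : 0 < D.k n / D.s n := Nat.div_pos (s_le_k n) (s_pos n)
  rw [← h1] at h2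
  exact Set.nonempty_of_ncard_ne_zero h2.ne'

theorem Admissible.isConstructionSequence (hD : D.Admissible)
    (hP : ∀ n, UniquelyReadable (D.prewords n)) :
    IsConstructionSequence (coefQ D.k D.l) D.words where
  readable := hD.readable_words hP
  length_eq := by
    rintro n _ ⟨σ, -, rfl⟩
    exact hD.length_towerWord n σ
  contains := by
    rintro n _ ⟨τ, hτ, rfl⟩ _ ⟨σ, hσ, rfl⟩
    obtain ⟨j, hj, hjσ⟩ := hD.exists_strip hσ hτ
    have := hD.eight_le_l n
    obtain ⟨r, h1, h2, h3, h4, h5⟩ := hD.pieceStart_of_index (hD.q_pos n) hj (κ := 0) (by omega)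
    refine OccursAt.isInfix (hD.occursAt_towerWord.mpr
      ((hD.readsAt_succ_iff (fun _ => hP 0) hσ).mpr ⟨h2, ?_⟩))
    rw [hD.strip_add n τ _ h3, h5, hjσ]
  parsing := by
    rintro n _ ⟨τ, hτ, rfl⟩ _ ⟨σ, hσ, rfl⟩ _ ⟨σ', hσ', rfl⟩ i₁ i₂ h1 h2 h
    rw [hD.occursAt_towerWord, hD.readsAt_succ_iff (fun _ => hP 0) (by assumption)] at h1 h2
    exact hD.pieceStarts_disjoint h1.1 h2.1 h
  spacers := by
    -- The proportion of spacers is at most `1 / l n`; the factor `2` makes the inequality strict.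
    -- The value at `0` is never tested.
    refine ⟨fun n => match n with
      | 0 => 1
      | n + 1 => 2 * (1 / (D.l n : ℝ)), ?_, ?_, ?_⟩
    · rintro (_ | n)
      · exact one_pos
      · have : (0 : ℝ) < D.l n := Nat.cast_pos.mpr (hD.l_pos n)
        simp only
        positivity
    · exact (summable_nat_add_iff 1).mp (hD.summable_l.mul_left 2)
    · rintro n _ ⟨τ, hτ, rfl⟩
      have hl : (0 : ℝ) < D.l n := Nat.cast_pos.mpr (hD.l_pos n)
      have hq : (0 : ℝ) < D.q n := Nat.cast_pos.mpr (hD.q_pos n)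
      have hk : (0 : ℝ) < D.k n := Nat.cast_pos.mpr (D.k_pos n)
      have hsub : {m : ℕ | m < (D.towerWord (n + 1) τ).length ∧ ∀ w ∈ D.words n, ∀ i : ℕ,
          OccursAt w (D.towerWord (n + 1) τ) i → ¬ (i ≤ m ∧ m < i + coefQ D.k D.l n)} ⊆
          ((Finset.range (D.q (n + 1))).filter fun t =>
            D.phase n t < D.q n ∨ D.l n * D.q n ≤ D.phase n t : Finset ℕ) := by
        rintro m ⟨hm, hm'⟩
        rw [hD.length_towerWord] at hm
        rw [Finset.coe_filter, Set.mem_ofPred_eq, Finset.mem_range]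
        refine ⟨hm, ?_⟩
        by_contra hcon
        rw [not_or, not_lt, not_le] at hcon
        obtain ⟨c, hc, h1, -⟩ := hD.exists_pieceStart hm hcon.1 hcon.2
        have h2 := Nat.mod_lt (D.phase n m) (hD.q_pos n)
        refine hm' _ (towerWord_mem_words (strip_lt n τ c)) c (hD.occursAt_towerWord.mpr
          ⟨hD.pieceStart_add_le hc, hD.readsAt_pieceStarts hc τ⟩) ⟨by omega, ?_⟩
        change m < c + D.q n
        omega
      have hle := (Set.ncard_le_ncard hsub (Finset.finite_toSet _)).trans
        ((Set.ncard_coe_finset _).le.trans (hD.spacer_count n))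
      have hle' : ((Set.ncard {m : ℕ | m < (D.towerWord (n + 1) τ).length ∧ ∀ w ∈ D.words n,
          ∀ i : ℕ, OccursAt w (D.towerWord (n + 1) τ) i →
            ¬ (i ≤ m ∧ m < i + coefQ D.k D.l n)} : ℕ) : ℝ) ≤ D.q n * D.k n * D.q n := by
        exact_mod_cast hle
      have hqs : ((coefQ D.k D.l (n + 1) : ℕ) : ℝ) = D.q n * (D.k n * (D.l n * D.q n)) := by
        have := q_succ (D := D) n
        exact_mod_cast this
      rw [hqs, div_lt_iff₀ (by positivity)]
      refine hle'.trans_lt ?_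
      have : 2 * (1 / (D.l n : ℝ)) * (D.q n * (D.k n * (D.l n * D.q n)))
        = 2 * (D.q n * D.k n * D.q n) := by field_simp
      rw [this]
      have : (0 : ℝ) < D.q n * D.k n * D.q n := by positivity
      linarith

theorem Admissible.isCircularConstruction (hD : D.Admissible)
    (hP : ∀ n, UniquelyReadable (D.prewords n)) :
    IsCircularConstruction {a : ℕ | a < D.s 0} D.k D.l D.prewords D.words where
  two_le_k := two_le_k
  l_pos := hD.l_pos
  summable_l := hD.summable_l
  construction := hD.isConstructionSequence hP
  alphabet_nonempty := ⟨0, s_pos 0⟩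
  base := by
    ext w
    constructor
    · rintro ⟨σ, hσ, rfl⟩; exact ⟨σ, hσ, rfl⟩
    · rintro ⟨σ, hσ, rfl⟩; exact ⟨σ, hσ, rfl⟩
  prewords := fun _ _ hv => prewords_spec hv
  step := words_succ
  strong := hP

theorem Admissible.isStronglyUniform (hD : D.Admissible)
    (hP : ∀ n, UniquelyReadable (D.prewords n)) : IsStronglyUniform D.words := by
  intro n
  refine ⟨D.q n * (D.k n / D.s n) * (D.l n - 1), ?_⟩
  rintro _ ⟨σ, hσ, rfl⟩ _ ⟨τ, hτ, rfl⟩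
  rw [← hD.ncard_pieceStarts hσ hτ]
  congr 1
  ext p
  rw [Set.mem_ofPred_eq, hD.occursAt_towerWord, hD.readsAt_succ_iff (fun _ => hP 0) hσ,
    Set.mem_ofPred_eq]

end AKData

/-! ### The limit of the periodic names -/

instance : Countable (Symb ℕ) := by
  have : Function.Injective (fun x : Symb ℕ => match x with
      | .letter a => (some (some a) : Option (Option ℕ))
      | .b => some none
      | .e => none) := by
    intro x y h
    cases x <;> cases y <;> simp_all
  exact this.countable

theorem measurableSet_eventually {α : Type*} [MeasurableSpace α] {P : ℕ → α → Prop}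
    (h : ∀ n, MeasurableSet {x | P n x}) : MeasurableSet {x | ∀ᶠ n in atTop, P n x} := by
  have : {x | ∀ᶠ n in atTop, P n x} = ⋃ N : ℕ, ⋂ n : ℕ, ⋂ _ : N ≤ n, {x | P n x} := by
    ext x
    simp only [Set.mem_ofPred_eq, eventually_atTop, Set.mem_iUnion, Set.mem_iInter]
  rw [this]
  exact MeasurableSet.iUnion fun N => MeasurableSet.iInter fun n => MeasurableSet.iInter fun _ => h n

theorem natCast_mul_inv_le {a b c : ℕ} (hb : 0 < b) (h : a * c ≤ b) :
    (a : ℝ≥0∞) * (b : ℝ≥0∞)⁻¹ ≤ (c : ℝ≥0∞)⁻¹ := by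
  rw [ENNReal.le_inv_iff_mul_le, mul_right_comm, ← Nat.cast_mul]
  calc ((a * c : ℕ) : ℝ≥0∞) * (b : ℝ≥0∞)⁻¹ ≤ (b : ℝ≥0∞) * (b : ℝ≥0∞)⁻¹ := by
        gcongr
    _ = 1 := ENNReal.mul_inv_cancel (Nat.cast_ne_zero.mpr hb.ne') (ENNReal.natCast_ne_top _)

theorem measurable_shift {α : Type*} [MeasurableSpace α] :
    Measurable (shift : (ℤ → α) → ℤ → α) :=
  measurable_pi_lambda _ fun n => measurable_pi_apply (n + 1)

/-- The alphabet is countable, so there are countably many words of length `m` and every set of them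
is measurable. -/
theorem measurableSet_finite_dep {C : Set (ℤ → Symb ℕ)} (a : ℤ) (m : ℕ)
    (h : ∀ x y : ℤ → Symb ℕ, (∀ i < m, x (a + (i : ℕ)) = y (a + (i : ℕ))) → (x ∈ C ↔ y ∈ C)) :
    MeasurableSet C := by
  set f : (ℤ → Symb ℕ) → (Fin m → Symb ℕ) := fun x i => x (a + (i : ℕ))
  have hf : Measurable f := measurable_pi_lambda _ fun i => measurable_pi_apply _
  have : C = f ⁻¹' (f '' C) := by
    refine Set.Subset.antisymm (Set.subset_preimage_image _ _) ?_
    rintro x ⟨y, hy, hxy⟩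
    refine (h y x fun i hi => ?_).mp hy
    exact congrFun hxy ⟨i, hi⟩
  rw [this]
  exact hf (Set.to_countable _).measurableSet

theorem block_length {α : Type*} (x : ℤ → α) (a : ℤ) (m : ℕ) : (block x a m).length = m := by
  simp [block]

theorem block_congr {α : Type*} {x y : ℤ → α} {a : ℤ} {m : ℕ}
    (h : ∀ i < m, x (a + (i : ℕ)) = y (a + (i : ℕ))) : block x a m = block y a m := by
  unfold block
  congr 1
  funext i
  exact h i i.2

theorem getElem?_block {α : Type*} (x : ℤ → α) (a : ℤ) {m r : ℕ} (h : r < m) :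
    (block x a m)[r]? = some (x (a + (r : ℕ))) := by
  rw [block, List.getElem?_ofFn, dif_pos h]

theorem measurableSet_symbolicShift (W : ℕ → Set (List (Symb ℕ))) :
    MeasurableSet (symbolicShift W) := by
  have : symbolicShift W = ⋂ a : ℤ, ⋂ m : ℕ, {x | ∃ n, ∃ w ∈ W n, block x a m <:+: w} := by
    ext x
    simp only [symbolicShift, Set.mem_ofPred_eq, Set.mem_iInter]
  rw [this]
  refine MeasurableSet.iInter fun a => MeasurableSet.iInter fun m => ?_
  refine measurableSet_finite_dep a m fun x y h => ?_
  rw [Set.mem_ofPred_eq, Set.mem_ofPred_eq, block_congr h]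

/-- Membership in `C` depends on the coordinates in `[-M, M]` only. -/
def DependsOnWindow (M : ℕ) (C : Set (ℤ → Symb ℕ)) : Prop :=
  ∀ x y : ℤ → Symb ℕ, (∀ i : ℤ, |i| ≤ M → x i = y i) → (x ∈ C ↔ y ∈ C)

theorem DependsOnWindow.measurableSet {M : ℕ} {C : Set (ℤ → Symb ℕ)} (h : DependsOnWindow M C) :
    MeasurableSet C := by
  refine measurableSet_finite_dep (-(M : ℤ)) (2 * M + 1) fun x y hxy => h x y fun i hi => ?_
  rw [abs_le] at hi
  have := hxy (i + M).toNat (by omega)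
  rwa [show (-(M : ℤ) + ((i + M).toNat : ℤ)) = i by omega] at this

theorem exists_dependsOnWindow {C : Set (ℤ → Symb ℕ)}
    (h : C ∈ measurableCylinders fun _ : ℤ => Symb ℕ) : ∃ M, DependsOnWindow M C := by
  obtain ⟨s, S, -, rfl⟩ := (mem_measurableCylinders _).mp h
  refine ⟨s.sup Int.natAbs, fun x y hxy => ?_⟩
  rw [mem_cylinder, mem_cylinder]
  have : s.restrict x = s.restrict y := by
    funext i
    refine hxy i ?_
    rw [Int.abs_eq_natAbs]
    exact_mod_cast Finset.le_sup (f := Int.natAbs) i.2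
  rw [this]

theorem DependsOnWindow.shift {M : ℕ} {C : Set (ℤ → Symb ℕ)} (h : DependsOnWindow M C) :
    DependsOnWindow (M + 1) (shift ⁻¹' C) := by
  intro x y hxy
  refine h _ _ fun i hi => hxy _ ?_
  rw [abs_le] at hi ⊢
  push_cast
  omega

/-- Two probability measures on sequences that agree on the sets that depend on finitely many
coordinates are equal. -/
theorem measure_ext_of_window {ν ν' : Measure (ℤ → Symb ℕ)} [IsProbabilityMeasure ν]
    [IsProbabilityMeasure ν'] (h : ∀ M C, DependsOnWindow M C → ν C = ν' C) : ν = ν' := by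
  refine ext_of_generate_finite _ generateFrom_measurableCylinders.symm
    isPiSystem_measurableCylinders (fun C hC => ?_) (by rw [measure_univ, measure_univ])
  obtain ⟨M, hM⟩ := exists_dependsOnWindow hC
  exact h M C hM

open Classical in
/-- The coordinatewise limit of a sequence of sequences of symbols. -/
noncomputable def eventualValue (f : ℕ → ℤ → Symb ℕ) : ℤ → Symb ℕ := fun m =>
  if h : ∃ c, ∀ᶠ n in atTop, f n m = c then h.choose else Symb.b

namespace AKData

variable {D : AKData}

/-- The word of the `σ`-th `n`-tower is read in `y` at the position `a`. -/
def ReadsSeq (D : AKData) (n σ : ℕ) (y : ℤ → Symb ℕ) (a : ℤ) : Prop :=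
  ∀ r < D.q n, y (a + (r : ℕ)) = D.lett n σ r

theorem Admissible.block_eq_towerWord (hD : D.Admissible) {n σ : ℕ} {y : ℤ → Symb ℕ} {a : ℤ} :
    block y a (D.q n) = D.towerWord n σ ↔ D.ReadsSeq n σ y a := by
  constructor
  · intro h r hr
    have h1 := hD.getElem?_towerWord n σ hr
    rw [← h, getElem?_block y a hr] at h1
    exact Option.some.inj h1
  · intro h
    apply List.ext_getElem?
    intro r
    by_cases hr : r < D.q n
    · rw [getElem?_block y a hr, hD.getElem?_towerWord n σ hr, h r hr]
    · rw [List.getElem?_eq_none (by rw [block_length]; omega),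
        List.getElem?_eq_none (by rw [hD.length_towerWord]; omega)]

/-- The periodic continuation of the word of the `σ`-th `n`-tower, seen from the level `t`. -/
noncomputable def perWord (D : AKData) (n σ t : ℕ) : ℤ → Symb ℕ :=
  fun m => D.lett n σ (((t : ℤ) + m) % (D.q n : ℤ)).toNat

theorem perWord_apply {n σ t r : ℕ} {m : ℤ} (h : (t : ℤ) + m = (r : ℕ)) (hr : r < D.q n) :
    D.perWord n σ t m = D.lett n σ r := by
  rw [perWord, h, ← Int.natCast_mod, Nat.mod_eq_of_lt hr, Int.toNat_natCast]

theorem shift_perWord (n σ t : ℕ) :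
    shift (D.perWord n σ t) = D.perWord n σ ((t + 1) % D.q n) := by
  funext m
  rw [shift, perWord, perWord]
  congr 2
  push_cast
  rw [Int.emod_add_emod]
  congr 1
  ring

/-- The levels of the `(n+1)`-towers that are spacers or close to the ends of the tower. -/
def peripheral (D : AKData) (n : ℕ) : Finset ℕ :=
  (Finset.range (D.q (n + 1))).filter fun t =>
    (D.phase n t < D.q n ∨ D.l n * D.q n ≤ D.phase n t) ∨
      (t < D.q n ∨ D.q (n + 1) < t + D.q n)

/-- The two margins have `2 * q n` levels, no more than the bound for the spacers because `k n ≥ 2`.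
-/
theorem Admissible.card_peripheral (hD : D.Admissible) (n : ℕ) :
    (D.peripheral n).card ≤ 2 * (D.q n * D.k n * D.q n) := by
  rw [peripheral, Finset.filter_or]
  refine (Finset.card_union_le _ _).trans ?_
  have h1 := hD.spacer_count n
  have h2 : ((Finset.range (D.q (n + 1))).filter fun t =>
      t < D.q n ∨ D.q (n + 1) < t + D.q n).card ≤ 2 * D.q n := by
    have h3 : ((Finset.range (D.q (n + 1))).filter fun t =>
      t < D.q n ∨ D.q (n + 1) < t + D.q n) ⊆
        Finset.range (D.q n) ∪ Finset.Ico (D.q (n + 1) - D.q n) (D.q (n + 1)) := by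
      intro t ht
      rw [Finset.mem_filter, Finset.mem_range] at ht
      rw [Finset.mem_union, Finset.mem_range, Finset.mem_Ico]
      omega
    refine (Finset.card_le_card h3).trans ((Finset.card_union_le _ _).trans ?_)
    rw [Finset.card_range, Nat.card_Ico]
    omega
  have h4 : 2 * D.q n ≤ D.q n * D.k n * D.q n := by
    have := two_le_k (D := D) n
    have := hD.q_pos n
    calc 2 * D.q n = 1 * 2 * D.q n := by ring
      _ ≤ _ := Nat.mul_le_mul_right _ (Nat.mul_le_mul (by omega) (by omega))
  omega

section typical

variable {X : Type u} [MeasurableSpace X] (Z : UnitSquare ≃ᵐ X)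

theorem Admissible.measure_pos_mem_le (hD : D.Admissible) {μ : Measure X}
    (hZ : MeasurePreserving Z lebesgue μ) (n : ℕ) (P : Finset ℕ) :
    μ {x | D.pos Z n x ∈ P} ≤ P.card * (D.q n : ℝ≥0∞)⁻¹ := by
  have hs := s_pos (D := D) n
  have hsub : {x | D.pos Z n x ∈ P} ⊆
      ⋃ y ∈ (P ∩ Finset.range (D.q n)) ×ˢ Finset.range (D.s n), D.level Z n y.1 y.2 := by
    intro x hx
    rw [Set.mem_iUnion₂]
    refine ⟨(D.pos Z n x, D.tow Z n x), ?_, rfl, rfl⟩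
    rw [Finset.mem_product, Finset.mem_inter, Finset.mem_range, Finset.mem_range]
    exact ⟨⟨hx, hD.pos_lt Z n x⟩, tow_lt Z n x⟩
  refine (measure_mono hsub).trans ((measure_biUnion_finset_le _ _).trans ?_)
  rw [Finset.sum_congr rfl (g := fun _ => ((D.q n : ℝ≥0∞) * D.s n)⁻¹)]
  · rw [Finset.sum_const, Finset.card_product, Finset.card_range, nsmul_eq_mul, Nat.cast_mul,
      ENNReal.mul_inv (Or.inr (ENNReal.natCast_ne_top _)) (Or.inl (ENNReal.natCast_ne_top _)),
      mul_comm (D.q n : ℝ≥0∞)⁻¹, mul_assoc, ← mul_assoc (D.s n : ℝ≥0∞),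
      ENNReal.mul_inv_cancel (Nat.cast_ne_zero.mpr hs.ne') (ENNReal.natCast_ne_top _), one_mul]
    gcongr
    exact Finset.inter_subset_left
  · rintro ⟨t, σ⟩ h
    rw [Finset.mem_product, Finset.mem_inter, Finset.mem_range, Finset.mem_range] at h
    exact hD.measure_level Z hZ h.1.2 h.2

theorem Admissible.two_pow_le_l (hD : D.Admissible) (n : ℕ) : 2 ^ (n + 2) ≤ D.l n := by
  refine le_trans ?_ (hD.growth n)
  rw [mul_assoc]
  exact Nat.le_mul_of_pos_right _ (Nat.mul_pos (hD.q_pos n) (D.k_pos n))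

theorem Admissible.measure_peripheral_le (hD : D.Admissible) {μ : Measure X}
    (hZ : MeasurePreserving Z lebesgue μ) (n : ℕ) :
    μ {x | D.pos Z (n + 1) x ∈ D.peripheral n} ≤ (2⁻¹ : ℝ≥0∞) ^ n := by
  refine (hD.measure_pos_mem_le Z hZ _ _).trans ?_
  rw [← ENNReal.inv_pow, show (2 : ℝ≥0∞) ^ n = ((2 ^ n : ℕ) : ℝ≥0∞) by push_cast; rfl]
  refine natCast_mul_inv_le (hD.q_pos _) ?_
  have h1 := hD.card_peripheral n
  have h2 := hD.two_pow_le_l n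
  rw [q_succ]
  calc (D.peripheral n).card * 2 ^ n ≤ 2 * (D.q n * D.k n * D.q n) * 2 ^ n :=
        Nat.mul_le_mul_right _ h1
    _ = D.q n * (D.k n * (2 ^ (n + 1) * D.q n)) := by ring
    _ ≤ _ := Nat.mul_le_mul_left _ (Nat.mul_le_mul_left _ (Nat.mul_le_mul_right _
        ((Nat.pow_le_pow_right (by norm_num) (by omega)).trans h2)))

theorem Admissible.ae_eventually_not_peripheral (hD : D.Admissible) {μ : Measure X}
    (hZ : MeasurePreserving Z lebesgue μ) :
    ∀ᵐ x ∂μ, ∀ᶠ n in atTop, D.pos Z (n + 1) x ∉ D.peripheral n := by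
  refine ae_eventually_notMem (s := fun n => {x | D.pos Z (n + 1) x ∈ D.peripheral n}) ?_
  refine ne_top_of_le_ne_top ?_ (ENNReal.tsum_le_tsum fun n => hD.measure_peripheral_le Z hZ n)
  rw [ENNReal.tsum_geometric]
  simp

/-- The sequence `y` is the name of the point `x`: for all large `n`, the word of the `n`-tower of
`x` is read in `y` around `0`. -/
def IsTypical (D : AKData) (Z : UnitSquare ≃ᵐ X) (x : X) (y : ℤ → Symb ℕ) : Prop :=
  ∀ᶠ n in atTop, D.pos Z (n + 1) x ∉ D.peripheral n ∧
    D.ReadsSeq n (D.tow Z n x) y (-(D.pos Z n x : ℤ))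

theorem Admissible.not_peripheral (hD : D.Admissible) {n : ℕ} {x : X}
    (h : D.pos Z (n + 1) x ∉ D.peripheral n) :
    D.q n ≤ D.pos Z (n + 1) x ∧ D.pos Z (n + 1) x + D.q n ≤ D.q (n + 1) ∧
      ∃ c ∈ D.pieceStarts n, D.pos Z (n + 1) x = c + D.pos Z n x ∧
        D.strip n (D.tow Z (n + 1) x) c = D.tow Z n x := by
  have hlt := hD.pos_lt Z (n + 1) x
  rw [peripheral, Finset.mem_filter, Finset.mem_range, not_and] at h
  have h1 := h hlt
  rw [not_or, not_or, not_or] at h1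
  obtain ⟨c, hc, h2, h3⟩ := hD.exists_pieceStart hlt (by omega) (by omega)
  obtain ⟨h4, h5⟩ := hD.pos_succ Z n x
  exact ⟨by omega, by omega, c, hc, by omega, by rw [h3, h5]⟩

/-- The limit of the periodic names of `x`. -/
noncomputable def limName (D : AKData) (Z : UnitSquare ≃ᵐ X) (x : X) : ℤ → Symb ℕ :=
  eventualValue fun n => D.perWord n (D.tow Z n x) (D.pos Z n x)

theorem limName_eq {x : X} {m : ℤ} {c : Symb ℕ}
    (h : ∀ᶠ n in atTop, D.perWord n (D.tow Z n x) (D.pos Z n x) m = c) :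
    D.limName Z x m = c := by
  have hex : ∃ c, ∀ᶠ n in atTop, D.perWord n (D.tow Z n x) (D.pos Z n x) m = c := ⟨c, h⟩
  rw [limName, eventualValue, dif_pos hex]
  obtain ⟨n, h1, h2⟩ := (h.and hex.choose_spec).exists
  exact h2.symm.trans h1

theorem measurableSet_perWord_mem (n : ℕ) (C : Set (ℤ → Symb ℕ)) :
    MeasurableSet {x | D.perWord n (D.tow Z n x) (D.pos Z n x) ∈ C} := by
  have : Measurable fun x => (D.tow Z n x, D.pos Z n x) :=
    (measurable_tow Z n).prodMk (measurable_pos Z n)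
  exact this (t := {y : ℕ × ℕ | D.perWord n y.1 y.2 ∈ C}) (Set.to_countable _).measurableSet

/-- In each coordinate, either some value is eventually attained or none is and the default `b` is
taken; both cases are measurable because there are countably many symbols. -/
theorem measurable_limName : Measurable (D.limName Z) := by
  refine measurable_pi_lambda _ fun m => measurable_to_countable' fun c => ?_
  have hG : ∀ c, MeasurableSet
      {x | ∀ᶠ n in atTop, D.perWord n (D.tow Z n x) (D.pos Z n x) m = c} := fun c =>
    measurableSet_eventually fun n => measurableSet_perWord_mem Z n {y | y m = c}
  have : (fun x => D.limName Z x m) ⁻¹' {c}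
      = {x | ∀ᶠ n in atTop, D.perWord n (D.tow Z n x) (D.pos Z n x) m = c} ∪
        ({x | c = Symb.b} ∩ ⋂ c' : Symb ℕ,
          {x | ∀ᶠ n in atTop, D.perWord n (D.tow Z n x) (D.pos Z n x) m = c'}ᶜ) := by
    ext x
    constructor
    · intro hx
      by_cases h : ∃ c, ∀ᶠ n in atTop, D.perWord n (D.tow Z n x) (D.pos Z n x) m = c
      · obtain ⟨c', hc'⟩ := h
        have h1 := limName_eq Z hc'
        left
        rw [Set.mem_preimage, Set.mem_singleton_iff, h1] at hx
        rwa [← hx]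
      · right
        rw [Set.mem_preimage, Set.mem_singleton_iff, limName, eventualValue, dif_neg h] at hx
        refine ⟨hx.symm, Set.mem_iInter.mpr fun c' hc' => h ⟨c', hc'⟩⟩
    · rintro (hx | ⟨hc, hx⟩)
      · exact limName_eq Z hx
      · have h : ¬ ∃ c, ∀ᶠ n in atTop, D.perWord n (D.tow Z n x) (D.pos Z n x) m = c := by
          rintro ⟨c', hc'⟩
          exact Set.mem_iInter.mp hx c' hc'
        rw [Set.mem_preimage, Set.mem_singleton_iff, limName, eventualValue, dif_neg h]
        exact hc.symm
  rw [this]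
  exact (hG c).union ((MeasurableSet.const _).inter (MeasurableSet.iInter fun c' => (hG c').compl))

theorem Admissible.readsSeq_of_succ (hD : D.Admissible) {n : ℕ} {x : X} {y : ℤ → Symb ℕ}
    (h : D.pos Z (n + 1) x ∉ D.peripheral n)
    (hy : D.ReadsSeq (n + 1) (D.tow Z (n + 1) x) y (-(D.pos Z (n + 1) x : ℤ))) :
    D.ReadsSeq n (D.tow Z n x) y (-(D.pos Z n x : ℤ)) := by
  obtain ⟨-, -, c, hc, h1, h2⟩ := hD.not_peripheral Z h
  intro r hr
  have h3 := hD.pieceStart_add_le hc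
  rw [← h2, ← hD.readsAt_pieceStarts hc _ r hr, ← hy (c + r) (by omega)]
  congr 1
  push_cast
  omega

/-- From some stage on the tower words around `x` are nested, so the periodic names of all later
stages agree with stage `n` on its whole word. -/
theorem Admissible.isTypical_limName (hD : D.Admissible) {x : X}
    (h : ∀ᶠ n in atTop, D.pos Z (n + 1) x ∉ D.peripheral n) :
    D.IsTypical Z x (D.limName Z x) := by
  obtain ⟨N, hN⟩ := eventually_atTop.mp h
  refine eventually_atTop.mpr ⟨N, fun n hn => ⟨hN n hn, fun r hr => ?_⟩⟩
  have key : ∀ d, D.ReadsSeq n (D.tow Z n x)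
      (D.perWord (n + d) (D.tow Z (n + d) x) (D.pos Z (n + d) x)) (-(D.pos Z n x : ℤ)) := by
    intro d
    -- Descending induction from stage `n + d` to stage `n`, indexed by the number `j` of stages
    -- descended.
    have h1 : ∀ j ≤ d, D.ReadsSeq (n + (d - j)) (D.tow Z (n + (d - j)) x)
        (D.perWord (n + d) (D.tow Z (n + d) x) (D.pos Z (n + d) x))
        (-(D.pos Z (n + (d - j)) x : ℤ)) := by
      intro j hj
      induction j with
      | zero =>
        intro r hr
        exact perWord_apply (by simp) hr
      | succ j ih =>
        have h2 := ih (by omega)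
        have e : n + (d - j) = n + (d - (j + 1)) + 1 := by omega
        rw [e] at h2
        exact hD.readsSeq_of_succ Z (hN _ (by omega)) h2
    have := h1 d le_rfl
    rwa [Nat.sub_self, add_zero] at this
  refine limName_eq Z (eventually_atTop.mpr ⟨n, fun m hm => ?_⟩)
  obtain ⟨d, rfl⟩ := Nat.exists_eq_add_of_le hm
  exact key d r hr

theorem Admissible.ae_isTypical_limName (hD : D.Admissible) {μ : Measure X}
    (hZ : MeasurePreserving Z lebesgue μ) : ∀ᵐ x ∂μ, D.IsTypical Z x (D.limName Z x) :=
  (hD.ae_eventually_not_peripheral Z hZ).mono fun _ h => hD.isTypical_limName Z h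

theorem Admissible.IsTypical.tendsto_pos (hD : D.Admissible) {x : X} {y : ℤ → Symb ℕ}
    (h : D.IsTypical Z x y) : Tendsto (fun n => D.pos Z n x) atTop atTop ∧
      Tendsto (fun n => D.q n - D.pos Z n x) atTop atTop := by
  have h1 : ∀ᶠ n in atTop, D.q n ≤ D.pos Z (n + 1) x ∧ D.q n ≤ D.q (n + 1) - D.pos Z (n + 1) x :=
    h.mono fun n hn => by
      obtain ⟨h1, h2, -⟩ := hD.not_peripheral Z hn.1
      omega
  constructor
  · exact (tendsto_add_atTop_iff_nat 1).mp
      (tendsto_atTop_mono' _ (h1.mono fun n hn => hn.1) hD.tendsto_q)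
  · exact (tendsto_add_atTop_iff_nat (f := fun n => D.q n - D.pos Z n x) 1).mp
      (tendsto_atTop_mono' _ (h1.mono fun n hn => hn.2) hD.tendsto_q)

theorem Admissible.IsTypical.eventually_window (hD : D.Admissible) {x : X} {y : ℤ → Symb ℕ}
    (h : D.IsTypical Z x y) (M : ℕ) : ∀ᶠ n in atTop, ∀ i : ℤ, |i| ≤ M →
      D.perWord n (D.tow Z n x) (D.pos Z n x) i = y i := by
  obtain ⟨h1, h2⟩ := Admissible.IsTypical.tendsto_pos Z hD h
  filter_upwards [h, h1.eventually_ge_atTop M, h2.eventually_gt_atTop M] with n hn hn1 hn2 i hi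
  rw [abs_le] at hi
  have hr : ((D.pos Z n x : ℤ) + i).toNat < D.q n := by omega
  rw [perWord_apply (r := ((D.pos Z n x : ℤ) + i).toNat) (by omega) hr, ← hn.2 _ hr]
  congr 1
  omega

theorem Admissible.IsTypical.ext (hD : D.Admissible) {x : X} {y y' : ℤ → Symb ℕ}
    (h : D.IsTypical Z x y) (h' : D.IsTypical Z x y') : y = y' := by
  funext m
  obtain ⟨n, h1, h2⟩ := ((Admissible.IsTypical.eventually_window Z hD h m.natAbs).and
    (Admissible.IsTypical.eventually_window Z hD h' m.natAbs)).exists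
  have hm : |m| ≤ (m.natAbs : ℤ) := (Int.abs_eq_natAbs m).le
  rw [← h1 m hm, h2 m hm]

/-- Off the margins, every word of `𝒲_n` around `0` lies inside the word of `𝒲_{n+1}` that `x` has
around `0`. There overlapping occurrences coincide, so `x` and `x'` have the same level and tower at
all late stages. -/
theorem Admissible.IsTypical.injective (hD : D.Admissible) {x x' : X} {y : ℤ → Symb ℕ}
    (h : D.IsTypical Z x y) (h' : D.IsTypical Z x' y) : x = x' := by
  apply hD.eq_of_frequently Z
  apply Eventually.frequently
  filter_upwards [h, h', eventually_ge_atTop 2, (tendsto_add_atTop_nat 1).eventually h]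
    with n hn hn' hn2 hn1
  obtain ⟨g1, g2, -⟩ := hD.not_peripheral Z hn.1
  have hlt := hD.pos_lt Z n x
  have hlt' := hD.pos_lt Z n x'
  set t := D.pos Z (n + 1) x
  have conv : ∀ σ, ∀ a : ℕ, a < D.q n → D.ReadsSeq n σ y (-(a : ℤ)) →
      D.ReadsAt n σ (D.lett (n + 1) (D.tow Z (n + 1) x)) (t - a) := by
    intro σ a ha hσ r hr
    rw [← hσ r hr, ← hn1.2 (t - a + r) (by omega)]
    congr 1
    push_cast [Nat.cast_sub (show a ≤ t by omega)]
    omega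
  have r1 := conv _ _ hlt hn.2
  have r2 := conv _ _ hlt' hn'.2
  have hpos : D.pos Z n x = D.pos Z n x' := by
    rcases lt_trichotomy (D.pos Z n x) (D.pos Z n x') with h3 | h3 | h3
    · have := hD.readsAt_disjoint (N := n + 1) hn2 (by omega) r2 (by omega) r1 (by omega) (by omega)
      omega
    · exact h3
    · have := hD.readsAt_disjoint (N := n + 1) hn2 (by omega) r1 (by omega) r2 (by omega) (by omega)
      omega
  refine ⟨hpos, hD.lett_injective n (tow_lt Z n x) (tow_lt Z n x') fun r hr => ?_⟩
  rw [← r1 r hr, ← r2 r hr, hpos]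

theorem Admissible.IsTypical.mem_coreSet (hD : D.Admissible) {x : X} {y : ℤ → Symb ℕ}
    (h : D.IsTypical Z x y) : y ∈ coreSet D.words := by
  obtain ⟨h1, h2⟩ := Admissible.IsTypical.tendsto_pos Z hD h
  refine ⟨fun a m => ?_, fun n => D.pos Z n x, fun n => D.q n - D.pos Z n x, h1, h2, ?_⟩
  · obtain ⟨n, hn, hn1, hn2⟩ := (h.and ((h1.eventually_ge_atTop a.natAbs).and
      (h2.eventually_ge_atTop (a.natAbs + m)))).exists
    refine ⟨n, _, towerWord_mem_words (tow_lt Z n x), ?_⟩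
    refine OccursAt.isInfix (i := ((D.pos Z n x : ℤ) + a).toNat) (occursAt_iff.mpr ?_)
    intro r hr
    rw [block_length] at hr
    rw [hD.getElem?_towerWord _ _ (by omega), getElem?_block y a hr, ← hn.2 _ (by omega)]
    congr 2
    push_cast
    omega
  · filter_upwards [h] with n hn
    have := hD.pos_lt Z n x
    rw [show D.pos Z n x + (D.q n - D.pos Z n x) = D.q n by omega,
      hD.block_eq_towerWord.mpr hn.2]
    exact towerWord_mem_words (tow_lt Z n x)

open Classical in
/-- The proportion of the periodic words of stage `n` that belong to `C`. -/
noncomputable def freq (D : AKData) (n : ℕ) (C : Set (ℤ → Symb ℕ)) : ℝ≥0∞ :=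
  ((Finset.range (D.q n) ×ˢ Finset.range (D.s n)).filter
    fun y => D.perWord n y.2 y.1 ∈ C).card * ((D.q n : ℝ≥0∞) * D.s n)⁻¹

theorem Admissible.measure_perWord_mem (hD : D.Admissible) {μ : Measure X}
    (hZ : MeasurePreserving Z lebesgue μ) (n : ℕ) (C : Set (ℤ → Symb ℕ)) :
    μ {x | D.perWord n (D.tow Z n x) (D.pos Z n x) ∈ C} = D.freq n C := by
  classical
  have h : {x | D.perWord n (D.tow Z n x) (D.pos Z n x) ∈ C} =
      ⋃ y ∈ (Finset.range (D.q n) ×ˢ Finset.range (D.s n)).filter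
        (fun y => D.perWord n y.2 y.1 ∈ C), D.level Z n y.1 y.2 := by
    ext x
    rw [Set.mem_iUnion₂]
    constructor
    · intro hx
      refine ⟨(D.pos Z n x, D.tow Z n x), ?_, rfl, rfl⟩
      rw [Finset.mem_filter, Finset.mem_product, Finset.mem_range, Finset.mem_range]
      exact ⟨⟨hD.pos_lt Z n x, tow_lt Z n x⟩, hx⟩
    · rintro ⟨y, hy, h1, h2⟩
      rw [Finset.mem_filter] at hy
      rw [Set.mem_ofPred_eq, h1, h2]
      exact hy.2
  rw [h, measure_biUnion_finset, Finset.sum_congr rfl (g := fun _ => ((D.q n : ℝ≥0∞) * D.s n)⁻¹),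
    Finset.sum_const, nsmul_eq_mul, freq]
  · rintro y hy
    rw [Finset.mem_filter, Finset.mem_product, Finset.mem_range, Finset.mem_range] at hy
    exact hD.measure_level Z hZ hy.1.1 hy.1.2
  · rintro y - y' - hne
    rw [Function.onFun, Set.disjoint_left]
    rintro x ⟨h1, h2⟩ ⟨h3, h4⟩
    exact hne (Prod.ext (h1.symm.trans h3) (h2.symm.trans h4))
  · exact fun y _ => measurableSet_level Z n _ _

/-- `freq n C` is the measure of the points whose periodic name of stage `n` is in `C`. Almost every
such name eventually agrees with the limit on the window that decides membership, so dominated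
convergence applies. -/
theorem Admissible.tendsto_freq (hD : D.Admissible) {μ : Measure X} [IsProbabilityMeasure μ]
    (hZ : MeasurePreserving Z lebesgue μ) {M : ℕ} {C : Set (ℤ → Symb ℕ)}
    (hC : DependsOnWindow M C) :
    Tendsto (fun n => D.freq n C) atTop (𝓝 (μ (D.limName Z ⁻¹' C))) := by
  simp_rw [← hD.measure_perWord_mem Z hZ]
  refine tendsto_measure_of_ae_tendsto_indicator_of_isFiniteMeasure _
    (measurable_limName Z hC.measurableSet) (fun n => measurableSet_perWord_mem Z n C) ?_
  filter_upwards [hD.ae_isTypical_limName Z hZ] with x hx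
  filter_upwards [Admissible.IsTypical.eventually_window Z hD hx M] with n hn
  exact hC _ _ hn

/-- The shift permutes the levels cyclically, so invariance is exact at every finite stage and
passes to the limit law. -/
theorem Admissible.freq_shift (hD : D.Admissible) (n : ℕ) (C : Set (ℤ → Symb ℕ)) :
    D.freq n (shift ⁻¹' C) = D.freq n C := by
  classical
  have hq := hD.q_pos n
  rw [freq, freq]
  congr 2
  refine Finset.card_bij (fun y _ => ((y.1 + 1) % D.q n, y.2)) ?_ ?_ ?_
  · intro y hy
    rw [Finset.mem_filter, Finset.mem_product, Finset.mem_range, Finset.mem_range] at hy ⊢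
    refine ⟨⟨Nat.mod_lt _ hq, hy.1.2⟩, ?_⟩
    have := hy.2
    rwa [Set.mem_preimage, shift_perWord] at this
  · rintro ⟨t, σ⟩ hy ⟨t', σ'⟩ hy' h
    rw [Finset.mem_filter, Finset.mem_product, Finset.mem_range, Finset.mem_range] at hy hy'
    simp only [Prod.mk.injEq] at h hy hy' ⊢
    refine ⟨?_, h.2⟩
    have h1 : t ≡ t' [MOD D.q n] := Nat.ModEq.add_right_cancel' 1 h.1
    rwa [Nat.ModEq, Nat.mod_eq_of_lt hy.1.1, Nat.mod_eq_of_lt hy'.1.1] at h1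
  · rintro ⟨t, σ⟩ hy
    rw [Finset.mem_filter, Finset.mem_product, Finset.mem_range, Finset.mem_range] at hy
    simp only at hy
    have e : ((t + (D.q n - 1)) % D.q n + 1) % D.q n = t := by
      rw [Nat.mod_add_mod, show t + (D.q n - 1) + 1 = t + D.q n by omega, Nat.add_mod_right,
        Nat.mod_eq_of_lt hy.1.1]
    refine ⟨((t + (D.q n - 1)) % D.q n, σ), ?_, ?_⟩
    · rw [Finset.mem_filter, Finset.mem_product, Finset.mem_range, Finset.mem_range]
      refine ⟨⟨Nat.mod_lt _ hq, hy.1.2⟩, ?_⟩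
      rw [Set.mem_preimage, shift_perWord]
      simp only [e]
      exact hy.2
    · exact Prod.ext e rfl

theorem Zmap_symm_eq (n : ℕ) (x : X) :
    (D.Zmap Z n).symm x = (D.Zmap (MeasurableEquiv.refl UnitSquare) n).symm (Z.symm x) := by
  induction n with
  | zero => rfl
  | succ n ih =>
    exact congrArg (D.h n).symm ih

/-- This makes the law of `limName` independent of the space `X` and of `Z`. -/
theorem limName_eq_comp (x : X) :
    D.limName Z x = D.limName (MeasurableEquiv.refl UnitSquare) (Z.symm x) := by
  have h1 : ∀ n, D.pos Z n x = D.pos (MeasurableEquiv.refl UnitSquare) n (Z.symm x) := fun n => by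
    rw [pos, pos, col, col, Zmap_symm_eq]
  have h2 : ∀ n, D.tow Z n x = D.tow (MeasurableEquiv.refl UnitSquare) n (Z.symm x) := fun n => by
    rw [tow, tow, Zmap_symm_eq]
  rw [limName, limName]
  congr 1
  funext n
  rw [h1, h2]

end typical

/-! ### The invariant measure -/

/-- The law of the names of the points of the square. -/
noncomputable def nameLaw (D : AKData) : Measure (ℤ → Symb ℕ) :=
  lebesgue.map (D.limName (MeasurableEquiv.refl UnitSquare))

instance : IsProbabilityMeasure D.nameLaw :=
  Measure.isProbabilityMeasure_map (measurable_limName _).aemeasurable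

theorem measurePreserving_limName {X : Type u} [MeasurableSpace X] {μ : Measure X}
    {Z : UnitSquare ≃ᵐ X} (hZ : MeasurePreserving Z lebesgue μ) :
    MeasurePreserving (D.limName Z) μ D.nameLaw := by
  have h : MeasurePreserving (D.limName (MeasurableEquiv.refl UnitSquare)) lebesgue D.nameLaw :=
    ⟨measurable_limName _, rfl⟩
  have := h.comp hZ.symm
  have e : D.limName Z = D.limName (MeasurableEquiv.refl UnitSquare) ∘ Z.symm :=
    funext (limName_eq_comp Z)
  rwa [← e] at this

theorem measurePreserving_refl :
    MeasurePreserving (MeasurableEquiv.refl UnitSquare) lebesgue lebesgue :=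
  MeasurePreserving.id _

theorem Admissible.tendsto_freq_nameLaw (hD : D.Admissible) {M : ℕ} {C : Set (ℤ → Symb ℕ)}
    (hC : DependsOnWindow M C) : Tendsto (fun n => D.freq n C) atTop (𝓝 (D.nameLaw C)) := by
  rw [nameLaw, Measure.map_apply (measurable_limName _) hC.measurableSet]
  exact hD.tendsto_freq _ measurePreserving_refl hC

theorem Admissible.lebesgue_singleton (hD : D.Admissible) (z : UnitSquare) :
    lebesgue {z} = 0 := by
  refine le_antisymm (le_of_forall_pos_le_add fun ε hε => ?_) zero_le
  rw [zero_add]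
  obtain ⟨n, hn⟩ := ENNReal.exists_inv_nat_lt hε.ne'
  have hsub : ({z} : Set UnitSquare) ⊆ D.level (MeasurableEquiv.refl UnitSquare) n
      (D.pos (MeasurableEquiv.refl UnitSquare) n z)
      (D.tow (MeasurableEquiv.refl UnitSquare) n z) := by
    rintro _ rfl
    exact ⟨rfl, rfl⟩
  refine (measure_mono hsub).trans ?_
  rw [hD.measure_level _ measurePreserving_refl (hD.pos_lt _ _ _) (tow_lt _ _ _)]
  refine le_trans (ENNReal.inv_le_inv.mpr ?_) hn.le
  have h1 := hD.lt_q n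
  have h2 := s_pos (D := D) n
  have : n ≤ D.q n * D.s n := h1.le.trans (Nat.le_mul_of_pos_right _ h2)
  exact_mod_cast this

theorem Admissible.isNonatomicInvariant_nameLaw (hD : D.Admissible) :
    IsNonatomicInvariant D.K D.nameLaw where
  prob := inferInstance
  concentrated := by
    change D.nameLaw (symbolicShift D.words)ᶜ = 0
    rw [nameLaw, Measure.map_apply (measurable_limName _)
      (measurableSet_symbolicShift D.words).compl]
    refine measure_mono_null ?_ (hD.ae_isTypical_limName _ measurePreserving_refl)
    intro z hz hz'
    exact hz (Admissible.IsTypical.mem_coreSet _ hD hz').1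
  nonatomic := by
    intro y
    rw [nameLaw, Measure.map_apply (measurable_limName _) (measurableSet_singleton y)]
    -- By injectivity a sequence is the name of at most one typical point, so its preimage is null.
    by_cases h : ∃ z, D.IsTypical (MeasurableEquiv.refl UnitSquare) z y
    · obtain ⟨z, hz⟩ := h
      refine measure_mono_null ?_ (measure_union_null (hD.lebesgue_singleton z)
        (hD.ae_isTypical_limName _ measurePreserving_refl))
      intro w hw
      by_cases hw' : D.IsTypical (MeasurableEquiv.refl UnitSquare) w
        (D.limName (MeasurableEquiv.refl UnitSquare) w)
      · left
        rw [Set.mem_preimage, Set.mem_singleton_iff] at hw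
        rw [hw] at hw'
        exact Admissible.IsTypical.injective _ hD hw' hz
      · right
        exact hw'
    · refine measure_mono_null ?_ (hD.ae_isTypical_limName _ measurePreserving_refl)
      intro w hw hw'
      rw [Set.mem_preimage, Set.mem_singleton_iff] at hw
      exact h ⟨w, hw ▸ hw'⟩
  invariant := by
    refine ⟨measurable_shift, ?_⟩
    have : IsProbabilityMeasure (D.nameLaw.map shift) :=
      Measure.isProbabilityMeasure_map measurable_shift.aemeasurable
    refine measure_ext_of_window fun M C hC => ?_
    rw [Measure.map_apply measurable_shift hC.measurableSet]
    refine tendsto_nhds_unique (hD.tendsto_freq_nameLaw hC.shift) ?_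
    simp_rw [hD.freq_shift]
    exact hD.tendsto_freq_nameLaw hC

end AKData

/-! ### Uniqueness of the invariant measure -/

namespace AKData

variable {D : AKData}

theorem Admissible.exists_word_of_mem_K (hD : D.Admissible) {y : ℤ → Symb ℕ} (hy : y ∈ D.K)
    (a : ℤ) (m : ℕ) : ∃ N τ p, τ < D.s N ∧ p + m ≤ D.q N ∧
      ∀ r < m, y (a + (r : ℕ)) = D.lett N τ (p + r) := by
  obtain ⟨N, w, ⟨τ, hτ, rfl⟩, u, v, huv⟩ := hy a m
  have hlen := hD.length_towerWord N τ
  rw [← huv, List.length_append, List.length_append, block_length] at hlen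
  refine ⟨N, τ, u.length, hτ, by omega, fun r hr => ?_⟩
  have h1 := hD.getElem?_towerWord N τ (t := u.length + r) (by omega)
  rw [← huv, List.append_assoc, List.getElem?_append_right (by omega), Nat.add_sub_cancel_left,
    List.getElem?_append_left (by rw [block_length]; omega), getElem?_block y a hr] at h1
  exact Option.some.inj h1

theorem Admissible.lt_of_q_lt (hD : D.Admissible) {n N : ℕ} (h : D.q n < D.q N) : n < N := by
  by_contra h1
  have := hD.q_mono (not_lt.mp h1)
  omega

/-- A finite window of `y` that contains both overlapping occurrences appears in one word of some
`𝒲_N`; it is longer than `q n`, so `N > n` and `readsAt_disjoint` applies there. -/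
theorem Admissible.readsSeq_separated (hD : D.Admissible) {y : ℤ → Symb ℕ} (hy : y ∈ D.K) {n : ℕ}
    (hn : 2 ≤ n) {σ σ' : ℕ} {a a' : ℤ} (h : D.ReadsSeq n σ y a) (h' : D.ReadsSeq n σ' y a')
    (haa : a < a') : a + D.q n ≤ a' := by
  by_contra hlt
  obtain ⟨d, rfl⟩ := Int.le.dest haa.le
  obtain ⟨N, τ, p, -, hp, hr⟩ := hD.exists_word_of_mem_K hy a (d + D.q n)
  have hN : n < N := hD.lt_of_q_lt (by omega)
  have h1 : D.ReadsAt n σ (D.lett N τ) p := fun r hrq => by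
    rw [← hr r (by omega), h r hrq]
  have h2 : D.ReadsAt n σ' (D.lett N τ) (p + d) := fun r hrq => by
    rw [← h' r hrq, add_assoc, ← hr (d + r) (by omega)]
    congr 1
    push_cast
    ring
  have := hD.readsAt_disjoint hn hN.le h1 (by omega) h2 (by omega) (by omega)
  omega

theorem Admissible.readsSeq_unique (hD : D.Admissible) {y : ℤ → Symb ℕ} (hy : y ∈ D.K) {n : ℕ}
    (hn : 2 ≤ n) {σ σ' t t' : ℕ} (h : D.ReadsSeq n σ y (-(t : ℤ)))
    (h' : D.ReadsSeq n σ' y (-(t' : ℤ)))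
    (ht : t < D.q n) (ht' : t' < D.q n) (hσ : σ < D.s n) (hσ' : σ' < D.s n) :
    t = t' ∧ σ = σ' := by
  have htt : t = t' := by
    rcases lt_trichotomy t t' with h3 | h3 | h3
    · have := hD.readsSeq_separated hy hn h' h (by omega)
      omega
    · exact h3
    · have := hD.readsSeq_separated hy hn h h' (by omega)
      omega
  subst htt
  exact ⟨rfl, hD.lett_injective n hσ hσ' fun r hr => by rw [← h r hr, ← h' r hr]⟩

theorem Admissible.readsSeq_of_pieceStart (hD : D.Admissible) {y : ℤ → Symb ℕ} {n σ' m : ℕ} {a : ℤ}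
    (h : D.ReadsSeq (n + 1) σ' y a) (hm : m ∈ D.pieceStarts n) :
    D.ReadsSeq n (D.strip n σ' m) y (a + m) := by
  intro r hr
  have h1 := hD.pieceStart_add_le hm
  rw [← hD.readsAt_pieceStarts hm σ' r hr, ← h (m + r) (by omega)]
  congr 1
  push_cast
  ring

/-- The window leaves room `q (n + 1)` on the left and as much from `a` on to the right, so the word
of `𝒲_{n+1}` around the occurrence, found in a word of `𝒲_N`, does not leave it. -/
theorem Admissible.exists_readsSeq_succ (hD : D.Admissible) {y : ℤ → Symb ℕ} (hy : y ∈ D.K) {n : ℕ}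
    (hn : 2 ≤ n) {σ : ℕ} {a : ℤ} (hσ : σ < D.s n) (h : D.ReadsSeq n σ y a) :
    ∃ σ' < D.s (n + 1), ∃ m ∈ D.pieceStarts n, D.strip n σ' m = σ ∧
      D.ReadsSeq (n + 1) σ' y (a - m) := by
  have hq := hD.q_lt_q_succ n
  have hq0 := hD.q_pos n
  obtain ⟨N, τ, p, hτ, hp, hr⟩ := hD.exists_word_of_mem_K hy (a - D.q (n + 1)) (2 * D.q (n + 1))
  have hN : n + 1 < N := hD.lt_of_q_lt (by omega)
  have h1 : D.ReadsAt n σ (D.lett N τ) (p + D.q (n + 1)) := fun r hrq => by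
    rw [← h r hrq, add_assoc, ← hr (D.q (n + 1) + r) (by omega)]
    congr 1
    push_cast
    ring
  obtain ⟨σ', c, hσ', -, hc, hcp, hm⟩ := hD.exists_parent hn (by omega) hτ h1 (by omega)
  obtain ⟨m, hmc⟩ := Nat.exists_eq_add_of_le hcp
  rw [hmc, Nat.add_sub_cancel_left] at hm
  have hml := hD.pieceStart_add_le hm
  have h2 : D.ReadsSeq (n + 1) σ' y (a - m) := fun r hrq => by
    have h3 := hr (c - p + r) (by omega)
    rw [show p + (c - p + r) = c + r by omega, hc r hrq] at h3
    rw [← h3]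
    congr 1
    omega
  refine ⟨σ', hσ', m, hm, ?_, h2⟩
  have h4 := hD.readsSeq_of_pieceStart h2 hm
  rw [sub_add_cancel] at h4
  exact hD.lett_injective n (strip_lt _ _ _) hσ fun r hrq => by rw [← h r hrq, ← h4 r hrq]

theorem measurableSet_readsSeq (n σ : ℕ) (a : ℤ) : MeasurableSet {y | D.ReadsSeq n σ y a} := by
  refine measurableSet_finite_dep a (D.q n) fun x y h => ?_
  exact forall₂_congr fun r hr => by rw [h r hr]

/-- The sequences for which the position `0` lies in a word of `𝒲_n`. -/
def covered (D : AKData) (n : ℕ) : Set (ℤ → Symb ℕ) :=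
  {y | ∃ t < D.q n, ∃ σ < D.s n, D.ReadsSeq n σ y (-(t : ℤ))}

theorem covered_eq (n : ℕ) : D.covered n =
    ⋃ z ∈ Finset.range (D.q n) ×ˢ Finset.range (D.s n), {y | D.ReadsSeq n z.2 y (-(z.1 : ℤ))} := by
  ext y
  simp only [covered, Set.mem_ofPred_eq, Set.mem_iUnion, Finset.mem_product, Finset.mem_range,
    Prod.exists, exists_prop]
  tauto

theorem measurableSet_covered (n : ℕ) : MeasurableSet (D.covered n) := by
  rw [covered_eq]
  exact Finset.measurableSet_biUnion _ fun z _ => measurableSet_readsSeq _ _ _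

theorem Admissible.covered_succ (hD : D.Admissible) {y : ℤ → Symb ℕ} (hy : y ∈ D.K) {n : ℕ}
    (hn : 2 ≤ n) (h : y ∈ D.covered n) : y ∈ D.covered (n + 1) := by
  obtain ⟨t, ht, σ, hσ, hr⟩ := h
  obtain ⟨σ', hσ', m, hm, -, h2⟩ := hD.exists_readsSeq_succ hy hn hσ hr
  have := hD.pieceStart_add_le hm
  refine ⟨t + m, by omega, σ', hσ', ?_⟩
  rwa [show (-((t + m : ℕ) : ℤ)) = -(t : ℤ) - m by push_cast; ring]

theorem Admissible.covered_mono (hD : D.Admissible) {y : ℤ → Symb ℕ} (hy : y ∈ D.K) {n N : ℕ}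
    (hn : 2 ≤ n) (hnN : n ≤ N) (h : y ∈ D.covered n) : y ∈ D.covered N := by
  induction N, hnN using Nat.le_induction with
  | base => exact h
  | succ N hN ih => exact hD.covered_succ hy (by omega) ih

theorem shift_mem_K {y : ℤ → Symb ℕ} (hy : y ∈ D.K) : shift y ∈ D.K := by
  intro a m
  obtain ⟨n, w, hw, h⟩ := hy (a + 1) m
  refine ⟨n, w, hw, ?_⟩
  have : block (shift y) a m = block y (a + 1) m := by
    rw [block, block]
    congr 1
    funext i
    rw [shift]
    congr 1
    ring
  rwa [this]

/-- Every letter of a word of `𝒲_N`, `N ≥ n`, lies in a word of `𝒲_n`, and a window of length `2 * q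
n` around `0` contains that word. -/
theorem Admissible.eq_b_or_e_of_not_covered (hD : D.Admissible) {y : ℤ → Symb ℕ} (hy : y ∈ D.K)
    {n : ℕ} (h : y ∉ D.covered n) : y 0 = Symb.b ∨ y 0 = Symb.e := by
  cases hy0 : y 0 with
  | b => exact Or.inl rfl
  | e => exact Or.inr rfl
  | letter a =>
    exfalso
    have hq := hD.q_pos n
    obtain ⟨N, τ, p, hτ, hp, hr⟩ := hD.exists_word_of_mem_K hy (-(D.q n : ℤ)) (2 * D.q n)
    have hN : n < N := hD.lt_of_q_lt (by omega)
    have h0 := hr (D.q n) (by omega)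
    rw [neg_add_cancel, hy0] at h0
    obtain ⟨σ, c, hσ, -, hc, h1, h2⟩ :=
      hD.exists_readsAt_of_letter hN.le hτ (by omega) ⟨a, h0.symm⟩
    refine h ⟨p + D.q n - c, by omega, σ, hσ, fun r hrq => ?_⟩
    have h3 := hr (c - p + r) (by omega)
    rw [show p + (c - p + r) = c + r by omega, hc r hrq] at h3
    rw [← h3]
    congr 1
    omega

theorem Admissible.not_b_e (hD : D.Admissible) {y : ℤ → Symb ℕ} (hy : y ∈ D.K) {j : ℤ}
    (hb : y j = Symb.b) : y (j + 1) ≠ Symb.e := by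
  obtain ⟨N, τ, p, -, hp, hr⟩ := hD.exists_word_of_mem_K hy j 2
  have h0 := hr 0 (by omega)
  have h1 := hr 1 (by omega)
  rw [Nat.cast_zero, add_zero, add_zero, hb] at h0
  rw [Nat.cast_one] at h1
  rw [h1]
  exact hD.lett_b_e N τ (by omega) h0.symm

/-- The sequences without letters in the shift space form a countable set. -/
theorem Admissible.countable_spacers (hD : D.Admissible) :
    {y | y ∈ D.K ∧ ∀ j : ℤ, y j = Symb.b ∨ y j = Symb.e}.Countable := by
  classical
  have hsub : {y | y ∈ D.K ∧ ∀ j : ℤ, y j = Symb.b ∨ y j = Symb.e} ⊆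
      {fun _ => Symb.b} ∪ {fun _ => Symb.e} ∪
        Set.range fun (p : ℤ) (j : ℤ) => if p ≤ j then (Symb.b : Symb ℕ) else Symb.e := by
    rintro y ⟨hy, hbe⟩
    have hup : ∀ i j : ℤ, i ≤ j → y i = Symb.b → y j = Symb.b := by
      intro i j hij hi
      induction j, hij using Int.leInduction with
      | base => exact hi
      | succ j hj ih => exact (hbe (j + 1)).resolve_right (hD.not_b_e hy ih)
    by_cases h1 : ∃ j, y j = Symb.b
    · by_cases h2 : ∃ j, y j = Symb.e
      · right
        obtain ⟨j, hj⟩ := h2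
        obtain ⟨p, hp, hmin⟩ := Int.exists_least_of_bdd (P := fun z => y z = Symb.b)
          ⟨j, fun z hz => by
            by_contra hlt
            rw [hup z j (by omega) hz] at hj
            cases hj⟩ h1
        refine ⟨p, funext fun i => ?_⟩
        change (if p ≤ i then Symb.b else Symb.e) = y i
        split_ifs with hi
        · exact (hup p i hi hp).symm
        · exact ((hbe i).resolve_left fun h => hi (hmin i h)).symm
      · left; left
        exact funext fun i => (hbe i).resolve_right fun h => h2 ⟨i, h⟩
    · left; right
      exact funext fun i => (hbe i).resolve_left fun h => h1 ⟨i, h⟩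
  exact Set.Countable.mono hsub
    (((Set.countable_singleton _).union (Set.countable_singleton _)).union (Set.countable_range _))

section invariant

variable {ν : Measure (ℤ → Symb ℕ)}

theorem IsNonatomicInvariant.measure_readsSeq (hν : IsNonatomicInvariant D.K ν) (n σ : ℕ) (a : ℤ) :
    ν {y | D.ReadsSeq n σ y a} = ν {y | D.ReadsSeq n σ y 0} := by
  have step : ∀ a : ℤ, ν {y | D.ReadsSeq n σ y (a + 1)} = ν {y | D.ReadsSeq n σ y a} := by
    intro a
    rw [← hν.invariant.measure_preimage (measurableSet_readsSeq n σ a).nullMeasurableSet]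
    congr 1
    ext y
    refine forall₂_congr fun r _ => ?_
    rw [shift, add_right_comm]
  induction a with
  | zero => rfl
  | succ i ih => rw [step, ih]
  | pred i ih => rw [← ih, ← step (-(i : ℤ) - 1), sub_add_cancel]

theorem Admissible.aedisjoint_readsSeq (hD : D.Admissible) (hν : IsNonatomicInvariant D.K ν) {n : ℕ}
    (hn : 2 ≤ n) {S : Set (ℕ × ℕ)} (hS : ∀ z ∈ S, z.1 < D.q n ∧ z.2 < D.s n) :
    S.Pairwise (Function.onFun (AEDisjoint ν)
      fun z : ℕ × ℕ => {y | D.ReadsSeq n z.2 y (-(z.1 : ℤ))}) := by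
  rintro z hz z' hz' hne
  refine measure_mono_null ?_ hν.concentrated
  rintro y ⟨h1, h2⟩ hy
  obtain ⟨h3, h4⟩ := hD.readsSeq_unique hy hn h1 h2 (hS z hz).1 (hS z' hz').1 (hS z hz).2
    (hS z' hz').2
  exact hne (Prod.ext h3 h4)

/-- All words of `𝒲_n` have the same frequency. -/
theorem Admissible.measure_readsSeq_eq (hD : D.Admissible) (hν : IsNonatomicInvariant D.K ν) {n : ℕ}
    (hn : 2 ≤ n) {σ σ' : ℕ} (hσ : σ < D.s n) (hσ' : σ' < D.s n) :
    ν {y | D.ReadsSeq n σ y 0} = ν {y | D.ReadsSeq n σ' y 0} := by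
  classical
  -- Every occurrence of a word of `𝒲_n` has exactly one parent in `𝒲_{n+1}`, and the number of
  -- places in a parent is independent of `σ`; so the right-hand side does not involve `σ`.
  have key : ∀ σ < D.s n, ν {y | D.ReadsSeq n σ y 0} = ∑ τ ∈ Finset.range (D.s (n + 1)),
      ((D.q n * (D.k n / D.s n) * (D.l n - 1) : ℕ) : ℝ≥0∞) * ν {y | D.ReadsSeq (n + 1) τ y 0} := by
    intro σ hσ
    set I := (Finset.range (D.q (n + 1)) ×ˢ Finset.range (D.s (n + 1))).filter
      fun z => z.1 ∈ D.pieceStarts n ∧ D.strip n z.2 z.1 = σ with hI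
    have h1 : ν {y | D.ReadsSeq n σ y 0} =
        ν (⋃ z ∈ I, {y | D.ReadsSeq (n + 1) z.2 y (-(z.1 : ℤ))}) := by
      refine measure_congr ?_
      have hK : ∀ᵐ y ∂ν, y ∈ D.K := hν.concentrated
      filter_upwards [hK] with y hy
      apply propext
      change D.ReadsSeq n σ y 0 ↔ y ∈ ⋃ z ∈ I, {y | D.ReadsSeq (n + 1) z.2 y (-(z.1 : ℤ))}
      rw [Set.mem_iUnion₂]
      constructor
      · intro h
        obtain ⟨τ, hτ, m, hm, hs, hr⟩ := hD.exists_readsSeq_succ hy hn hσ h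
        rw [zero_sub] at hr
        refine ⟨(m, τ), ?_, hr⟩
        rw [hI, Finset.mem_filter, Finset.mem_product, Finset.mem_range, Finset.mem_range]
        exact ⟨⟨hm.1, hτ⟩, hm, hs⟩
      · rintro ⟨z, hz, hr⟩
        rw [hI, Finset.mem_filter] at hz
        have := hD.readsSeq_of_pieceStart hr hz.2.1
        rwa [hz.2.2, neg_add_cancel] at this
    rw [h1, measure_biUnion_finset₀ (hD.aedisjoint_readsSeq hν (by omega) ?_)
      (fun z _ => (measurableSet_readsSeq _ _ _).nullMeasurableSet), hI, Finset.sum_filter,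
      Finset.sum_product_right]
    · refine Finset.sum_congr rfl fun τ hτ => ?_
      rw [← Finset.sum_filter, Finset.sum_congr rfl (g := fun _ => ν {y | D.ReadsSeq (n + 1) τ y 0})
        (fun (m : ℕ) _ => IsNonatomicInvariant.measure_readsSeq hν (n + 1) τ (-(m : ℤ))),
        Finset.sum_const, nsmul_eq_mul, ← hD.ncard_pieceStarts hσ (Finset.mem_range.mp hτ),
        ← Set.ncard_coe_finset]
      congr 3
      ext m
      rw [Finset.coe_filter, Set.mem_ofPred_eq, Set.mem_ofPred_eq, Finset.mem_range]
      exact ⟨fun h => h.2, fun h => ⟨h.1.1, h⟩⟩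
    · intro z hz
      rw [Finset.mem_coe, hI, Finset.mem_filter, Finset.mem_product, Finset.mem_range,
        Finset.mem_range] at hz
      exact hz.1
  rw [key σ hσ, key σ' hσ']

/-- The `q n * s n` events "word `σ` around `0`, read from level `t`" are almost disjoint and have
the same measure, and the total mass is one. -/
theorem Admissible.measure_readsSeq_le (hD : D.Admissible) (hν : IsNonatomicInvariant D.K ν) {n : ℕ}
    (hn : 2 ≤ n) {σ : ℕ} (hσ : σ < D.s n) (a : ℤ) :
    ν {y | D.ReadsSeq n σ y a} ≤ ((D.q n : ℝ≥0∞) * D.s n)⁻¹ := by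
  have := hν.prob
  have h1 : ν (⋃ z ∈ Finset.range (D.q n) ×ˢ Finset.range (D.s n),
      {y | D.ReadsSeq n z.2 y (-(z.1 : ℤ))}) ≤ 1 := prob_le_one
  rw [measure_biUnion_finset₀ (hD.aedisjoint_readsSeq hν hn ?_)
      (fun z _ => (measurableSet_readsSeq _ _ _).nullMeasurableSet),
    Finset.sum_congr rfl (g := fun _ => ν {y | D.ReadsSeq n σ y a}), Finset.sum_const,
    Finset.card_product, Finset.card_range, Finset.card_range, nsmul_eq_mul, Nat.cast_mul] at h1
  · rwa [ENNReal.le_inv_iff_mul_le, mul_comm]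
  · intro z hz
    rw [Finset.mem_product, Finset.mem_range, Finset.mem_range] at hz
    rw [IsNonatomicInvariant.measure_readsSeq hν, IsNonatomicInvariant.measure_readsSeq hν n σ a]
    exact hD.measure_readsSeq_eq hν hn hz.2 hσ
  · intro z hz
    rwa [Finset.mem_coe, Finset.mem_product, Finset.mem_range, Finset.mem_range] at hz

end invariant

end AKData

namespace AKData

variable {D : AKData} {ν : Measure (ℤ → Symb ℕ)}

/-! ### Sequences outside the words are negligible -/

theorem Admissible.measure_starts_le (hD : D.Admissible) (hν : IsNonatomicInvariant D.K ν) {n : ℕ}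
    (hn : 2 ≤ n) (a : ℤ) :
    ν (⋃ σ ∈ Finset.range (D.s n), {y | D.ReadsSeq n σ y a}) ≤ (D.q n : ℝ≥0∞)⁻¹ := by
  refine (measure_biUnion_finset_le _ _).trans ((Finset.sum_le_sum fun σ hσ =>
    hD.measure_readsSeq_le hν hn (Finset.mem_range.mp hσ) a).trans ?_)
  rw [Finset.sum_const, Finset.card_range, nsmul_eq_mul,
    ENNReal.mul_inv (Or.inr (ENNReal.natCast_ne_top _)) (Or.inl (ENNReal.natCast_ne_top _)),
    mul_left_comm, ENNReal.mul_inv_cancel (Nat.cast_ne_zero.mpr (s_pos n).ne')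
      (ENNReal.natCast_ne_top _), mul_one]

theorem Admissible.tendsto_inv_q (hD : D.Admissible) :
    Tendsto (fun n => (D.q n : ℝ≥0∞)⁻¹) atTop (𝓝 0) :=
  ENNReal.tendsto_inv_nat_nhds_zero.comp hD.tendsto_q

/-- The sequences for which the position `0` lies in no word of any `𝒲_n`, `n ≥ 2`. -/
def uncovered (D : AKData) : Set (ℤ → Symb ℕ) := ⋂ n ≥ 2, (D.covered n)ᶜ

/-- If `0` is uncovered but `1` is covered, then for all large `n` a word of `𝒲_n` starts exactly at
`1`. This has probability at most `1 / q n`. -/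
theorem Admissible.uncovered_ae_le_shift (hD : D.Admissible) (hν : IsNonatomicInvariant D.K ν) :
    ν (D.uncovered \ shift ⁻¹' D.uncovered) = 0 := by
  set G : ℕ → Set (ℤ → Symb ℕ) := fun n =>
    ⋃ σ ∈ Finset.range (D.s n), {y | D.ReadsSeq n σ y 1} with hG
  have hsub : D.uncovered \ shift ⁻¹' D.uncovered ⊆ D.Kᶜ ∪ ⋃ N ≥ 2, ⋂ n ≥ N, G n := by
    rintro y ⟨hy, hy'⟩
    by_cases hK : y ∈ D.K
    · right
      rw [Set.mem_preimage, uncovered, Set.mem_iInter₂] at hy'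
      push Not at hy'
      obtain ⟨N, hN, hc⟩ := hy'
      rw [Set.mem_compl_iff, not_not] at hc
      rw [Set.mem_iUnion₂]
      refine ⟨N, hN, Set.mem_iInter₂.mpr fun n hn => ?_⟩
      obtain ⟨t, ht, σ, hσ, hr⟩ := hD.covered_mono (shift_mem_K hK) hN hn hc
      have hyn : y ∉ D.covered n := Set.mem_iInter₂.mp hy n (le_trans hN hn)
      have hr' : D.ReadsSeq n σ y (1 - (t : ℤ)) := fun r hrq => by
        rw [← hr r hrq, shift]
        congr 1
        ring
      rcases Nat.eq_zero_or_pos t with rfl | h0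
      · rw [Nat.cast_zero, sub_zero] at hr'
        exact Set.mem_iUnion₂.mpr ⟨σ, Finset.mem_range.mpr hσ, hr'⟩
      · refine absurd ⟨t - 1, by omega, σ, hσ, ?_⟩ hyn
        rwa [show (-((t - 1 : ℕ) : ℤ)) = 1 - (t : ℤ) by omega]
    · exact Or.inl hK
  refine measure_mono_null hsub (measure_union_null hν.concentrated ?_)
  rw [measure_iUnion_null_iff]
  intro N
  rw [measure_iUnion_null_iff]
  intro hN
  refine le_antisymm (ge_of_tendsto hD.tendsto_inv_q ?_) zero_le
  filter_upwards [eventually_ge_atTop N] with n hn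
  exact (measure_mono (Set.iInter₂_subset n hn)).trans (hD.measure_starts_le hν (hN.trans hn) 1)

/-- A set that is almost mapped into itself by a measure preserving map of finite measure. -/
theorem _root_.MeasureTheory.MeasurePreserving.ae_forall_iterate_mem {α : Type*}
    [MeasurableSpace α] {μ : Measure α} {f : α → α} (hf : MeasurePreserving f μ μ) {V : Set α}
    (h : μ (V \ f ⁻¹' V) = 0) : ∀ᵐ x ∂μ, x ∈ V → ∀ j : ℕ, f^[j] x ∈ V := by
  have h1 : ∀ᵐ x ∂μ, x ∈ V → f x ∈ V := by
    refine measure_mono_null ?_ h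
    intro x hx
    rw [Set.mem_compl_iff, Set.mem_ofPred_eq] at hx
    push Not at hx
    exact hx
  have h2 : ∀ᵐ x ∂μ, ∀ j : ℕ, f^[j] x ∈ V → f (f^[j] x) ∈ V :=
    ae_all_iff.mpr fun j => (hf.iterate j).quasiMeasurePreserving.ae h1
  filter_upwards [h2] with x hx hV j
  induction j with
  | zero => exact hV
  | succ j ih => rw [Function.iterate_succ_apply']; exact hx j ih

theorem iterate_shift {α : Type*} (y : ℤ → α) (j : ℕ) (m : ℤ) : shift^[j] y m = y (m + j) := by
  induction j generalizing m with
  | zero => simp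
  | succ j ih =>
    rw [Function.iterate_succ_apply', shift, ih]
    congr 1
    push_cast
    ring

/-- Almost every uncovered sequence stays uncovered under all forward shifts, so it has no letters
on `[0, ∞)`. By invariance this event has the same measure as having no letters at all, and such
sequences form a countable set, null for a non-atomic measure. -/
theorem Admissible.measure_uncovered (hD : D.Admissible) (hν : IsNonatomicInvariant D.K ν) :
    ν D.uncovered = 0 := by
  have := hν.prob
  have hK : ∀ᵐ y ∂ν, y ∈ D.K := hν.concentrated
  set A : ℕ → Set (ℤ → Symb ℕ) := fun m => {y | ∀ j : ℤ, -(m : ℤ) ≤ j → y j = Symb.b ∨ y j = Symb.e}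
    with hA
  have hAm : ∀ m, MeasurableSet (A m) := by
    intro m
    have : A m = ⋂ j : ℤ, ⋂ _ : -(m : ℤ) ≤ j, (fun y => y j) ⁻¹' {Symb.b, Symb.e} := by
      ext y
      simp [hA]
    rw [this]
    exact MeasurableSet.iInter fun j => MeasurableSet.iInter fun _ =>
      measurable_pi_apply j (Set.to_countable _).measurableSet
  have hle : ν D.uncovered ≤ ν (A 0) := by
    refine measure_mono_ae ?_
    filter_upwards [hν.invariant.ae_forall_iterate_mem (hD.uncovered_ae_le_shift hν), hK,
      ae_all_iff.mpr fun j : ℕ => (hν.invariant.iterate j).quasiMeasurePreserving.ae hK]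
      with y hy hyK hyK' hV j hj
    obtain ⟨i, rfl⟩ := Int.eq_ofNat_of_zero_le (by simpa using hj : 0 ≤ j)
    have h1 := hD.eq_b_or_e_of_not_covered (hyK' i) (n := 2)
      (Set.mem_iInter₂.mp (hy hV i) 2 le_rfl)
    rwa [iterate_shift, zero_add] at h1
  -- The decreasing sets `A m` are shifts of one another, so their common measure is that of their
  -- intersection.
  have hshift : ∀ m, ν (A (m + 1)) = ν (A m) := by
    intro m
    rw [← hν.invariant.measure_preimage (hAm (m + 1)).nullMeasurableSet]
    congr 1
    ext y
    constructor
    · intro h j hj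
      have := h (j - 1) (by push_cast; omega)
      rwa [shift, sub_add_cancel] at this
    · intro h j hj
      exact h (j + 1) (by push_cast at hj; omega)
  have hconst : ∀ m, ν (A m) = ν (A 0) := by
    intro m
    induction m with
    | zero => rfl
    | succ m ih => rw [hshift, ih]
  have hlim : Tendsto (fun m => ν (A m)) atTop (𝓝 (ν (⋂ m, A m))) := by
    refine tendsto_measure_iInter_atTop (fun m => (hAm m).nullMeasurableSet) ?_
      ⟨0, measure_ne_top _ _⟩
    intro m m' hm y hy j hj
    exact hy j (by omega)
  simp_rw [hconst] at hlim
  have h0 : ν (⋂ m, A m) = 0 := by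
    refine measure_mono_null (t := D.Kᶜ ∪ {y | y ∈ D.K ∧ ∀ j : ℤ, y j = Symb.b ∨ y j = Symb.e}) ?_
      (measure_union_null hν.concentrated ?_)
    · intro y hy
      by_cases h : y ∈ D.K
      · exact Or.inr ⟨h, fun j => Set.mem_iInter.mp hy j.natAbs j (by omega)⟩
      · exact Or.inl h
    · rw [← Set.biUnion_of_singleton {y | y ∈ D.K ∧ ∀ j : ℤ, y j = Symb.b ∨ y j = Symb.e}]
      exact (measure_biUnion_null_iff hD.countable_spacers).mpr fun y _ => hν.nonatomic y
  rw [h0] at hlim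
  have := tendsto_nhds_unique hlim tendsto_const_nhds
  exact le_antisymm (hle.trans this.symm.le) zero_le

theorem Admissible.tendsto_measure_compl_covered (hD : D.Admissible)
    (hν : IsNonatomicInvariant D.K ν) :
    Tendsto (fun n => ν (D.covered n)ᶜ) atTop (𝓝 0) := by
  have := hν.prob
  rw [← tendsto_add_atTop_iff_nat 2]
  set B : ℕ → Set (ℤ → Symb ℕ) := fun n => (D.covered (n + 2))ᶜ ∩ D.K with hB
  have hKm : MeasurableSet D.K := measurableSet_symbolicShift _
  have h1 : ∀ n, ν (D.covered (n + 2))ᶜ = ν (B n) := by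
    intro n
    refine measure_congr ?_
    have hK : ∀ᵐ y ∂ν, y ∈ D.K := hν.concentrated
    filter_upwards [hK] with y hy
    exact propext ⟨fun h => ⟨h, hy⟩, fun h => h.1⟩
  simp_rw [h1]
  have h2 : ν (⋂ n, B n) = 0 := by
    refine measure_mono_null ?_ (hD.measure_uncovered hν)
    intro y hy
    refine Set.mem_iInter₂.mpr fun n hn => ?_
    obtain ⟨m, rfl⟩ := Nat.exists_eq_add_of_le' hn
    exact (Set.mem_iInter.mp hy m).1
  rw [← h2]
  refine tendsto_measure_iInter_atTop
    (fun n => ((measurableSet_covered _).compl.inter hKm).nullMeasurableSet) ?_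
    ⟨0, measure_ne_top _ _⟩
  intro m n hmn y hy
  exact ⟨fun h => hy.1 (hD.covered_mono hy.2 (by omega) (by omega) h), hy.2⟩

/-- If `0` lies in a word of `𝒲_n` at distance at least `M` from its ends, the window shows the
periodic name of that word, and `freq` counts these words. The two error terms pay for levels near
the ends and for uncovered sequences. -/
theorem Admissible.measure_window_le (hD : D.Admissible) (hν : IsNonatomicInvariant D.K ν) {M : ℕ}
    {C : Set (ℤ → Symb ℕ)} (hC : DependsOnWindow M C) {n : ℕ} (hn : 2 ≤ n) :
    ν C ≤ D.freq n C + (2 * M * (D.q n : ℝ≥0∞)⁻¹ + ν (D.covered n)ᶜ) := by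
  classical
  set I := (Finset.range (D.q n) ×ˢ Finset.range (D.s n)).filter
    fun z => D.perWord n z.2 z.1 ∈ C with hI
  set J := Finset.range M ∪ Finset.Ico (D.q n - M) (D.q n) with hJ
  set Rd : ℕ × ℕ → Set (ℤ → Symb ℕ) := fun z => {y | D.ReadsSeq n z.2 y (-(z.1 : ℤ))} with hRd
  have hsub : C ⊆ (⋃ z ∈ I, Rd z) ∪
      ((⋃ t ∈ J, ⋃ σ ∈ Finset.range (D.s n), {y | D.ReadsSeq n σ y (-(t : ℤ))}) ∪
        (D.covered n)ᶜ) := by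
    intro y hy
    by_cases hc : y ∈ D.covered n
    · obtain ⟨t, ht, σ, hσ, hr⟩ := hc
      by_cases hJt : t ∈ J
      · right; left
        exact Set.mem_iUnion₂.mpr ⟨t, hJt, Set.mem_iUnion₂.mpr ⟨σ, Finset.mem_range.mpr hσ, hr⟩⟩
      · left
        rw [hJ, Finset.mem_union, Finset.mem_range, Finset.mem_Ico] at hJt
        refine Set.mem_iUnion₂.mpr ⟨(t, σ), ?_, hr⟩
        rw [hI, Finset.mem_filter, Finset.mem_product, Finset.mem_range, Finset.mem_range]
        refine ⟨⟨ht, hσ⟩, (hC _ _ fun i hi => ?_).mp hy⟩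
        rw [abs_le] at hi
        have h1 : ((t : ℤ) + i).toNat < D.q n := by omega
        rw [perWord_apply (r := ((t : ℤ) + i).toNat) (by dsimp only; omega) h1, ← hr _ h1]
        congr 1
        omega
    · exact Or.inr (Or.inr hc)
  refine (measure_mono hsub).trans ((measure_union_le _ _).trans
    (add_le_add ?_ ((measure_union_le _ _).trans (add_le_add_left ?_ _))))
  · refine (measure_biUnion_finset_le _ _).trans ((Finset.sum_le_sum
      (g := fun _ => ((D.q n : ℝ≥0∞) * D.s n)⁻¹) fun z hz => ?_).trans ?_)
    · rw [hI, Finset.mem_filter, Finset.mem_product, Finset.mem_range, Finset.mem_range] at hz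
      exact hD.measure_readsSeq_le hν hn hz.1.2 _
    · rw [Finset.sum_const, nsmul_eq_mul, freq]
  · refine (measure_biUnion_finset_le _ _).trans ((Finset.sum_le_sum
      (g := fun _ => (D.q n : ℝ≥0∞)⁻¹) fun t _ => hD.measure_starts_le hν hn _).trans ?_)
    rw [Finset.sum_const, nsmul_eq_mul]
    have h1 : J.card ≤ 2 * M := by
      refine (Finset.card_union_le _ _).trans ?_
      rw [Finset.card_range, Nat.card_Ico]
      omega
    gcongr
    exact_mod_cast h1

theorem Admissible.measure_window_le_nameLaw (hD : D.Admissible) (hν : IsNonatomicInvariant D.K ν)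
    {M : ℕ} {C : Set (ℤ → Symb ℕ)} (hC : DependsOnWindow M C) : ν C ≤ D.nameLaw C := by
  have h : Tendsto (fun n => D.freq n C + (2 * M * (D.q n : ℝ≥0∞)⁻¹ + ν (D.covered n)ᶜ)) atTop
      (𝓝 (D.nameLaw C + (2 * M * 0 + 0))) :=
    (hD.tendsto_freq_nameLaw hC).add
      ((ENNReal.Tendsto.const_mul hD.tendsto_inv_q (Or.inr (by finiteness))).add
        (hD.tendsto_measure_compl_covered hν))
  rw [mul_zero, add_zero, add_zero] at h
  exact ge_of_tendsto h ((eventually_ge_atTop 2).mono fun n hn => hD.measure_window_le hν hC hn)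

/-- The one-sided bound, applied to `C` and to its complement, gives equality for probability
measures. -/
theorem Admissible.eq_nameLaw (hD : D.Admissible) (hν : IsNonatomicInvariant D.K ν) :
    ν = D.nameLaw := by
  have := hν.prob
  refine measure_ext_of_window fun M C hC => le_antisymm (hD.measure_window_le_nameLaw hν hC) ?_
  have hC' : DependsOnWindow M Cᶜ := fun x y h => not_congr (hC x y h)
  have h1 := hD.measure_window_le_nameLaw hν hC'
  rw [prob_compl_eq_one_sub hC.measurableSet, prob_compl_eq_one_sub hC.measurableSet] at h1
  exact (ENNReal.sub_le_sub_iff_left prob_le_one ENNReal.one_ne_top).mp h1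

/-- Conditioning on an invariant set of positive measure gives another non-atomic invariant measure
on `𝕂`. By uniqueness it is the same measure, so the complement of the set is null. -/
theorem Admissible.ergodic_nameLaw (hD : D.Admissible) : Ergodic shift D.nameLaw := by
  have hν := hD.isNonatomicInvariant_nameLaw
  refine ⟨hν.invariant, ⟨fun {A} hA hinv => ?_⟩⟩
  by_cases h0 : D.nameLaw A = 0
  · rw [eventuallyConst_set']
    exact Or.inl (ae_eq_empty.mpr h0)
  · have hcond : IsNonatomicInvariant D.K (ProbabilityTheory.cond D.nameLaw A) :=
      { prob := ProbabilityTheory.cond_isProbabilityMeasure h0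
        concentrated := ProbabilityTheory.cond_absolutelyContinuous hν.concentrated
        nonatomic := fun x => ProbabilityTheory.cond_absolutelyContinuous (hν.nonatomic x)
        invariant := by
          have h1 := hν.invariant.restrict_preimage hA
          rw [hinv] at h1
          exact h1.smul_measure _ }
    have h1 := hD.eq_nameLaw hcond
    rw [eventuallyConst_set']
    right
    rw [ae_eq_univ, ← h1]
    rw [ProbabilityTheory.cond_apply hA, Set.inter_compl_self, measure_empty, mul_zero]

end AKData

/-! ### The transformations built by the abstract method -/

theorem MeasureTheory.MeasurePreserving.zpow {X : Type*} [MeasurableSpace X] {μ : Measure X}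
    {T : X ≃ᵐ X} (hT : MeasurePreserving T μ μ) (i : ℤ) :
    MeasurePreserving (fun x => ((T.toEquiv : Equiv.Perm X) ^ i) x) μ μ := by
  induction i with
  | zero => exact MeasurePreserving.id μ
  | succ i ih =>
    have : (fun x => ((T.toEquiv : Equiv.Perm X) ^ ((i : ℤ) + 1)) x) =
        (fun x => ((T.toEquiv : Equiv.Perm X) ^ (i : ℤ)) x) ∘ T := by
      funext x
      rw [zpow_add_one]
      rfl
    rw [this]
    exact ih.comp hT
  | pred i ih =>
    have : (fun x => ((T.toEquiv : Equiv.Perm X) ^ (-(i : ℤ) - 1)) x) =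
        (fun x => ((T.toEquiv : Equiv.Perm X) ^ (-(i : ℤ))) x) ∘ T.symm := by
      funext x
      rw [zpow_sub_one]
      rfl
    rw [this]
    exact ih.comp (hT.symm T)

namespace AKData

variable {D : AKData} {X : Type u} [MeasurableSpace X] {Z : UnitSquare ≃ᵐ X} {μ : Measure X}

/-- The points that lie in the spacer levels of the `(n+1)`-towers. -/
def spacerSet (D : AKData) (Z : UnitSquare ≃ᵐ X) (n : ℕ) : Set X :=
  {x | D.phase n (D.pos Z (n + 1) x) < D.q n ∨ D.l n * D.q n ≤ D.phase n (D.pos Z (n + 1) x)}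

theorem measurableSet_spacerSet (n : ℕ) : MeasurableSet (D.spacerSet Z n) :=
  measurable_pos Z (n + 1)
    (t := {t | D.phase n t < D.q n ∨ D.l n * D.q n ≤ D.phase n t}) (Set.to_countable _).measurableSet

theorem Admissible.measure_spacerSet_le (hD : D.Admissible) (hZ : MeasurePreserving Z lebesgue μ)
    (n : ℕ) : μ (D.spacerSet Z n) ≤ (D.l n : ℝ≥0∞)⁻¹ := by
  have hsub : D.spacerSet Z n ⊆ {x | D.pos Z (n + 1) x ∈ (Finset.range (D.q (n + 1))).filter
      fun t => D.phase n t < D.q n ∨ D.l n * D.q n ≤ D.phase n t} := fun x hx => by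
    rw [Set.mem_ofPred_eq, Finset.mem_filter, Finset.mem_range]
    exact ⟨hD.pos_lt Z (n + 1) x, hx⟩
  refine (measure_mono hsub).trans ((hD.measure_pos_mem_le Z hZ (n + 1) _).trans ?_)
  refine natCast_mul_inv_le (hD.q_pos _) ?_
  refine (Nat.mul_le_mul_right _ (hD.spacer_count n)).trans (le_of_eq ?_)
  rw [q_succ]
  ring

/-- The points that lie in spacer levels at late stages. -/
def lateSpacers (D : AKData) (Z : UnitSquare ≃ᵐ X) (n : ℕ) : Set X := ⋃ m ≥ n, D.spacerSet Z m

theorem measurableSet_lateSpacers (n : ℕ) : MeasurableSet (D.lateSpacers Z n) :=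
  MeasurableSet.iUnion fun m => MeasurableSet.iUnion fun _ => measurableSet_spacerSet m

/-- The spacers of stage `m ≥ n` have measure at most `1 / l m`, and the growth condition gives `q n
/ l m ≤ q m / l m ≤ 2^(-(m + 2))`. The weaker exponent `m + 1` suffices for the geometric sum. -/
theorem Admissible.mul_measure_lateSpacers_le (hD : D.Admissible)
    (hZ : MeasurePreserving Z lebesgue μ) (n : ℕ) :
    D.q n * μ (D.lateSpacers Z n) ≤ (2⁻¹ : ℝ≥0∞) ^ n := by
  have h1 : D.lateSpacers Z n ⊆ ⋃ j, D.spacerSet Z (n + j) := by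
    refine Set.iUnion₂_subset fun m hm => ?_
    obtain ⟨j, rfl⟩ := Nat.exists_eq_add_of_le hm
    exact Set.subset_iUnion (fun j => D.spacerSet Z (n + j)) j
  calc D.q n * μ (D.lateSpacers Z n) ≤ D.q n * ∑' j, μ (D.spacerSet Z (n + j)) := by
        gcongr
        exact (measure_mono h1).trans (measure_iUnion_le _)
    _ = ∑' j, D.q n * μ (D.spacerSet Z (n + j)) := ENNReal.tsum_mul_left.symm
    _ ≤ ∑' j, (2⁻¹ : ℝ≥0∞) ^ (n + 1) * 2⁻¹ ^ j := by
        refine ENNReal.tsum_le_tsum fun j => ?_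
        refine (mul_le_mul_right (hD.measure_spacerSet_le hZ (n + j)) _).trans ?_
        rw [← pow_add, ← ENNReal.inv_pow,
          show (2 : ℝ≥0∞) ^ (n + 1 + j) = ((2 ^ (n + 1 + j) : ℕ) : ℝ≥0∞) by push_cast; rfl]
        refine natCast_mul_inv_le (hD.l_pos _) ?_
        refine le_trans ?_ (hD.growth (n + j))
        have hq := hD.q_mono (Nat.le_add_right n j)
        have hk := D.k_pos (n + j)
        calc D.q n * 2 ^ (n + 1 + j) ≤ D.q (n + j) * 2 ^ (n + j + 2) :=
              Nat.mul_le_mul hq (Nat.pow_le_pow_right (by norm_num) (by omega))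
          _ = 2 ^ (n + j + 2) * D.q (n + j) * 1 := by ring
          _ ≤ _ := Nat.mul_le_mul_left _ hk
    _ = (2⁻¹ : ℝ≥0∞) ^ n := by
        rw [ENNReal.tsum_mul_left, ENNReal.tsum_geometric, pow_succ, ENNReal.one_sub_inv_two,
          inv_inv, mul_assoc, ENNReal.inv_mul_cancel (by norm_num) (by norm_num), mul_one]

theorem phase_at_zero (n : ℕ) : D.phase n 0 = 0 := by
  rw [phase, Nat.zero_mod, Nat.zero_div, Nat.zero_div, dynIndex_zero]

/-- A move to the next level of the `(M)`-towers is a move to the next level of the `n`-towers,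
unless it ends in a spacer. -/
theorem Admissible.step_of_step (hD : D.Admissible) {x y : X} {n M : ℕ} (hnM : n ≤ M)
    (hy : y ∉ D.lateSpacers Z n)
    (hp : D.pos Z M y = (D.pos Z M x + 1) % D.q M) (ht : D.tow Z M y = D.tow Z M x) :
    D.pos Z n y = (D.pos Z n x + 1) % D.q n ∧ D.tow Z n y = D.tow Z n x := by
  induction M, hnM using Nat.le_induction with
  | base => exact ⟨hp, ht⟩
  | succ m hnm ih =>
    have hym : y ∉ D.spacerSet Z m := fun h => hy (Set.mem_iUnion₂.mpr ⟨m, hnm, h⟩)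
    rw [spacerSet, Set.mem_ofPred_eq, not_or, not_lt, not_le] at hym
    obtain ⟨h1, h2⟩ := hD.pos_succ Z m x
    obtain ⟨h3, h4⟩ := hD.pos_succ Z m y
    have hqm := hD.q_pos m
    have hlt := hD.pos_lt Z (m + 1) x
    set t := D.pos Z (m + 1) x
    set t' := D.pos Z (m + 1) y with ht'
    -- Passing from the top to level `0` would end in a spacer, as level `0` has phase `0`.
    have htt : t' = t + 1 := by
      rcases Nat.lt_or_ge (t + 1) (D.q (m + 1)) with h | h
      · rwa [Nat.mod_eq_of_lt h] at hp
      · rw [show t + 1 = D.q (m + 1) by omega, Nat.mod_self] at hp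
        rw [hp, phase_at_zero] at hym
        omega
    have hstep : D.phase m t' = D.phase m t + 1 ∧ ∀ σ, D.strip m σ t' = D.strip m σ t := by
      obtain ⟨blk, r, hr, hbr⟩ := hD.exists_block m t'
      have hr0 : r ≠ 0 := by
        rintro rfl
        rw [hbr, hD.phase_add m blk hr] at hym
        have := dynIndex_lt (p := D.p m) hqm (blk / D.k m)
        omega
      have htr : t = blk * (D.l m * D.q m) + (r - 1) := by omega
      constructor
      · rw [hbr, htr, hD.phase_add m blk hr, hD.phase_add m blk (by omega)]
        omega
      · intro σ
        rw [hbr, htr, hD.strip_add m σ blk hr, hD.strip_add m σ blk (by omega)]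
    refine ih ?_ ?_
    · rw [h3, h1, hstep.1, Nat.mod_add_mod]
    · rw [h4, h2, ht, hstep.2]

theorem Admissible.lett_eq_of_notMem_spacerSet (hD : D.Admissible) {x : X} {n : ℕ}
    (h : x ∉ D.spacerSet Z n) : D.lett (n + 1) (D.tow Z (n + 1) x) (D.pos Z (n + 1) x)
      = D.lett n (D.tow Z n x) (D.pos Z n x) := by
  rw [spacerSet, Set.mem_ofPred_eq, not_or, not_lt, not_le] at h
  obtain ⟨h1, h2⟩ := hD.pos_succ Z n x
  rw [lett_of_phase_mem h.1 h.2, h1, h2]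

theorem Admissible.mem_labelled_b (hD : D.Admissible) {x : X} {n : ℕ} :
    (D.Zmap Z (n + 1)).symm x ∈ D.labelled n Symb.b ↔
      D.phase n (D.pos Z (n + 1) x) < D.q n := by
  rw [hD.mem_labelled, hD.getElem?_skeleton n (hD.pos_lt Z (n + 1) x), Option.some_inj]
  split_ifs with h1 h2
  · exact iff_of_true rfl h1
  · exact iff_of_false nofun h1
  · exact iff_of_false nofun h1

theorem Admissible.mem_labelled_e (hD : D.Admissible) {x : X} {n : ℕ} :
    (D.Zmap Z (n + 1)).symm x ∈ D.labelled n Symb.e ↔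
      D.l n * D.q n ≤ D.phase n (D.pos Z (n + 1) x) := by
  have : D.q n ≤ D.l n * D.q n := Nat.le_mul_of_pos_left _ (hD.l_pos n)
  rw [hD.mem_labelled, hD.getElem?_skeleton n (hD.pos_lt Z (n + 1) x), Option.some_inj]
  split_ifs with h1 h2
  · exact iff_of_false nofun (by omega)
  · exact iff_of_false nofun (by omega)
  · exact iff_of_true rfl (by omega)

theorem Admissible.mem_lastLabelled_b (hD : D.Admissible) {x : X} :
    x ∈ D.lastLabelled Z Symb.b ↔ ∃ n, D.phase n (D.pos Z (n + 1) x) < D.q n ∧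
      ∀ m, n < m → x ∉ D.spacerSet Z m := by
  refine exists_congr fun n => and_congr hD.mem_labelled_b (forall₂_congr fun m _ => ?_)
  rw [hD.mem_labelled_b, hD.mem_labelled_e, spacerSet, Set.mem_ofPred_eq, not_or]

theorem Admissible.mem_lastLabelled_e (hD : D.Admissible) {x : X} :
    x ∈ D.lastLabelled Z Symb.e ↔ ∃ n, D.l n * D.q n ≤ D.phase n (D.pos Z (n + 1) x) ∧
      ∀ m, n < m → x ∉ D.spacerSet Z m := by
  refine exists_congr fun n => and_congr hD.mem_labelled_e (forall₂_congr fun m _ => ?_)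
  rw [hD.mem_labelled_b, hD.mem_labelled_e, spacerSet, Set.mem_ofPred_eq, not_or]

/-- Descend from stage `n`. The first spacer level met is the last label of the point and also the
letter given by the recursion for `lett`; if none is met, the letter of the `0`-tower remains. -/
theorem Admissible.atomOf_eq (hD : D.Admissible) {x : X} {n : ℕ} (h : x ∉ D.lateSpacers Z n) :
    D.atomOf Z x = D.lett n (D.tow Z n x) (D.pos Z n x) := by
  have hlate : ∀ {n}, x ∉ D.lateSpacers Z n → ∀ m, n ≤ m → x ∉ D.spacerSet Z m :=
    fun h m hm hx => h (Set.mem_iUnion₂.mpr ⟨m, hm, hx⟩)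
  induction n with
  | zero =>
    have h1 : x ∉ D.lastLabelled Z Symb.b := by
      rw [hD.mem_lastLabelled_b]
      rintro ⟨n, hn, -⟩
      exact hlate h n (Nat.zero_le _) (Or.inl hn)
    have h2 : x ∉ D.lastLabelled Z Symb.e := by
      rw [hD.mem_lastLabelled_e]
      rintro ⟨n, hn, -⟩
      exact hlate h n (Nat.zero_le _) (Or.inr hn)
    rw [atomOf, if_neg h1, if_neg h2]
    rfl
  | succ n ih =>
    by_cases hn : x ∈ D.spacerSet Z n
    · by_cases hb : D.phase n (D.pos Z (n + 1) x) < D.q n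
      · have h1 : x ∈ D.lastLabelled Z Symb.b :=
          hD.mem_lastLabelled_b.mpr ⟨n, hb, fun m hm => hlate h m hm⟩
        rw [atomOf, if_pos h1, lett_of_phase_lt hb]
      · have he := hn.resolve_left hb
        have h1 : x ∉ D.lastLabelled Z Symb.b := by
          rw [hD.mem_lastLabelled_b]
          rintro ⟨j, hj, hj'⟩
          rcases lt_trichotomy j n with h3 | h3 | h3
          · exact hj' n h3 hn
          · exact hb (h3 ▸ hj)
          · exact hlate h j h3 (Or.inl hj)
        have h2 : x ∈ D.lastLabelled Z Symb.e :=
          hD.mem_lastLabelled_e.mpr ⟨n, he, fun m hm => hlate h m hm⟩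
        rw [atomOf, if_neg h1, if_pos h2, hD.lett_of_le_phase he]
    · rw [hD.lett_eq_of_notMem_spacerSet hn]
      refine ih fun hx => ?_
      obtain ⟨m, hm, hxm⟩ := Set.mem_iUnion₂.mp hx
      rcases Nat.lt_or_ge n m with h3 | h3
      · exact hlate h m h3 hxm
      · obtain rfl : m = n := by omega
        exact hn hxm

theorem Admissible.measurable_atomOf (hD : D.Admissible) : Measurable (D.atomOf Z) := by
  have hL : ∀ c, MeasurableSet (D.lastLabelled Z c) := by
    intro c
    have hl : ∀ n c, MeasurableSet {x | (D.Zmap Z (n + 1)).symm x ∈ D.labelled n c} := by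
      intro n c
      simp_rw [hD.mem_labelled]
      exact measurable_pos Z (n + 1) (t := {t | (D.skeleton n)[t]? = some c})
        (Set.to_countable _).measurableSet
    have : D.lastLabelled Z c = ⋃ n, ({x | (D.Zmap Z (n + 1)).symm x ∈ D.labelled n c} ∩
        ⋂ m, ⋂ _ : n < m, ({x | (D.Zmap Z (m + 1)).symm x ∈ D.labelled m Symb.b}ᶜ ∩
          {x | (D.Zmap Z (m + 1)).symm x ∈ D.labelled m Symb.e}ᶜ)) := by
      ext x
      simp only [lastLabelled, Set.mem_ofPred_eq, Set.mem_iUnion, Set.mem_inter_iff,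
        Set.mem_iInter, Set.mem_compl_iff]
    rw [this]
    exact MeasurableSet.iUnion fun n => (hl n c).inter (MeasurableSet.iInter fun m =>
      MeasurableSet.iInter fun _ => (hl m _).compl.inter (hl m _).compl)
  have htow : Measurable fun x => (Symb.letter ⌊(D.s 0 : ℝ) * ((Z.symm x).2 : ℝ)⌋₊ : Symb ℕ) :=
    (measurable_of_countable (fun j : ℕ => (Symb.letter j : Symb ℕ))).comp (measurable_tow Z 0)
  exact Measurable.ite (hL _) measurable_const (Measurable.ite (hL _) measurable_const htow)

theorem Admissible.measurable_name (hD : D.Admissible) {T : X ≃ᵐ X}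
    (hT : MeasurePreserving T μ μ) : Measurable (D.name Z T) :=
  measurable_pi_lambda _ fun i => hD.measurable_atomOf.comp (hT.zpow i).measurable

theorem name_apply (T : X ≃ᵐ X) (x : X) : D.name Z T (T x) = shift (D.name Z T x) := by
  funext i
  rw [name, shift, name, zpow_add_one]
  rfl

/-- Almost every point moves to the next level of its `n`-tower, unless it moves to a spacer of a
late stage. -/
theorem Admissible.ae_step (hD : D.Admissible) {T : X ≃ᵐ X}
    (hT : MeasurePreserving T μ μ) (hlim : D.IsLimit Z μ T) (n : ℕ) :
    ∀ᵐ x ∂μ, T x ∉ D.lateSpacers Z n →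
      D.pos Z n (T x) = (D.pos Z n x + 1) % D.q n ∧ D.tow Z n (T x) = D.tow Z n x := by
  have key : ∀ t σ, ∀ᵐ x ∂μ, D.pos Z n x = t → D.tow Z n x = σ → T x ∉ D.lateSpacers Z n →
      D.pos Z n (T x) = (D.pos Z n x + 1) % D.q n ∧ D.tow Z n (T x) = D.tow Z n x := by
    intro t σ
    -- For every `M ≥ n`, `T` maps the failing points of the level into `T(level)` but outside
    -- `T_M(level)`, since on that image `T_M` makes a proper step of the `n`-towers.
    refine le_antisymm (ge_of_tendsto (hlim (D.level Z n t σ) (measurableSet_level Z n t σ)) ?_) zero_le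
    filter_upwards [eventually_ge_atTop n] with M hM
    rw [← hT.measure_preimage_equiv
      (s := (D.approx Z M '' D.level Z n t σ) ∆ (T '' D.level Z n t σ))]
    refine measure_mono fun x hx => ?_
    rw [Set.mem_compl_iff, Set.mem_ofPred_eq] at hx
    push Not at hx
    obtain ⟨h1, h2, h3, h4⟩ := hx
    refine Or.inr ⟨⟨x, ⟨h1, h2⟩, rfl⟩, ?_⟩
    rintro ⟨z, ⟨hz1, hz2⟩, hz⟩
    obtain ⟨h5, h6⟩ := hD.col_approx Z M z
    rw [hz] at h5 h6
    obtain ⟨h7, h8⟩ := hD.step_of_step hM h3 h5 h6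
    rw [hz1, ← h1] at h7
    rw [hz2, ← h2] at h8
    exact h4 h7 h8
  have key' : ∀ᵐ x ∂μ, ∀ t σ, D.pos Z n x = t → D.tow Z n x = σ → T x ∉ D.lateSpacers Z n →
      D.pos Z n (T x) = (D.pos Z n x + 1) % D.q n ∧ D.tow Z n (T x) = D.tow Z n x :=
    ae_all_iff.mpr fun t => ae_all_iff.mpr fun σ => key t σ
  filter_upwards [key'] with x hx
  exact hx _ _ rfl rfl

/-- A segment has `2 * q n + 1 ≤ 3 * q n` points, so the exceptional sets have measure at most `3 *
2^(-n)` and Borel-Cantelli applies. -/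
theorem Admissible.ae_eventually_orbit_avoids (hD : D.Admissible)
    (hZ : MeasurePreserving Z lebesgue μ) {T : X ≃ᵐ X} (hT : MeasurePreserving T μ μ) :
    ∀ᵐ x ∂μ, ∀ᶠ n in atTop, ∀ i : ℤ, |i| ≤ D.q n →
      ((T.toEquiv : Equiv.Perm X) ^ i) x ∉ D.lateSpacers Z n := by
  set B : ℕ → Set X := fun n => ⋃ i ∈ Finset.Icc (-(D.q n : ℤ)) (D.q n),
    (fun x => ((T.toEquiv : Equiv.Perm X) ^ i) x) ⁻¹' D.lateSpacers Z n with hB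
  have hle : ∀ n, μ (B n) ≤ 3 * (2⁻¹ : ℝ≥0∞) ^ n := by
    intro n
    refine (measure_biUnion_finset_le _ _).trans ?_
    rw [Finset.sum_congr rfl (g := fun _ => μ (D.lateSpacers Z n)) fun i _ =>
      (hT.zpow i).measure_preimage (measurableSet_lateSpacers n).nullMeasurableSet,
      Finset.sum_const, nsmul_eq_mul, Int.card_Icc]
    have h1 : (((D.q n : ℤ) + 1 - -(D.q n : ℤ)).toNat : ℝ≥0∞) ≤ 3 * D.q n := by
      have := hD.q_pos n
      have h2 : ((D.q n : ℤ) + 1 - -(D.q n : ℤ)).toNat ≤ 3 * D.q n := by omega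
      exact_mod_cast h2
    calc _ ≤ 3 * D.q n * μ (D.lateSpacers Z n) := mul_le_mul_left h1 _
      _ = 3 * (D.q n * μ (D.lateSpacers Z n)) := mul_assoc _ _ _
      _ ≤ _ := mul_le_mul_right (hD.mul_measure_lateSpacers_le hZ n) _
  have hsum : ∑' n, μ (B n) ≠ ⊤ := by
    refine ne_top_of_le_ne_top ?_ (ENNReal.tsum_le_tsum hle)
    rw [ENNReal.tsum_mul_left, ENNReal.tsum_geometric, ENNReal.one_sub_inv_two, inv_inv]
    finiteness
  filter_upwards [ae_eventually_notMem hsum] with x hx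
  filter_upwards [hx] with n hn i hi hmem
  rw [abs_le] at hi
  exact hn (Set.mem_iUnion₂.mpr ⟨i, Finset.mem_Icc.mpr hi, hmem⟩)

/-- The name of almost every point is made of the words of its towers. -/
theorem Admissible.ae_isTypical_name (hD : D.Admissible) (hZ : MeasurePreserving Z lebesgue μ)
    {T : X ≃ᵐ X} (hT : MeasurePreserving T μ μ) (hlim : D.IsLimit Z μ T) :
    ∀ᵐ x ∂μ, D.IsTypical Z x (D.name Z T x) := by
  have hstep : ∀ᵐ x ∂μ, ∀ n, ∀ i : ℤ,
      T (((T.toEquiv : Equiv.Perm X) ^ i) x) ∉ D.lateSpacers Z n →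
      D.pos Z n (T (((T.toEquiv : Equiv.Perm X) ^ i) x))
        = (D.pos Z n (((T.toEquiv : Equiv.Perm X) ^ i) x) + 1) % D.q n ∧
      D.tow Z n (T (((T.toEquiv : Equiv.Perm X) ^ i) x))
        = D.tow Z n (((T.toEquiv : Equiv.Perm X) ^ i) x) :=
    ae_all_iff.mpr fun n => ae_all_iff.mpr fun i =>
      (hT.zpow i).quasiMeasurePreserving.ae (hD.ae_step hT hlim n)
  filter_upwards [hstep, hD.ae_eventually_orbit_avoids hZ hT, hD.ae_eventually_not_peripheral Z hZ]
    with x hx hav hper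
  filter_upwards [hav, hper] with n hn hnp
  refine ⟨hnp, ?_⟩
  have hq := hD.q_pos n
  set p := D.pos Z n x with hp
  have hplt : p < D.q n := hD.pos_lt Z n x
  set y : ℤ → X := fun i => ((T.toEquiv : Equiv.Perm X) ^ i) x with hy
  have hTy : ∀ i, T (y i) = y (i + 1) := fun i => by
    rw [hy]
    change _ = ((T.toEquiv : Equiv.Perm X) ^ (i + 1)) x
    rw [add_comm i 1, zpow_one_add]
    rfl
  have hyn : ∀ i : ℤ, |i| ≤ D.q n → y i ∉ D.lateSpacers Z n := hn
  have hchain : ∀ r : ℕ, r < D.q n →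
      D.pos Z n (y (-(p : ℤ) + r)) = (D.pos Z n (y (-(p : ℤ))) + r) % D.q n ∧
      D.tow Z n (y (-(p : ℤ) + r)) = D.tow Z n (y (-(p : ℤ))) := by
    intro r
    induction r with
    | zero =>
      intro _
      rw [Nat.cast_zero, add_zero, add_zero, Nat.mod_eq_of_lt (hD.pos_lt Z n _)]
      exact ⟨rfl, rfl⟩
    | succ r ih =>
      intro hr
      obtain ⟨h1, h2⟩ := ih (by omega)
      have h3 := hx n (-(p : ℤ) + r)
      change T (y _) ∉ _ → D.pos Z n (T (y _)) = (D.pos Z n (y _) + 1) % _ ∧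
        D.tow Z n (T (y _)) = D.tow Z n (y _) at h3
      rw [hTy, add_assoc] at h3
      obtain ⟨h4, h5⟩ := h3 (hyn _ (by rw [abs_le]; omega))
      rw [Nat.cast_succ]
      rw [h4, h5, h1, h2, Nat.mod_add_mod, ← add_assoc]
      exact ⟨rfl, rfl⟩
  have h0 := hchain p hplt
  rw [neg_add_cancel] at h0
  have hy0 : y 0 = x := rfl
  rw [hy0, ← hp] at h0
  -- After `p` steps modulo `q n` the level is `p`, so it was `0` at time `-p`: the segment runs
  -- through the whole tower.
  have hstart : D.pos Z n (y (-(p : ℤ))) = 0 := by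
    have h1 : D.pos Z n (y (-(p : ℤ))) + p ≡ 0 + p [MOD D.q n] := by
      rw [Nat.ModEq, ← h0.1, zero_add, Nat.mod_eq_of_lt hplt]
    have h2 := Nat.ModEq.add_right_cancel' p h1
    rwa [Nat.ModEq, Nat.zero_mod, Nat.mod_eq_of_lt (hD.pos_lt Z n _)] at h2
  intro r hr
  have h1 := hD.atomOf_eq (hyn (-(p : ℤ) + r) (by rw [abs_le]; omega))
  obtain ⟨h2, h3⟩ := hchain r hr
  rw [hstart, zero_add, Nat.mod_eq_of_lt hr] at h2
  rw [h2, h3, ← h0.2] at h1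
  exact h1

end AKData

/-! ### Measurable inverses and isomorphisms of systems -/

instance : StandardBorelSpace (Set.Ico (0 : ℝ) 1) := measurableSet_Ico.standardBorel

theorem MeasurableEquiv.standardBorelSpace {α β : Type*} [MeasurableSpace α] [MeasurableSpace β]
    [StandardBorelSpace α] (e : β ≃ᵐ α) : StandardBorelSpace β := by
  let := upgradeStandardBorel α
  let τ : TopologicalSpace β := TopologicalSpace.induced e inferInstance
  have hind : IsInducing e := ⟨rfl⟩
  have hp : PolishSpace β := (e.toEquiv.toHomeomorphOfIsInducing hind).isClosedEmbedding.polishSpace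
  refine ⟨τ, ⟨?_⟩, hp⟩
  rw [show borel β = MeasurableSpace.comap e (borel α) from borel_comap, ← BorelSpace.measurable_eq (α := α)]
  exact e.measurableEmbedding.comap_eq.symm

/-- By the Lusin-Souslin theorem an injective measurable map on a standard Borel set is a measurable
embedding, and its inverse extends measurably to all of `Y`. -/
theorem exists_measurable_leftInverse {X Y : Type*} [MeasurableSpace X] [StandardBorelSpace X]
    [Nonempty X] [MeasurableSpace Y] [MeasurableSpace.CountablySeparated Y] {f : X → Y}
    (hf : Measurable f) {A : Set X} (hA : MeasurableSet A) (hinj : Set.InjOn f A) :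
    ∃ g : Y → X, Measurable g ∧ ∀ x ∈ A, g (f x) = x := by
  have : StandardBorelSpace A := hA.standardBorel
  have hfe : MeasurableEmbedding fun x : A => f x :=
    (hf.comp measurable_subtype_coe).measurableEmbedding hinj.injective
  obtain ⟨g, hg, hgf⟩ := hfe.exists_measurable_extend measurable_subtype_coe fun _ => inferInstance
  exact ⟨g, hg, fun x hx => congrFun hgf ⟨x, hx⟩⟩

theorem MeasureTheory.MeasurePreserving.of_leftInverse {X Y : Type*} [MeasurableSpace X]
    [MeasurableSpace Y] {μ : Measure X} {ν : Measure Y} {f : X → Y} {g : Y → X}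
    (hf : MeasurePreserving f μ ν) (hg : Measurable g) (hgf : ∀ᵐ x ∂μ, g (f x) = x) :
    MeasurePreserving g ν μ := by
  refine ⟨hg, ?_⟩
  rw [← hf.map_eq, Measure.map_map hg hf.measurable]
  exact (Measure.map_congr hgf).trans Measure.map_id

theorem MeasureTheory.MeasurePreserving.ae_rightInverse {X Y : Type*} [MeasurableSpace X]
    [MeasurableSpace Y] [MeasurableEq Y] {μ : Measure X} {ν : Measure Y} {f : X → Y} {g : Y → X}
    (hf : MeasurePreserving f μ ν) (hg : Measurable g) (hgf : ∀ᵐ x ∂μ, g (f x) = x) :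
    ∀ᵐ y ∂ν, f (g y) = y := by
  have hm : MeasurableSet {y | f (g y) = y} :=
    measurableSet_eq_fun (hf.measurable.comp hg) measurable_id
  rw [← hf.map_eq, ae_map_iff hf.measurable.aemeasurable hm]
  filter_upwards [hgf] with x hx
  rw [hx]

/-- A measure preserving map with a measurable almost-everywhere left inverse that intertwines the
transformations is an isomorphism of systems. -/
theorem isSystemIso_of_leftInverse {X Y : Type*} [MeasurableSpace X] [MeasurableSpace Y]
    [MeasurableEq Y] {μ : Measure X} {ν : Measure Y} {T : X → X} {R : Y → Y} {f : X → Y} {g : Y → X}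
    (hf : MeasurePreserving f μ ν) (hfT : ∀ᵐ x ∂μ, f (T x) = R (f x)) (hg : Measurable g)
    (hgf : ∀ᵐ x ∂μ, g (f x) = x) : IsSystemIso μ T ν R f :=
  ⟨hf, hfT, g, hf.of_leftInverse hg hgf, hgf, hf.ae_rightInverse hg hgf⟩

/-- Ergodicity is transported by isomorphisms of systems. -/
theorem IsSystemIso.ergodic {X Y : Type*} [MeasurableSpace X] [MeasurableSpace Y]
    {μ : Measure X} {ν : Measure Y} {T : X → X} {R : Y → Y} {f : X → Y}
    (h : IsSystemIso μ T ν R f) (hT : MeasurePreserving T μ μ) (hR : Ergodic R ν) :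
    Ergodic T μ := by
  obtain ⟨hf, hfT, g, hg, hgf, -⟩ := h
  refine ⟨hT, ⟨fun {A} hA hinv => ?_⟩⟩
  have hpre : f ⁻¹' (g ⁻¹' A) =ᵐ[μ] A := by
    filter_upwards [hgf] with x hx
    apply propext
    change g (f x) ∈ A ↔ x ∈ A
    rw [hx]
  -- The intertwining relation holds only almost everywhere, so the transported set is only almost
  -- invariant.
  have hC : R ⁻¹' (g ⁻¹' A) =ᵐ[ν] g ⁻¹' A := by
    have hm : MeasurableSet (g ⁻¹' A) := hg.measurable hA
    have hm' : MeasurableSet (R ⁻¹' (g ⁻¹' A)) := hR.measurable hm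
    rw [← measure_symmDiff_eq_zero_iff,
      ← hf.measure_preimage (hm'.symmDiff hm).nullMeasurableSet, Set.preimage_symmDiff,
      measure_symmDiff_eq_zero_iff]
    refine EventuallyEq.trans ?_ hpre.symm
    filter_upwards [hfT, hT.quasiMeasurePreserving.ae hgf] with x hx hx'
    apply propext
    change g (R (f x)) ∈ A ↔ x ∈ A
    rw [← hx, hx']
    exact Set.ext_iff.mp hinv x
  rw [eventuallyConst_set']
  rcases hR.quasiErgodic.ae_mem_or_ae_notMem₀ (hg.measurable hA).nullMeasurableSet hC with h1 | h1
  · right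
    refine hpre.symm.trans ?_
    exact eventuallyEq_univ.mpr (hf.quasiMeasurePreserving.ae h1)
  · left
    refine hpre.symm.trans ?_
    exact eventuallyEq_empty.mpr (hf.quasiMeasurePreserving.ae h1)

namespace AKData

variable {D : AKData} {X : Type u} [MeasurableSpace X] {Z : UnitSquare ≃ᵐ X} {μ : Measure X}
  {T : X ≃ᵐ X}

/-! ### The name map as an isomorphism -/

theorem Admissible.ae_block_name (hD : D.Admissible) (hZ : MeasurePreserving Z lebesgue μ)
    (hT : MeasurePreserving T μ μ) (hlim : D.IsLimit Z μ T) :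
    ∀ᵐ x ∂μ, ∀ᶠ n in atTop, ∀ i < D.q n, ∀ σ < D.s n, x ∈ D.Zmap Z n '' D.R n i σ →
      block (D.name Z T x) (-(dynIndex (D.p n) (D.q n) i : ℤ)) (D.q n) = D.towerWord n σ := by
  filter_upwards [hD.ae_isTypical_name hZ hT hlim] with x hx
  filter_upwards [hx] with n hn i hi σ _ hxi
  obtain ⟨h1, h2⟩ := (hD.mem_image_R Z n x hi).mp hxi
  rw [hD.block_eq_towerWord, ← h1, ← h2]
  exact hn.2

/-- A measurable set of full measure on which the name map is well-behaved. -/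
theorem Admissible.exists_typical_set (hD : D.Admissible) (hZ : MeasurePreserving Z lebesgue μ)
    (hT : MeasurePreserving T μ μ) (hlim : D.IsLimit Z μ T) :
    ∃ X₀ : Set X, MeasurableSet X₀ ∧ μ X₀ᶜ = 0 ∧ ∀ x ∈ X₀, D.IsTypical Z x (D.name Z T x) ∧
      D.name Z T x = D.limName Z x := by
  have h : ∀ᵐ x ∂μ, D.IsTypical Z x (D.name Z T x) ∧ D.name Z T x = D.limName Z x := by
    filter_upwards [hD.ae_isTypical_name hZ hT hlim, hD.ae_isTypical_limName Z hZ] with x h1 h2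
    exact ⟨h1, Admissible.IsTypical.ext Z hD h1 h2⟩
  obtain ⟨t, ht, htm, ht0⟩ := exists_measurable_superset_of_null h
  refine ⟨tᶜ, htm.compl, by rwa [compl_compl], fun x hx => ?_⟩
  by_contra hn
  exact hx (ht hn)

/-- Both `name` and `limName` are typical for almost every point, and a point has only one typical
sequence, so they have the same law. -/
theorem Admissible.measurePreserving_name (hD : D.Admissible) (hZ : MeasurePreserving Z lebesgue μ)
    (hT : MeasurePreserving T μ μ) (hlim : D.IsLimit Z μ T) :
    MeasurePreserving (D.name Z T) μ D.nameLaw := by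
  obtain ⟨X₀, -, h0, h⟩ := hD.exists_typical_set hZ hT hlim
  have hae : D.name Z T =ᵐ[μ] D.limName Z := by
    have : ∀ᵐ x ∂μ, x ∈ X₀ := h0
    filter_upwards [this] with x hx
    exact (h x hx).2
  refine ⟨hD.measurable_name hT, ?_⟩
  rw [Measure.map_congr hae]
  exact (measurePreserving_limName hZ).map_eq

theorem Admissible.exists_embedding_set (hD : D.Admissible) (hZ : MeasurePreserving Z lebesgue μ)
    (hT : MeasurePreserving T μ μ) (hlim : D.IsLimit Z μ T) :
    ∃ X₀ : Set X, MeasurableSet X₀ ∧ μ X₀ᶜ = 0 ∧ Set.InjOn (D.name Z T) X₀ ∧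
      Set.MapsTo (D.name Z T) X₀ (coreSet D.words) ∧
      MeasurableSet (D.name Z T '' X₀) ∧ D.nameLaw (D.name Z T '' X₀)ᶜ = 0 := by
  have : StandardBorelSpace X := Z.symm.standardBorelSpace
  obtain ⟨X₀, hm, h0, h⟩ := hD.exists_typical_set hZ hT hlim
  have hinj : Set.InjOn (D.name Z T) X₀ := fun x hx x' hx' hxx =>
    Admissible.IsTypical.injective Z hD (h x hx).1 (hxx ▸ (h x' hx').1)
  have himg := hm.image_of_measurable_injOn (hD.measurable_name hT) hinj
  refine ⟨X₀, hm, h0, hinj, fun x hx => Admissible.IsTypical.mem_coreSet Z hD (h x hx).1, himg, ?_⟩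
  rw [← (hD.measurePreserving_name hZ hT hlim).measure_preimage himg.compl.nullMeasurableSet]
  exact measure_mono_null (fun x hx hx' => hx ⟨x, hx', rfl⟩) h0

theorem Admissible.isSystemIso_name (hD : D.Admissible) (hZ : MeasurePreserving Z lebesgue μ)
    (hT : MeasurePreserving T μ μ) (hlim : D.IsLimit Z μ T) :
    IsSystemIso μ T D.nameLaw shift (D.name Z T) := by
  have : StandardBorelSpace X := Z.symm.standardBorelSpace
  have : Nonempty X := ⟨Z (⟨0, by norm_num⟩, ⟨0, by norm_num⟩)⟩
  obtain ⟨X₀, hm, h0, hinj, -⟩ := hD.exists_embedding_set hZ hT hlim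
  obtain ⟨g, hg, hgf⟩ := exists_measurable_leftInverse (hD.measurable_name hT) hm hinj
  have hX₀ : ∀ᵐ x ∂μ, x ∈ X₀ := h0
  exact isSystemIso_of_leftInverse (hD.measurePreserving_name hZ hT hlim)
    (Eventually.of_forall (name_apply T)) hg (hX₀.mono hgf)

/-- The limit of the periodic names intertwines the shift with every limit of the `T_n`. -/
theorem Admissible.ae_limName_apply (hD : D.Admissible) (hZ : MeasurePreserving Z lebesgue μ)
    {τ : X → X} (hτ : MeasurePreserving τ μ μ)
    (hlim : ∀ C, MeasurableSet C →
      Tendsto (fun n => μ (D.approx Z n ⁻¹' C \ τ ⁻¹' C)) atTop (𝓝 0)) :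
    ∀ᵐ x ∂μ, D.limName Z (τ x) = shift (D.limName Z x) := by
  have hstep : ∀ n t σ, ∀ᵐ x ∂μ, D.pos Z n x = t → D.tow Z n x = σ → τ x ∉ D.lateSpacers Z n →
      D.pos Z n (τ x) = (D.pos Z n x + 1) % D.q n ∧ D.tow Z n (τ x) = D.tow Z n x := by
    intro n t σ
    -- For `M ≥ n`, `T_M x` lies in `C` whether it makes a proper step or lands in a late spacer.
    -- Failing points thus have `τ x ∉ C`, and convergence of preimages suffices, without an inverse
    -- of `τ`.
    set C : Set X := D.level Z n ((t + 1) % D.q n) σ ∪ D.lateSpacers Z n with hC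
    refine le_antisymm (ge_of_tendsto (hlim C ((measurableSet_level Z n _ σ).union
      (measurableSet_lateSpacers n))) ?_) zero_le
    filter_upwards [eventually_ge_atTop n] with M hM
    refine measure_mono fun x hx => ?_
    rw [Set.mem_compl_iff, Set.mem_ofPred_eq] at hx
    push Not at hx
    obtain ⟨rfl, rfl, h3, h4⟩ := hx
    constructor
    · by_cases hl : D.approx Z M x ∈ D.lateSpacers Z n
      · exact Or.inr hl
      · obtain ⟨h5, h6⟩ := hD.col_approx Z M x
        exact Or.inl (hD.step_of_step hM hl h5 h6)
    · rintro (h5 | h5)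
      · exact h4 h5.1 h5.2
      · exact h3 h5
  have hstep' : ∀ᵐ x ∂μ, ∀ n t σ, D.pos Z n x = t → D.tow Z n x = σ → τ x ∉ D.lateSpacers Z n →
      D.pos Z n (τ x) = (D.pos Z n x + 1) % D.q n ∧ D.tow Z n (τ x) = D.tow Z n x :=
    ae_all_iff.mpr fun n => ae_all_iff.mpr fun t => ae_all_iff.mpr fun σ => hstep n t σ
  have hsum : ∑' n, μ (D.lateSpacers Z n) ≠ ⊤ := by
    refine ne_top_of_le_ne_top (b := ∑' n : ℕ, (2⁻¹ : ℝ≥0∞) ^ n) ?_ (ENNReal.tsum_le_tsum fun n => ?_)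
    · rw [ENNReal.tsum_geometric, ENNReal.one_sub_inv_two, inv_inv]
      finiteness
    · refine le_trans ?_ (hD.mul_measure_lateSpacers_le hZ n)
      exact le_mul_of_one_le_left zero_le (by exact_mod_cast hD.q_pos n)
  have hlate : ∀ᵐ x ∂μ, ∀ᶠ n in atTop, x ∉ D.lateSpacers Z n := ae_eventually_notMem hsum
  filter_upwards [hstep', hτ.quasiMeasurePreserving.ae hlate, hD.ae_isTypical_limName Z hZ]
    with x h1 h2 h3
  funext m
  refine limName_eq Z ?_
  filter_upwards [h2, Admissible.IsTypical.eventually_window Z hD h3 (m + 1).natAbs] with n hn hw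
  obtain ⟨h4, h5⟩ := h1 n _ _ rfl rfl hn
  rw [h4, h5, ← shift_perWord, shift, shift]
  exact hw (m + 1) (Int.abs_eq_natAbs _).le

theorem Admissible.exists_limName_leftInverse (hD : D.Admissible)
    (hZ : MeasurePreserving Z lebesgue μ) :
    ∃ g : (ℤ → Symb ℕ) → X, Measurable g ∧ ∀ᵐ x ∂μ, g (D.limName Z x) = x := by
  have : StandardBorelSpace X := Z.symm.standardBorelSpace
  have : Nonempty X := ⟨Z (⟨0, by norm_num⟩, ⟨0, by norm_num⟩)⟩
  obtain ⟨t, ht, htm, ht0⟩ := exists_measurable_superset_of_null (hD.ae_isTypical_limName Z hZ)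
  have htyp : ∀ x ∈ tᶜ, D.IsTypical Z x (D.limName Z x) := fun x hx => by
    by_contra h
    exact hx (ht h)
  obtain ⟨g, hg, hgf⟩ := exists_measurable_leftInverse (measurable_limName (D := D) Z) htm.compl
    (fun x hx x' hx' h => Admissible.IsTypical.injective Z hD (htyp x hx) (h ▸ htyp x' hx'))
  have hae : ∀ᵐ x ∂μ, x ∈ tᶜ := by
    change μ tᶜᶜ = 0
    rwa [compl_compl]
  exact ⟨g, hg, hae.mono hgf⟩

end AKData

/-! ### Area preserving polar coordinates -/

/-- The point `e^{2πia}` of the unit circle. -/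
noncomputable def circlePoint (a : ℝ) : ℂ := Complex.exp (2 * Real.pi * Complex.I * (a : ℂ))

theorem continuous_circlePoint : Continuous circlePoint := by
  unfold circlePoint
  fun_prop

theorem circlePoint_add (a b : ℝ) : circlePoint (a + b) = circlePoint a * circlePoint b := by
  rw [circlePoint, circlePoint, circlePoint, ← Complex.exp_add]
  congr 1
  push_cast
  ring

theorem circlePoint_intCast (m : ℤ) : circlePoint m = 1 := by
  rw [circlePoint, Complex.exp_eq_one_iff]
  exact ⟨m, by push_cast; ring⟩

theorem circlePoint_fract (a : ℝ) : circlePoint (Int.fract a) = circlePoint a := by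
  conv_rhs => rw [← Int.fract_add_floor a, circlePoint_add, circlePoint_intCast, mul_one]

theorem norm_circlePoint (a : ℝ) : ‖circlePoint a‖ = 1 := by
  rw [circlePoint, show (2 * Real.pi * Complex.I * (a : ℂ) : ℂ) =
    ((2 * Real.pi * a : ℝ) : ℂ) * Complex.I by push_cast; ring]
  exact Complex.norm_exp_ofReal_mul_I _

theorem polar_eq (z : UnitSquare) :
    polar z = (Real.sqrt (z.2 : ℝ) : ℂ) * circlePoint (z.1 : ℝ) := rfl

theorem rotC_eq (α : ℝ) (w : ℂ) : rotC α w = circlePoint α * w := rfl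

theorem polar_rot (α : ℝ) (z : UnitSquare) : polar (rot α z) = rotC α (polar z) := by
  rw [polar_eq, polar_eq, rotC_eq]
  change (Real.sqrt (z.2 : ℝ) : ℂ) * circlePoint (Int.fract ((z.1 : ℝ) + α)) = _
  rw [circlePoint_fract, circlePoint_add]
  ring

theorem continuous_polar : Continuous polar := by
  unfold polar
  fun_prop

theorem norm_polar_sq (z : UnitSquare) : ‖polar z‖ ^ 2 = z.2 := by
  rw [polar_eq, norm_mul, norm_circlePoint, mul_one, Complex.norm_real, Real.norm_eq_abs, sq_abs,
    Real.sq_sqrt z.2.2.1]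

theorem circlePoint_injOn : Set.InjOn circlePoint (Set.Ico 0 1) := by
  intro a ha b hb h
  rw [circlePoint, circlePoint, Complex.exp_eq_exp_iff_exists_int] at h
  obtain ⟨m, hm⟩ := h
  have h2 : (2 * Real.pi * Complex.I : ℂ) ≠ 0 := Complex.two_pi_I_ne_zero
  have h3 : (a : ℂ) = (b : ℂ) + m := by
    apply mul_left_cancel₀ h2
    rw [hm]
    ring
  have h4 : a = b + m := by exact_mod_cast h3
  have h5 : (-1 : ℝ) < m := by linarith [ha.1, hb.2]
  have h6 : (m : ℝ) < 1 := by linarith [ha.2, hb.1]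
  have h7 : -1 < m := by exact_mod_cast h5
  have h8 : m < 1 := by exact_mod_cast h6
  obtain rfl : m = 0 := by omega
  simpa using h4

theorem polar_injective {z z' : UnitSquare} (h0 : (z.2 : ℝ) ≠ 0) (h : polar z = polar z') :
    z = z' := by
  have h2 : (z.2 : ℝ) = z'.2 := by rw [← norm_polar_sq, ← norm_polar_sq, h]
  rw [polar_eq, polar_eq, ← h2] at h
  have h3 : (Real.sqrt (z.2 : ℝ) : ℂ) ≠ 0 := by
    rw [Complex.ofReal_ne_zero]
    exact (Real.sqrt_pos.mpr (lt_of_le_of_ne z.2.2.1 h0.symm)).ne'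
  exact Prod.ext (Subtype.ext (circlePoint_injOn z.1.2 z'.1.2 (mul_left_cancel₀ h3 h)))
    (Subtype.ext h2)

/-- Periodicity moves the interval from `-π` to `0`, and scaling by `2π` does the rest. -/
theorem lintegral_circlePoint {f : ℂ → ℝ≥0∞} :
    ∫⁻ θ in Set.Ioo (-Real.pi) Real.pi, f (Complex.cos θ + Complex.sin θ * Complex.I)
      = ENNReal.ofReal (2 * Real.pi) * ∫⁻ a in Set.Ico (0 : ℝ) 1, f (circlePoint a) := by
  have hpi := Real.pi_pos
  have hT : (0 : ℝ) < 2 * Real.pi := by positivity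
  set F : ℝ → ℝ≥0∞ := fun θ => f (circlePoint (θ / (2 * Real.pi))) with hF
  have hcs : ∀ θ : ℝ, Complex.cos θ + Complex.sin θ * Complex.I = circlePoint (θ / (2 * Real.pi)) := by
    intro θ
    rw [← Complex.exp_mul_I, circlePoint]
    congr 1
    have : (Real.pi : ℂ) ≠ 0 := by exact_mod_cast hpi.ne'
    push_cast
    field_simp
  have h1 : ∫⁻ θ in Set.Ioo (-Real.pi) Real.pi, f (Complex.cos θ + Complex.sin θ * Complex.I)
      = ∫⁻ θ in Set.Ioc (-Real.pi) (-Real.pi + 2 * Real.pi), F θ := by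
    rw [show -Real.pi + 2 * Real.pi = Real.pi by ring, setLIntegral_congr Ioo_ae_eq_Ioc]
    simp_rw [hcs]
    rfl
  have h2 : ∫⁻ θ in Set.Ioc (-Real.pi) (-Real.pi + 2 * Real.pi), F θ =
      ∫⁻ θ in Set.Ioc 0 (0 + 2 * Real.pi), F θ := by
    refine IsAddFundamentalDomain.setLIntegral_eq (G := AddSubgroup.zmultiples (2 * Real.pi))
      (isAddFundamentalDomain_Ioc hT _) (isAddFundamentalDomain_Ioc hT _) F ?_
    rintro ⟨_, m, rfl⟩ θ
    change f (circlePoint ((m • (2 * Real.pi) + θ) / (2 * Real.pi))) = f (circlePoint _)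
    rw [add_div, zsmul_eq_mul, mul_div_cancel_right₀ _ hT.ne', circlePoint_add,
      circlePoint_intCast, one_mul]
  have himg : (fun a : ℝ => 2 * Real.pi * a) '' Set.Ioc 0 1 = Set.Ioc 0 (0 + 2 * Real.pi) := by
    rw [Set.image_mul_left_Ioc hT]
    simp
  rw [h1, h2, ← himg, lintegral_image_eq_lintegral_abs_deriv_mul (f' := fun _ => 2 * Real.pi)
    measurableSet_Ioc (fun x _ => ?_) (fun x _ y _ hxy => mul_left_cancel₀ hT.ne' hxy),
    abs_of_pos hT, lintegral_const_mul' _ _ ENNReal.ofReal_ne_top,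
    setLIntegral_congr (Ioc_ae_eq_Icc.trans Ico_ae_eq_Icc.symm)]
  · congr 1
    refine lintegral_congr fun a => ?_
    rw [hF]
    dsimp only
    rw [mul_div_cancel_left₀ _ hT.ne']
  · simpa using ((hasDerivAt_id x).const_mul (2 * Real.pi)).hasDerivWithinAt

/-- Substitution `y = r ^ 2`. -/
theorem lintegral_sqrt (G : ℝ → ℝ≥0∞) :
    ∫⁻ y in Set.Ico (0 : ℝ) 1, G (Real.sqrt y)
      = ∫⁻ r in Set.Ioc (0 : ℝ) 1, ENNReal.ofReal (2 * r) * G r := by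
  have himg : (fun r : ℝ => r ^ 2) '' Set.Ioc 0 1 = Set.Ioc 0 1 := by
    ext y
    constructor
    · rintro ⟨r, hr, rfl⟩
      exact ⟨by have := hr.1; positivity, by
        change r ^ 2 ≤ 1
        nlinarith [hr.1, hr.2]⟩
    · intro hy
      exact ⟨Real.sqrt y, ⟨Real.sqrt_pos.mpr hy.1, Real.sqrt_le_one.mpr hy.2⟩, Real.sq_sqrt hy.1.le⟩
  rw [setLIntegral_congr (Ico_ae_eq_Icc.trans Ioc_ae_eq_Icc.symm), ← himg,
    lintegral_image_eq_lintegral_abs_deriv_mul (f' := fun r => 2 * r) measurableSet_Ioc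
      (fun x _ => ?_) ?_, himg]
  · refine setLIntegral_congr_fun measurableSet_Ioc fun r hr => ?_
    have h := hr.1
    change ENNReal.ofReal |2 * r| * G (Real.sqrt (r ^ 2)) = _
    rw [Real.sqrt_sq h.le, abs_of_pos (by positivity)]
  · intro r hr r' hr' h
    exact (pow_left_inj₀ hr.1.le hr'.1.le two_ne_zero).mp h
  · simpa using (hasDerivAt_pow 2 x).hasDerivWithinAt

/-- On both sides integrate over the angle first. The densities in the radius agree: `2 r` from `y =
r ^ 2`, and `r * 2π / π` from normalized area. -/
theorem measurePreserving_polar : MeasurePreserving polar lebesgue diskMeasure := by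
  refine ⟨continuous_polar.measurable, Measure.ext_of_lintegral _ fun f hf => ?_⟩
  set F : ℝ → ℝ → ℝ≥0∞ := fun a r => f ((r : ℂ) * circlePoint a) with hF
  have hFm : Measurable (Function.uncurry F) := by
    have : Continuous fun z : ℝ × ℝ => (z.2 : ℂ) * circlePoint z.1 :=
      (Complex.continuous_ofReal.comp continuous_snd).mul
        (continuous_circlePoint.comp continuous_fst)
    exact hf.comp this.measurable
  have hL : ∫⁻ w, f w ∂(Measure.map polar lebesgue)
      = ∫⁻ r in Set.Ioc (0 : ℝ) 1, ENNReal.ofReal (2 * r) * ∫⁻ a in Set.Ico (0 : ℝ) 1, F a r := by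
    rw [lintegral_map hf continuous_polar.measurable, lebesgue,
      lintegral_prod (fun z : UnitSquare => f (polar z))
        (hf.comp continuous_polar.measurable).aemeasurable,
      lintegral_lintegral_swap (f := fun x y => f (polar (x, y))) (hf.comp continuous_polar.measurable).aemeasurable]
    change ∫⁻ y : Set.Ico (0 : ℝ) 1, ∫⁻ x : Set.Ico (0 : ℝ) 1,
      F (x : ℝ) (Real.sqrt (y : ℝ)) ∂_ ∂_ = _
    rw [lintegral_congr fun y : Set.Ico (0 : ℝ) 1 => lintegral_subtype_comap
      (measurableSet_Ico (a := (0 : ℝ)) (b := 1)) (fun x => F x (Real.sqrt (y : ℝ))),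
      lintegral_subtype_comap (measurableSet_Ico (a := (0 : ℝ)) (b := 1))
      (fun y => ∫⁻ x in Set.Ico (0 : ℝ) 1, F x (Real.sqrt y))]
    exact lintegral_sqrt fun r => ∫⁻ a in Set.Ico (0 : ℝ) 1, F a r
  have hR : ∫⁻ w, f w ∂diskMeasure = (ENNReal.ofReal Real.pi)⁻¹ *
      ∫⁻ r in Set.Ioc (0 : ℝ) 1, ENNReal.ofReal r *
        (ENNReal.ofReal (2 * Real.pi) * ∫⁻ a in Set.Ico (0 : ℝ) 1, F a r) := by
    rw [diskMeasure, lintegral_smul_measure, smul_eq_mul]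
    congr 1
    rw [← lintegral_indicator Metric.isClosed_closedBall.measurableSet,
      ← Complex.lintegral_comp_polarCoord_symm, polarCoord_target, Measure.volume_eq_prod,
      ← Measure.prod_restrict, lintegral_prod]
    · have h1 : ∀ r ∈ Set.Ioi (0 : ℝ), ∫⁻ θ in Set.Ioo (-Real.pi) Real.pi,
          ENNReal.ofReal (r, θ).1 • (Metric.closedBall (0 : ℂ) 1).indicator f
            (Complex.polarCoord.symm (r, θ)) = (Set.Ioc (0 : ℝ) 1).indicator (fun r =>
          ENNReal.ofReal r *
            (ENNReal.ofReal (2 * Real.pi) * ∫⁻ a in Set.Ico (0 : ℝ) 1, F a r)) r := by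
        intro r hr
        have hr0 : (0 : ℝ) < r := hr
        have hn : ∀ θ : ℝ, ‖Complex.polarCoord.symm (r, θ)‖ = r := fun θ => by
          rw [Complex.norm_polarCoord_symm, abs_of_pos hr0]
        by_cases hr1 : r ≤ 1
        · rw [Set.indicator_of_mem (show r ∈ Set.Ioc (0 : ℝ) 1 from ⟨hr0, hr1⟩),
            ← lintegral_circlePoint (f := fun w => f ((r : ℂ) * w)),
            ← lintegral_const_mul' _ _ ENNReal.ofReal_ne_top]
          refine lintegral_congr fun θ => ?_
          rw [Set.indicator_of_mem (by rw [mem_closedBall_zero_iff, hn]; exact hr1),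
            Complex.polarCoord_symm_apply, smul_eq_mul, Complex.ofReal_cos, Complex.ofReal_sin]
        · rw [Set.indicator_of_notMem (fun h => hr1 h.2)]
          refine (lintegral_congr fun θ => ?_).trans lintegral_zero
          rw [Set.indicator_of_notMem (by rw [mem_closedBall_zero_iff, hn]; exact hr1), smul_zero]
      rw [setLIntegral_congr_fun measurableSet_Ioi h1, lintegral_indicator measurableSet_Ioc,
        Measure.restrict_restrict measurableSet_Ioc,
        Set.inter_eq_left.mpr (show Set.Ioc (0 : ℝ) 1 ⊆ Set.Ioi 0 from fun r hr => hr.1)]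
    · have hm : Measurable (Complex.polarCoord.symm : ℝ × ℝ → ℂ) := by
        have : (Complex.polarCoord.symm : ℝ × ℝ → ℂ) = fun p =>
            (p.1 : ℂ) * ((Real.cos p.2 : ℂ) + (Real.sin p.2 : ℂ) * Complex.I) :=
          funext Complex.polarCoord_symm_apply
        rw [this]
        fun_prop
      exact ((ENNReal.measurable_ofReal.comp measurable_fst).smul
        ((hf.indicator Metric.isClosed_closedBall.measurableSet).comp hm)).aemeasurable
  rw [hL, hR, ← lintegral_const_mul' _ _
    (ENNReal.inv_ne_top.mpr (ENNReal.ofReal_pos.mpr Real.pi_pos).ne')]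
  refine setLIntegral_congr_fun measurableSet_Ioc fun r hr => ?_
  rw [ENNReal.ofReal_mul (by norm_num), ENNReal.ofReal_mul (by norm_num)]
  have h1 : (ENNReal.ofReal Real.pi)⁻¹ * ENNReal.ofReal Real.pi = 1 :=
    ENNReal.inv_mul_cancel (ENNReal.ofReal_pos.mpr Real.pi_pos).ne' ENNReal.ofReal_ne_top
  calc _ = ((ENNReal.ofReal Real.pi)⁻¹ * ENNReal.ofReal Real.pi) * (ENNReal.ofReal 2 *
        ENNReal.ofReal r * ∫⁻ a in Set.Ico (0 : ℝ) 1, F a r) := by rw [h1, one_mul]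
    _ = _ := by ring

instance : IsProbabilityMeasure diskMeasure := by
  rw [← measurePreserving_polar.map_eq]
  exact Measure.isProbabilityMeasure_map continuous_polar.measurable.aemeasurable

theorem measurePreserving_rotC (α : ℝ) : MeasurePreserving (rotC α) diskMeasure diskMeasure := by
  have hc : circlePoint α ∈ Submonoid.unitSphere ℂ :=
    mem_sphere_zero_iff_norm.mpr (norm_circlePoint α)
  have h1 : MeasurePreserving (rotC α) volume volume :=
    (rotation ⟨circlePoint α, hc⟩).measurePreserving
  have h2 := h1.restrict_preimage (Metric.isClosed_closedBall (x := (0 : ℂ)) (ε := 1)).measurableSet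
  have h3 : rotC α ⁻¹' Metric.closedBall 0 1 = Metric.closedBall 0 1 := by
    ext w
    rw [Set.mem_preimage, mem_closedBall_zero_iff, mem_closedBall_zero_iff, rotC_eq, norm_mul,
      norm_circlePoint, one_mul]
  rw [h3] at h2
  exact h2.smul_measure _

theorem measurableSet_snd_ne_zero : MeasurableSet {z : UnitSquare | (z.2 : ℝ) ≠ 0} :=
  (measurable_subtype_coe.comp measurable_snd) (measurableSet_singleton (0 : ℝ)).compl

theorem ae_snd_ne_zero : ∀ᵐ z ∂lebesgue, (z.2 : ℝ) ≠ 0 := by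
  have h : diskMeasure {0} = 0 := by
    rw [diskMeasure, Measure.smul_apply, smul_eq_mul,
      measure_mono_null (le_refl _) (Measure.restrict_apply_le _ _ |>.trans_eq (measure_singleton _)
        |>.antisymm zero_le), mul_zero]
  rw [← measurePreserving_polar.measure_preimage (measurableSet_singleton _).nullMeasurableSet] at h
  refine measure_mono_null (fun z hz => ?_) h
  rw [Set.mem_compl_iff, Set.mem_ofPred_eq, not_not] at hz
  rw [Set.mem_preimage, Set.mem_singleton_iff, ← norm_eq_zero, ← sq_eq_zero_iff, norm_polar_sq, hz]

theorem measurable_rot (α : ℝ) : Measurable (rot α) := by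
  refine Measurable.prodMk (Measurable.subtype_mk ?_) measurable_snd
  exact measurable_fract.comp
    ((measurable_subtype_coe.comp measurable_fst).add_const α)

/-- Up to a null set `polar` conjugates `rot` to a rotation of the plane, which is a linear
isometry. -/
theorem measurePreserving_rot (α : ℝ) : MeasurePreserving (rot α) lebesgue lebesgue := by
  have : Nonempty UnitSquare := ⟨(⟨0, by norm_num⟩, ⟨0, by norm_num⟩)⟩
  obtain ⟨κ, hκ, hκp⟩ := exists_measurable_leftInverse continuous_polar.measurable
    measurableSet_snd_ne_zero fun z hz z' _ h => polar_injective hz h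
  have h1 := measurePreserving_polar.of_leftInverse hκ (ae_snd_ne_zero.mono hκp)
  refine ⟨measurable_rot α, ?_⟩
  rw [Measure.map_congr (g := κ ∘ rotC α ∘ polar)]
  · exact (h1.comp ((measurePreserving_rotC α).comp measurePreserving_polar)).map_eq
  · filter_upwards [ae_snd_ne_zero] with z hz
    rw [Function.comp_apply, Function.comp_apply, ← polar_rot]
    exact (hκp (rot α z) hz).symm

namespace AKData

variable {D : AKData} {g : ℕ → (ℂ ≃ ℂ)} {S : ℂ → ℂ}

/-! ### The smooth approximations and their limit on the disk -/

theorem IsDiskRealization.norm_le_one_iff (hS : D.IsDiskRealization g S) (n : ℕ) (w : ℂ) :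
    ‖g n w‖ ≤ 1 ↔ ‖w‖ ≤ 1 := by
  obtain ⟨δ, hδ, h⟩ := hS.boundary n
  have h1 : ∀ w : ℂ, 1 < ‖w‖ → g n w = w := fun w hw => h w (Or.inr (by linarith))
  by_cases hw : ‖w‖ ≤ 1
  · refine iff_of_true (not_lt.mp fun hgw => ?_) hw
    rw [(g n).injective (h1 _ hgw)] at hgw
    exact absurd hw (not_le.mpr hgw)
  · rw [h1 w (not_le.mp hw)]

theorem IsDiskRealization.measurePreserving_disk (hS : D.IsDiskRealization g S) (n : ℕ) :
    MeasurePreserving (g n) diskMeasure diskMeasure := by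
  have h2 := (hS.areaPreserving n).restrict_preimage
    (Metric.isClosed_closedBall (x := (0 : ℂ)) (ε := 1)).measurableSet
  have h3 : g n ⁻¹' Metric.closedBall 0 1 = Metric.closedBall 0 1 := by
    ext w
    rw [Set.mem_preimage, mem_closedBall_zero_iff, mem_closedBall_zero_iff, hS.norm_le_one_iff]
  rw [h3] at h2
  exact h2.smul_measure _

theorem IsDiskRealization.continuous_composed (hS : D.IsDiskRealization g S) (n : ℕ) :
    Continuous (composed g n) ∧ Continuous (composed g n).symm := by
  induction n with
  | zero => exact ⟨continuous_id, continuous_id⟩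
  | succ n ih =>
    exact ⟨ih.1.comp (hS.smooth n).1.continuous, (hS.smooth n).2.continuous.comp ih.2⟩

theorem IsDiskRealization.measurePreserving_composed (hS : D.IsDiskRealization g S) (n : ℕ) :
    MeasurePreserving (composed g n) diskMeasure diskMeasure ∧
      MeasurePreserving (composed g n).symm diskMeasure diskMeasure := by
  have h1 : MeasurePreserving (composed g n) diskMeasure diskMeasure := by
    induction n with
    | zero => exact MeasurePreserving.id _
    | succ n ih => exact ih.comp (hS.measurePreserving_disk n)
  exact ⟨h1, h1.of_leftInverse (hS.continuous_composed n).2.measurable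
    (Eventually.of_forall (composed g n).symm_apply_apply)⟩

theorem IsDiskRealization.continuous_smoothApprox (hS : D.IsDiskRealization g S) (n : ℕ) :
    Continuous (D.smoothApprox g n) :=
  (hS.continuous_composed n).1.comp
    ((continuous_const_mul (circlePoint (D.α n))).comp (hS.continuous_composed n).2)

theorem IsDiskRealization.measurePreserving_smoothApprox (hS : D.IsDiskRealization g S) (n : ℕ) :
    MeasurePreserving (D.smoothApprox g n) diskMeasure diskMeasure :=
  (hS.measurePreserving_composed n).1.comp
    ((measurePreserving_rotC _).comp (hS.measurePreserving_composed n).2)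

/-- Only the derivative of order `0` is needed; its norm is that of the value. -/
theorem IsDiskRealization.tendstoUniformlyOn (hS : D.IsDiskRealization g S) :
    TendstoUniformlyOn (D.smoothApprox g) S atTop (Metric.closedBall 0 1) := by
  have h := hS.converges 0
  rw [Metric.tendstoUniformlyOn_iff] at h ⊢
  intro ε hε
  filter_upwards [h ε hε] with n hn w hw
  refine lt_of_le_of_lt ?_ (hn w hw)
  rw [dist_eq_norm, dist_eq_norm,
    ← iteratedFDerivWithin_zero_apply (𝕜 := ℝ) (s := Metric.closedBall 0 1) (f := S) ![],
    ← iteratedFDerivWithin_zero_apply (𝕜 := ℝ) (s := Metric.closedBall 0 1)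
      (f := D.smoothApprox g n) ![]]
  refine le_trans (ContinuousMultilinearMap.le_opNorm (iteratedFDerivWithin ℝ 0 S
    (Metric.closedBall 0 1) w - iteratedFDerivWithin ℝ 0 (D.smoothApprox g n)
    (Metric.closedBall 0 1) w) ![]) ?_
  simp

theorem diskMeasure_compl : diskMeasure (Metric.closedBall 0 1)ᶜ = 0 := by
  rw [diskMeasure, Measure.smul_apply, smul_eq_mul, Measure.restrict_apply
    Metric.isClosed_closedBall.measurableSet.compl, Set.compl_inter_self, measure_empty, mul_zero]

theorem measurePreserving_closedBall_coe : MeasurePreserving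
    (Subtype.val : Metric.closedBall (0 : ℂ) 1 → ℂ) (Measure.comap Subtype.val diskMeasure)
    diskMeasure := by
  have h := measurePreserving_subtype_coe (μa := diskMeasure)
    (Metric.isClosed_closedBall (x := (0 : ℂ)) (ε := 1)).measurableSet
  have hae : ∀ᵐ w ∂diskMeasure, w ∈ Metric.closedBall (0 : ℂ) 1 := diskMeasure_compl
  rwa [Measure.restrict_eq_self_of_ae_mem hae] at h

open Classical in
/-- A map of the plane that agrees with `S` on the unit disk. -/
noncomputable def diskExtension (S : ℂ → ℂ) : ℂ → ℂ := (Metric.closedBall 0 1).piecewise S id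

theorem diskExtension_apply {w : ℂ} (hw : w ∈ Metric.closedBall (0 : ℂ) 1) :
    diskExtension S w = S w := by
  classical
  exact Set.piecewise_eq_of_mem _ _ _ hw

theorem IsDiskRealization.measurable_diskExtension (hS : D.IsDiskRealization g S) :
    Measurable (diskExtension S) := by
  classical
  exact ContinuousOn.measurable_piecewise hS.contDiffOn.continuousOn continuousOn_id
    Metric.isClosed_closedBall.measurableSet

/-- Integrals of bounded continuous functions along the approximations are constant in `n` and
converge to those along the limit. -/
theorem IsDiskRealization.measurePreserving_diskExtension (hS : D.IsDiskRealization g S) :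
    MeasurePreserving (diskExtension S) diskMeasure diskMeasure := by
  refine ⟨hS.measurable_diskExtension, ?_⟩
  have : IsProbabilityMeasure (Measure.map (diskExtension S) diskMeasure) :=
    Measure.isProbabilityMeasure_map hS.measurable_diskExtension.aemeasurable
  refine ext_of_forall_integral_eq_of_IsFiniteMeasure fun F => ?_
  rw [integral_map hS.measurable_diskExtension.aemeasurable
    F.continuous.measurable.aestronglyMeasurable]
  have h1 : Tendsto (fun n => ∫ w, F (D.smoothApprox g n w) ∂diskMeasure) atTop
      (𝓝 (∫ w, F (diskExtension S w) ∂diskMeasure)) := by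
    refine tendsto_integral_of_dominated_convergence (fun _ => ‖F‖) (fun n =>
      (F.continuous.comp (hS.continuous_smoothApprox n)).aestronglyMeasurable)
      (integrable_const _) (fun n => Eventually.of_forall fun w => F.norm_coe_le_norm _) ?_
    have hae : ∀ᵐ w ∂diskMeasure, w ∈ Metric.closedBall (0 : ℂ) 1 := diskMeasure_compl
    filter_upwards [hae] with w hw
    rw [diskExtension_apply hw]
    exact (F.continuous.tendsto _).comp (hS.tendstoUniformlyOn.tendsto_at hw)
  have h2 : ∀ n, ∫ w, F (D.smoothApprox g n w) ∂diskMeasure = ∫ w, F w ∂diskMeasure := by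
    intro n
    conv_rhs => rw [← (hS.measurePreserving_smoothApprox n).map_eq]
    rw [integral_map (hS.measurePreserving_smoothApprox n).measurable.aemeasurable
      F.continuous.measurable.aestronglyMeasurable]
  simp_rw [h2] at h1
  exact tendsto_nhds_unique h1 tendsto_const_nhds

theorem IsDiskRealization.tendsto_symmDiff (hS : D.IsDiskRealization g S) {A : Set ℂ}
    (hA : MeasurableSet A) : Tendsto (fun n => diskMeasure
      ((D.smoothApprox g n ⁻¹' A) ∆ (diskExtension S ⁻¹' A))) atTop (𝓝 0) := by
  have hcoe := measurePreserving_closedBall_coe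
  have : IsFiniteMeasure (Measure.comap (Subtype.val : Metric.closedBall (0 : ℂ) 1 → ℂ)
      diskMeasure) := by
    refine ⟨?_⟩
    rw [← Set.preimage_univ (f := (Subtype.val : Metric.closedBall (0 : ℂ) 1 → ℂ)),
      hcoe.measure_preimage nullMeasurableSet_univ]
    exact measure_lt_top _ _
  set f : ℕ → C(Metric.closedBall (0 : ℂ) 1, ℂ) := fun n =>
    ⟨fun w => D.smoothApprox g n w, (hS.continuous_smoothApprox n).comp continuous_subtype_val⟩
  set f' : C(Metric.closedBall (0 : ℂ) 1, ℂ) :=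
    ⟨fun w => S w, continuousOn_iff_continuous_domRestrict.mp hS.contDiffOn.continuousOn⟩ with hf'
  have hf : Tendsto f atTop (𝓝 f') := by
    rw [ContinuousMap.tendsto_iff_tendstoUniformly]
    exact tendstoUniformlyOn_iff_tendstoUniformly_comp_coe.mp hS.tendstoUniformlyOn
  have hext : ∀ w : Metric.closedBall (0 : ℂ) 1, diskExtension S w = f' w := fun w =>
    diskExtension_apply w.2
  have hmp : MeasurePreserving f' (Measure.comap Subtype.val diskMeasure) diskMeasure := by
    have h := hS.measurePreserving_diskExtension.comp hcoe
    have e : diskExtension S ∘ Subtype.val = f' := funext hext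
    rwa [e] at h
  have key := tendsto_measure_symmDiff_preimage_nhds_zero hf (Eventually.of_forall fun n =>
    (hS.measurePreserving_smoothApprox n).comp hcoe) hmp hA.nullMeasurableSet (measure_ne_top _ _)
  refine key.congr fun n => ?_
  rw [← hcoe.measure_preimage
    (((hS.continuous_smoothApprox n).measurable hA).symmDiff
      (hS.measurable_diskExtension hA)).nullMeasurableSet]
  congr 1
  ext w
  rw [Set.mem_preimage, Set.mem_symmDiff, Set.mem_symmDiff, Set.mem_preimage, Set.mem_preimage,
    Set.mem_preimage, Set.mem_preimage, hext]
  rfl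

end AKData

/-! ### Comparison of the smooth and the abstract approximations -/

theorem abs_sub_le_of_mem_cell {Q N i j : ℕ} {z z' : UnitSquare} (h : z ∈ cell Q N i j)
    (h' : z' ∈ cell Q N i j) :
    |(z.1 : ℝ) - z'.1| ≤ 1 / Q ∧ |(z.2 : ℝ) - z'.2| ≤ 1 / N := by
  obtain ⟨h1, h2, h3, h4⟩ := h
  obtain ⟨h1', h2', h3', h4'⟩ := h'
  rw [add_div] at h2 h4 h2' h4'
  constructor <;> rw [abs_le] <;> constructor <;> linarith

namespace AKData

variable {D : AKData} {g : ℕ → (ℂ ≃ ℂ)} {S : ℂ → ℂ}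

/-- A smooth map that moves small cells as `h n` does agrees with `h n`. -/
theorem Admissible.apply_polar (hD : D.Admissible) {n : ℕ} {L : Set UnitSquare}
    (hL : ∀ m, n < m → ∀ i < D.q m, ∀ j < D.s m, ∀ x ∈ L ∩ D.R m i j,
      g n (polar x) ∈ polar '' (D.h n '' D.R m i j)) {x : UnitSquare} (hx : x ∈ L) :
    g n (polar x) = polar (D.h n x) := by
  -- At each stage `m`, some preimage `z` of `g n (polar x)` shares with `h n x` an atom of `ξ_m`.
  -- The point `z` may depend on `m`, but the atoms shrink, so continuity of `polar` gives equality.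
  have hex : ∀ j : ℕ, ∃ z : UnitSquare, polar z = g n (polar x) ∧
      |(z.1 : ℝ) - (D.h n x).1| ≤ 1 / D.q (j + (n + 1)) ∧
      |(z.2 : ℝ) - (D.h n x).2| ≤ 1 / D.s (j + (n + 1)) := by
    intro j
    set m := j + (n + 1) with hm
    have hq := hD.q_pos m
    have hs := s_pos (D := D) m
    have hi := floor_mul_lt hq x.1
    have hj := floor_mul_lt hs x.2
    have hxR : x ∈ D.R m ⌊(D.q m : ℝ) * (x.1 : ℝ)⌋₊ ⌊(D.s m : ℝ) * (x.2 : ℝ)⌋₊ :=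
      (mem_cell hq hs).mpr ⟨rfl, rfl⟩
    obtain ⟨z, hz, hzx⟩ := hL m (by omega) _ hi _ hj x ⟨hx, hxR⟩
    obtain ⟨i', -, j', -, hcell⟩ := D.permutes n m (by omega) _ hi _ hj
    change D.h n '' D.R m _ _ = D.R m i' j' at hcell
    refine ⟨z, hzx, abs_sub_le_of_mem_cell (i := i') (j := j') ?_ ?_⟩
    · rw [hcell] at hz
      exact hz
    · have h1 : D.h n x ∈ D.h n '' D.R m ⌊(D.q m : ℝ) * (x.1 : ℝ)⌋₊ ⌊(D.s m : ℝ) * (x.2 : ℝ)⌋₊ :=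
        ⟨x, hxR, rfl⟩
      rw [hcell] at h1
      exact h1
  choose z hz h1 h2 using hex
  have hlim : ∀ {a : ℕ → ℕ}, Tendsto a atTop atTop →
      Tendsto (fun j => 1 / (a (j + (n + 1)) : ℝ)) atTop (𝓝 0) := fun ha =>
    tendsto_one_div_atTop_nhds_zero_nat.comp (ha.comp (tendsto_add_atTop_nat (n + 1)))
  have hz1 : Tendsto (fun j => (z j).1) atTop (𝓝 (D.h n x).1) := by
    rw [tendsto_subtype_rng, tendsto_iff_dist_tendsto_zero]
    exact squeeze_zero (fun _ => dist_nonneg) (fun j => by rw [Real.dist_eq]; exact h1 j)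
      (hlim hD.tendsto_q)
  have hz2 : Tendsto (fun j => (z j).2) atTop (𝓝 (D.h n x).2) := by
    rw [tendsto_subtype_rng, tendsto_iff_dist_tendsto_zero]
    exact squeeze_zero (fun _ => dist_nonneg) (fun j => by rw [Real.dist_eq]; exact h2 j)
      (hlim hD.req1)
  have h3 : Tendsto (fun j => polar (z j)) atTop (𝓝 (polar (D.h n x))) :=
    (continuous_polar.tendsto (D.h n x)).comp (hz1.prodMk_nhds hz2)
  simp_rw [hz] at h3
  exact tendsto_nhds_unique tendsto_const_nhds h3

/-- The map `H_n ∘ polar ∘ (h_1 ∘ ⋯ ∘ h_n)⁻¹` between the `n`-th abstract and smooth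
approximations. -/
noncomputable def conjugacy (D : AKData) (g : ℕ → (ℂ ≃ ℂ)) (n : ℕ) (x : UnitSquare) : ℂ :=
  composed g n (polar ((D.Zmap (MeasurableEquiv.refl UnitSquare) n).symm x))

theorem conjugacy_approx (n : ℕ) (x : UnitSquare) :
    conjugacy D g n (D.approx (MeasurableEquiv.refl UnitSquare) n x)
      = D.smoothApprox g n (conjugacy D g n x) := by
  rw [conjugacy, approx, MeasurableEquiv.symm_apply_apply, polar_rot, smoothApprox, conjugacy,
    Equiv.symm_apply_apply]

theorem measurePreserving_approx (n : ℕ) :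
    MeasurePreserving (D.approx (MeasurableEquiv.refl UnitSquare) n) lebesgue lebesgue := by
  have h := measurePreserving_Zmap (D := D) _ measurePreserving_refl n
  exact h.comp ((measurePreserving_rot _).comp (h.symm _))

theorem IsDiskRealization.measurePreserving_conjugacy (hS : D.IsDiskRealization g S) (n : ℕ) :
    MeasurePreserving (conjugacy D g n) lebesgue diskMeasure :=
  (hS.measurePreserving_composed n).1.comp (measurePreserving_polar.comp
    ((measurePreserving_Zmap (D := D) _ measurePreserving_refl n).symm _))

/-- Consecutive maps can differ only where `g_{n+1}` and `h_{n+1}` disagree in polar coordinates,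
and these sets have summable measure. -/
theorem IsDiskRealization.ae_eventually_conjugacy_succ (hS : D.IsDiskRealization g S)
    (hD : D.Admissible) :
    ∀ᵐ x ∂lebesgue, ∀ᶠ n in atTop, conjugacy D g (n + 1) x = conjugacy D g n x := by
  obtain ⟨ε, hε, hL⟩ := hS.obeys
  choose L hLm hLε hL using hL
  set E : ℕ → Set UnitSquare := fun n =>
    (D.Zmap (MeasurableEquiv.refl UnitSquare) (n + 1)).symm ⁻¹' (L n)ᶜ with hE
  have hEle : ∀ n, lebesgue (E n) ≤ ε n := fun n => by
    rw [hE, ((measurePreserving_Zmap (D := D) _ measurePreserving_refl (n + 1)).symm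
      _).measure_preimage (hLm n).compl.nullMeasurableSet]
    exact hLε n
  filter_upwards [ae_eventually_notMem (ne_top_of_le_ne_top hε (ENNReal.tsum_le_tsum hEle))]
    with x hx
  filter_upwards [hx] with n hn
  have hmem : (D.Zmap (MeasurableEquiv.refl UnitSquare) (n + 1)).symm x ∈ L n := by
    by_contra h
    exact hn h
  have h1 := hD.apply_polar (hL n) hmem
  have h2 : D.h n ((D.Zmap (MeasurableEquiv.refl UnitSquare) (n + 1)).symm x)
      = (D.Zmap (MeasurableEquiv.refl UnitSquare) n).symm x :=
    (D.h n).apply_symm_apply _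
  rw [h2] at h1
  exact congrArg (composed g n) h1

theorem IsDiskRealization.exists_limit_conjugacy (hS : D.IsDiskRealization g S)
    (hD : D.Admissible) : ∃ K : UnitSquare → ℂ, Measurable K ∧
      ∀ᵐ x ∂lebesgue, ∀ᶠ n in atTop, conjugacy D g n x = K x := by
  have hconst : ∀ᵐ x ∂lebesgue, ∃ w, ∀ᶠ n in atTop, conjugacy D g n x = w := by
    filter_upwards [hS.ae_eventually_conjugacy_succ hD] with x hx
    obtain ⟨N, hN⟩ := eventually_atTop.mp hx
    refine ⟨conjugacy D g N x, eventually_atTop.mpr ⟨N, fun n hn => ?_⟩⟩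
    induction n, hn using Nat.le_induction with
    | base => rfl
    | succ n hn ih => rw [hN n hn, ih]
  obtain ⟨K, hK, hlim⟩ := measurable_limit_of_tendsto_metrizable_ae
    (fun n => (hS.measurePreserving_conjugacy n).measurable.aemeasurable)
    (hconst.mono fun x ⟨w, hw⟩ => ⟨w, tendsto_const_nhds.congr' (hw.mono fun _ h => h.symm)⟩)
  refine ⟨K, hK, ?_⟩
  filter_upwards [hconst, hlim] with x ⟨w, hw⟩ hx
  rwa [tendsto_nhds_unique hx (tendsto_const_nhds.congr' (hw.mono fun _ h => h.symm))]

theorem IsDiskRealization.measurePreserving_limit (hS : D.IsDiskRealization g S)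
    {K : UnitSquare → ℂ} (hK : Measurable K)
    (hlim : ∀ᵐ x ∂lebesgue, ∀ᶠ n in atTop, conjugacy D g n x = K x) :
    MeasurePreserving K lebesgue diskMeasure := by
  refine ⟨hK, Measure.ext fun C hC => ?_⟩
  rw [Measure.map_apply hK hC]
  have h := tendsto_measure_of_ae_tendsto_indicator_of_isFiniteMeasure (μ := lebesgue) atTop
    (hK hC) (fun n => (hS.measurePreserving_conjugacy n).measurable hC)
    (hlim.mono fun x hx => hx.mono fun n hn => by
      rw [Set.mem_preimage, Set.mem_preimage, hn])
  simp_rw [(hS.measurePreserving_conjugacy _).measure_preimage hC.nullMeasurableSet] at h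
  exact tendsto_nhds_unique h tendsto_const_nhds

/-- For two good points the limit is attained at a common stage, where the map is injective off the
fibre over the centre of the disk. -/
theorem exists_leftInverse_limit {K : UnitSquare → ℂ} (hK : Measurable K)
    (hlim : ∀ᵐ x ∂lebesgue, ∀ᶠ n in atTop, conjugacy D g n x = K x) :
    ∃ κ : ℂ → UnitSquare, Measurable κ ∧ ∀ᵐ x ∂lebesgue, κ (K x) = x := by
  have : Nonempty UnitSquare := ⟨(⟨0, by norm_num⟩, ⟨0, by norm_num⟩)⟩
  have hgood : ∀ᵐ x ∂lebesgue, (∀ᶠ n in atTop, conjugacy D g n x = K x) ∧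
      ∀ n, (((D.Zmap (MeasurableEquiv.refl UnitSquare) n).symm x).2 : ℝ) ≠ 0 :=
    hlim.and (ae_all_iff.mpr fun n => ((measurePreserving_Zmap (D := D) _ measurePreserving_refl
      n).symm _).quasiMeasurePreserving.ae ae_snd_ne_zero)
  obtain ⟨t, ht, htm, ht0⟩ := exists_measurable_superset_of_null hgood
  have htc : ∀ x ∈ tᶜ, (∀ᶠ n in atTop, conjugacy D g n x = K x) ∧
      ∀ n, (((D.Zmap (MeasurableEquiv.refl UnitSquare) n).symm x).2 : ℝ) ≠ 0 := fun x hx => by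
    by_contra h
    exact hx (ht h)
  obtain ⟨κ, hκ, hκK⟩ := exists_measurable_leftInverse hK htm.compl fun x hx x' hx' h => by
    obtain ⟨n, h1, h2⟩ := ((htc x hx).1.and (htc x' hx').1).exists
    rw [← h1, ← h2] at h
    exact (D.Zmap (MeasurableEquiv.refl UnitSquare) n).symm.injective
      (polar_injective ((htc x hx).2 n) ((composed g n).injective h))
  have hae : ∀ᵐ x ∂lebesgue, x ∈ tᶜ := by
    change lebesgue tᶜᶜ = 0
    rwa [compl_compl]
  exact ⟨κ, hκ, hae.mono hκK⟩

/-- Pulled back to the square by the limit `K` of the conjugacies, the diffeomorphism is a weak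
limit of the `T_n`, so `limName` intertwines it with the shift. -/
theorem IsDiskRealization.exists_isSystemIso (hS : D.IsDiskRealization g S) (hD : D.Admissible) :
    ∃ φ : ℂ → (ℤ → Symb ℕ), IsSystemIso diskMeasure S D.nameLaw shift φ := by
  obtain ⟨K, hK, hlim⟩ := hS.exists_limit_conjugacy hD
  obtain ⟨κ, hκ, hκK⟩ := exists_leftInverse_limit hK hlim
  have hKmp := hS.measurePreserving_limit hK hlim
  have hκmp := hKmp.of_leftInverse hκ hκK
  have hKκ := hKmp.ae_rightInverse hκ hκK
  set Z₀ := MeasurableEquiv.refl UnitSquare with hZ₀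
  set τ : UnitSquare → UnitSquare := κ ∘ diskExtension S ∘ K with hτ
  have hτmp : MeasurePreserving τ lebesgue lebesgue :=
    hκmp.comp (hS.measurePreserving_diskExtension.comp hKmp)
  set E : ℕ → Set UnitSquare := fun n => {x | conjugacy D g n x ≠ K x} with hE
  have hEm : ∀ n, MeasurableSet (E n) := fun n =>
    (measurableSet_eq_fun (hS.measurePreserving_conjugacy n).measurable hK).compl
  have hE0 : Tendsto (fun n => lebesgue (E n)) atTop (𝓝 0) := by
    rw [← measure_empty (μ := lebesgue)]
    refine tendsto_measure_of_ae_tendsto_indicator_of_isFiniteMeasure atTop MeasurableSet.empty hEm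
      (hlim.mono fun x hx => hx.mono fun n hn => ?_)
    exact iff_of_false (fun h => h hn) (Set.notMem_empty x)
  have hweak : ∀ C, MeasurableSet C →
      Tendsto (fun n => lebesgue (D.approx Z₀ n ⁻¹' C \ τ ⁻¹' C)) atTop (𝓝 0) := by
    intro C hC
    have hA : MeasurableSet (κ ⁻¹' C) := hκ hC
    have hb : Tendsto (fun n => diskMeasure ((D.smoothApprox g n ⁻¹' (κ ⁻¹' C)) ∆
        (diskExtension S ⁻¹' (κ ⁻¹' C))) + (lebesgue (E n) + lebesgue (E n))) atTop
        (𝓝 (0 + (0 + 0))) := (hS.tendsto_symmDiff hA).add (hE0.add hE0)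
    rw [add_zero, add_zero] at hb
    refine tendsto_of_tendsto_of_tendsto_of_le_of_le tendsto_const_nhds hb (fun _ => zero_le)
      fun n => ?_
    have happ := measurePreserving_approx (D := D) n
    rw [← hKmp.measure_preimage (((hS.continuous_smoothApprox n).measurable hA).symmDiff
      (hS.measurable_diskExtension hA)).nullMeasurableSet]
    nth_rewrite 2 [← happ.measure_preimage (hEm n).nullMeasurableSet]
    refine le_trans (measure_mono_ae ?_) ((measure_union_le _ _).trans
      (add_le_add_right (measure_union_le _ _) _))
    -- Where the conjugacy of stage `n` equals `K` both at `x` and at `T_n x`, the smooth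
    -- approximation sends `K x` to `K (T_n x)`, so a discrepancy is seen in the disk. Elsewhere it
    -- is paid for by `E n` and its preimage under `T_n`.
    filter_upwards [happ.quasiMeasurePreserving.ae hκK] with x hx hxC
    obtain ⟨h1, h2⟩ := hxC
    by_cases hx1 : conjugacy D g n x = K x
    · by_cases hx2 : conjugacy D g n (D.approx Z₀ n x) = K (D.approx Z₀ n x)
      · refine Or.inl (Or.inl ⟨?_, h2⟩)
        change κ (D.smoothApprox g n (K x)) ∈ C
        rw [← hx1, ← conjugacy_approx, hx2, hx]
        exact h1
      · exact Or.inr (Or.inr hx2)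
    · exact Or.inr (Or.inl hx1)
  have hshift := hD.ae_limName_apply measurePreserving_refl hτmp hweak
  obtain ⟨ψ, hψ, hψn⟩ := hD.exists_limName_leftInverse measurePreserving_refl
  refine ⟨D.limName Z₀ ∘ κ, isSystemIso_of_leftInverse
    ((measurePreserving_limName measurePreserving_refl).comp hκmp) ?_ (hK.comp hψ) ?_⟩
  · have hae : ∀ᵐ w ∂diskMeasure, w ∈ Metric.closedBall (0 : ℂ) 1 := diskMeasure_compl
    filter_upwards [hκmp.quasiMeasurePreserving.ae hshift, hKκ, hae] with w h1 h2 h3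
    rw [hτ, Function.comp_apply, Function.comp_apply, h2, diskExtension_apply h3] at h1
    exact h1
  · filter_upwards [hκmp.quasiMeasurePreserving.ae hψn, hKκ] with w h1 h2
    change K (ψ (D.limName Z₀ (κ w))) = w
    rw [h1, h2]

end AKData

/-! ### The growth condition -/

theorem coefPQ_congr {k k' l l' : ℕ → ℕ} {n : ℕ} (hk : ∀ i < n, k i = k' i)
    (hl : ∀ i < n, l i = l' i) : coefPQ k l n = coefPQ k' l' n := by
  induction n with
  | zero => rfl
  | succ n ih =>
    rw [coefPQ, coefPQ, ih (fun i hi => hk i (by omega)) (fun i hi => hl i (by omega)),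
      hk n (by omega), hl n (by omega)]

/-- The lower bounds `l*_n` for the coefficients `l_n`. -/
def growthBound (n : ℕ) (k : Fin (n + 1) → ℕ) (l : Fin n → ℕ) : ℕ :=
  -- The values `1` outside the given ranges are never used: `coefQ` at `n` depends only on
  -- coefficients with index below `n`.
  2 ^ (n + 2) * coefQ (fun i => if h : i < n + 1 then k ⟨i, h⟩ else 1)
    (fun i => if h : i < n then l ⟨i, h⟩ else 1) n * k (Fin.last n)

theorem AKData.GrowsFasterThan.admissible {D : AKData} (h : D.GrowsFasterThan growthBound)
    (h1 : D.Requirement1) (h2 : D.Requirement2) (h3 : D.Requirement3) : D.Admissible := by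
  refine ⟨h1, h2, h3, fun n => ?_⟩
  have hn := h n
  rw [growthBound, coefQ, coefPQ_congr (k' := D.k) (l' := D.l)
    (fun i hi => dif_pos (by omega)) (fun i hi => dif_pos hi)] at hn
  exact hn

theorem theorem6 :
    ∃ lstar : (n : ℕ) → (Fin (n + 1) → ℕ) → (Fin n → ℕ) → ℕ,
    ∀ D : AKData, D.Requirement1 → D.Requirement2 → D.Requirement3 → D.GrowsFasterThan lstar →
      -- the words of the towers, and how they are built from the prewords
      (∀ n, (D.words n).ncard = D.s n) ∧
      (∀ n, D.words (n + 1) = circOp (D.l n) (D.p n) (D.q n) '' D.prewords n) ∧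
      (∀ n, ∀ v ∈ D.prewords n, v.length = D.k n ∧ (∀ w ∈ v, w ∈ D.words n) ∧
        ∀ w ∈ D.words n, Set.ncard {t : ℕ | v[t]? = some w} = D.k n / D.s n) ∧
      -- they form a strongly uniform circular construction sequence
      ((∀ n, UniquelyReadable (D.prewords n)) →
        IsCircularConstruction {a : ℕ | a < D.s 0} D.k D.l D.prewords D.words ∧
        IsStronglyUniform D.words) ∧
      -- the unique non-atomic invariant measure
      ∃ ν : Measure (ℤ → Symb ℕ),
        IsNonatomicInvariant D.K ν ∧
        (∀ ν' : Measure (ℤ → Symb ℕ), IsNonatomicInvariant D.K ν' → ν' = ν) ∧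
        Ergodic shift ν ∧
        -- the transformation built by the abstract method
        (∀ (X : Type u) [MeasurableSpace X] (μ : Measure X) (Z : UnitSquare ≃ᵐ X) (T : X ≃ᵐ X),
          MeasurePreserving Z lebesgue μ → MeasurePreserving T μ μ → D.IsLimit Z μ T →
          -- the names of points consist of the words of the towers
          (∀ᵐ x ∂μ, ∀ᶠ n in atTop, ∀ i < D.q n, ∀ σ < D.s n,
            x ∈ D.Zmap Z n '' D.R n i σ →
              block (D.name Z T x) (-(dynIndex (D.p n) (D.q n) i : ℤ)) (D.q n)
                = D.towerWord n σ) ∧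
          -- the name map is one-to-one on a set of measure one, and its range carries `ν`
          (∃ X₀ : Set X, MeasurableSet X₀ ∧ μ X₀ᶜ = 0 ∧ Set.InjOn (D.name Z T) X₀ ∧
            Set.MapsTo (D.name Z T) X₀ (coreSet D.words) ∧
            MeasurableSet (D.name Z T '' X₀) ∧ ν (D.name Z T '' X₀)ᶜ = 0) ∧
          IsSystemIso μ T ν shift (D.name Z T) ∧
          Ergodic T μ) ∧
        -- the diffeomorphisms of the disk built by the smooth method
        (∀ (g : ℕ → (ℂ ≃ ℂ)) (S : ℂ → ℂ), D.IsDiskRealization g S →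
          ∃ φ : ℂ → (ℤ → Symb ℕ), IsSystemIso diskMeasure S ν shift φ) := by
  refine ⟨growthBound, fun D h1 h2 h3 hgrow => ?_⟩
  have hD := hgrow.admissible h1 h2 h3
  refine ⟨fun n => hD.ncard_words n, fun n => AKData.words_succ n, fun n v hv => ?_,
    fun hP => ⟨hD.isCircularConstruction hP, hD.isStronglyUniform hP⟩, D.nameLaw,
    hD.isNonatomicInvariant_nameLaw, fun ν' hν' => hD.eq_nameLaw hν', hD.ergodic_nameLaw,
    fun X _ μ Z T hZ hT hlim => ?_, fun g S hS => hS.exists_isSystemIso hD⟩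
  · obtain ⟨h4, h5⟩ := AKData.prewords_spec hv
    exact ⟨h4, h5, fun w hw => hD.ncard_preword hv hw⟩
  · have hiso := hD.isSystemIso_name hZ hT hlim
    exact ⟨hD.ae_block_name hZ hT hlim, hD.exists_embedding_set hZ hT hlim, hiso,
      hiso.ergodic hT hD.ergodic_nameLaw⟩
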